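/- **Theorem 2 (stability of GIC-1 and GIC-2).** Consider a manipulator with six revolute joints: forward kinematics $q\mapsto g(q)=(R(q),p(q))\in SE(3)$ of class $C^3$ and symmetric positive definite inertia matrix $q\mapsto M(q)\in\mathbb R^{6\times 6}$ of class $C^2$, both $2\pi$-periodic in each joint angle, a gravity term $G(q)\in\mathbb R^6$, the Coriolis matrix $C(q,\dot q)$ given by the Christoffel symbols of $M$, and the body Jacobian $J_b(q)$, defined by $V^b=J_b(q)\dot q$, $\dot g=g\hat V^b$. Its dynamics on $SE(3)$ without external disturbance are $$\tilde M\dot V^b+\tilde C V^b+\tilde G=\tilde T,\qquad \tilde M=J_b^{-T}MJ_b^{-1},\quad \tilde C=J_b^{-T}(C-MJ_b^{-1}\dot J_b)J_b^{-1},\quad \tilde G=J_b^{-T}G .$$ Let $D\subset SE(3)$ be open, such that $J_b(q)$ is non-singular whenever $g(q)\in D$; the end-effector moves in $D$. Let $g_d=(R_d,p_d):[0,\infty)\to SE(3)$ be a desired trajectory with reachable positions that stays in a compact subset of $D$, with $\dot g_d=g_d\hat V_d$, where $V_d$ is differentiable and bounded. Put $$g_{de}=g_d^{-1}g,\qquad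 V_d^*=\mathrm{Ad}_{g_{de}^{-1}}V_d,\qquad e_V=V^b-V_d^*,\qquad \hat\xi_{de}=\log g_{de},$$ and, for symmetric positive definite $K_p,K_R\in\mathbb R^{3\times3}$ and $K_\xi,K_d\in\mathbb R^{6\times 6}$, consider for $i=1,2$ the control laws $$\tilde T_i=\tilde M\dot V_d^*+\tilde CV_d^*+\tilde G-f_{G,i}-K_de_V,$$ $$f_{G,1}=\begin{bmatrix}R^TR_dK_pR_d^T(p-p_d)\\(K_RR_d^TR-R^TR_dK_R)^\vee\end{bmatrix}\ (\text{GIC-1}),\qquad f_{G,2}=K_\xi\,\xi_{de}\ (\text{GIC-2}).$$ Then, for each $i\in\{1,2\}$, the equilibrium $(g_{de},e_V)=(I,0)$ of the closed-loop system is asymptotically stable, uniformly in the initial time $t_0\ge 0$. That is, with the error $\|I-g_{de}\|_F+\|e_V\|$: motions whose error at time $t_0$ is sufficiently small exist in $D$ for all $t\ge t_0$; for every $\varepsilon>0$ there is $\delta>0$ such that an initial error below $\delta$ keeps the error below $\varepsilon$ for all later times; and there is $\delta>0$ such that for every $\varepsilon>0$ there is $\tau\ge 0$ such that an initial error below $\delta$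 gives an error below $\varepsilon$ from time $t_0+\tau$ on. Here $\delta$ and $\tau$ do not depend on $t_0$. -/

import Mathlib

open Set Matrix

noncomputable section

namespace GIC

/-! ### Rigid motions, twists -/

/-- Index set with six elements. It labels the coordinates of a twist `V = [v; ω]` (the left summand
is the translational part `v`, the right summand the rotational part `ω`) and also the six joints
of the manipulator. -/
abbrev Ix : Type := Fin 3 ⊕ Fin 3

/-- Vectors of `ℝ⁶`. -/
abbrev Vec6 : Type := Ix → ℝ

/-- Real `6 × 6` matrices. -/
abbrev Mat6 : Type := Matrix Ix Ix ℝ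

/-- Real `3 × 3` matrices. -/
abbrev Mat3 : Type := Matrix (Fin 3) (Fin 3) ℝ

/-- Real `4 × 4` matrices, in `3 + 1` blocks. -/
abbrev Mat4 : Type := Matrix (Fin 3 ⊕ Unit) (Fin 3 ⊕ Unit) ℝ

/-- Translational part `v` of `V = [v; ω]`. -/
def lin (V : Vec6) : Fin 3 → ℝ := fun i => V (Sum.inl i)

/-- Rotational part `ω` of `V = [v; ω]`. -/
def ang (V : Vec6) : Fin 3 → ℝ := fun i => V (Sum.inr i)

/-- Euclidean norm of a real vector. -/
def euclNorm {ι : Type} [Fintype ι] (x : ι → ℝ) : ℝ := Real.sqrt (∑ i, x i ^ 2)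

/-- Frobenius norm of a `4 × 4` matrix, `√(tr (XᵀX))`. -/
def frobenius (X : Mat4) : ℝ := Real.sqrt (Xᵀ * X).trace

/-- The hat map `ℝ³ → so(3)`, `ω̂ x = ω × x`. -/
def skew (w : Fin 3 → ℝ) : Mat3 :=
  !![0, -w 2, w 1; w 2, 0, -w 0; -w 1, w 0, 0]

/-- The vee map `so(3) → ℝ³`, inverse of `skew`. -/
def unskew (X : Mat3) : Fin 3 → ℝ := ![X 2 1, X 0 2, X 1 0]

/-- The block matrix `[R p; 0 1]`. -/
def homog (R : Mat3) (p : Fin 3 → ℝ) : Mat4 :=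
  fromBlocks R (Matrix.of fun i _ => p i) 0 1

/-- `SE(3)` in homogeneous matrix representation. -/
def SE3 : Set Mat4 :=
  {g | ∃ R ∈ Matrix.specialOrthogonalGroup (Fin 3) ℝ, ∃ p : Fin 3 → ℝ, g = homog R p}

/-- Rotational part `R` of `g = (R, p)`. -/
def rot (g : Mat4) : Mat3 := g.toBlocks₁₁

/-- Translational part `p` of `g = (R, p)`. -/
def pos (g : Mat4) : Fin 3 → ℝ := fun i => g (Sum.inl i) (Sum.inr ())

/-- The hat map `ℝ⁶ → se(3)`, `V̂ = [ω̂ v; 0 0]`. -/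
def hat (V : Vec6) : Mat4 :=
  fromBlocks (skew (ang V)) (Matrix.of fun i _ => lin V i) 0 0

/-- The vee map `se(3) → ℝ⁶`, inverse of `hat`. -/
def vee (X : Mat4) : Vec6 := Sum.elim (pos X) (unskew (rot X))

/-- The matrix of `Ad_g` on `ℝ⁶`, `[R p̂R; 0 R]`. -/
def Ad (g : Mat4) : Mat6 :=
  fromBlocks (rot g) (skew (pos g) * rot g) 0 (rot g)

/-- Configuration error `g_de = g_d⁻¹ g`. -/
def gde (g gd : Mat4) : Mat4 := gd⁻¹ * g

/-! ### The logarithm on `SE(3)` -/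

/-- The rotation angle `φ ∈ [0, π]` of `R`, `cos φ = (tr R - 1) / 2`. -/
def rotAngle (R : Mat3) : ℝ := Real.arccos ((R.trace - 1) / 2)

/-- The vector `ψ` with `ψ̂ = log R = φ / (2 sin φ) (R - Rᵀ)`, for `tr R ≠ -1`.
(At `R = 1` the formula reads `0 / 0 * 0 = 0`, which is the value of the logarithm.) -/
def logSO3 (R : Mat3) : Fin 3 → ℝ :=
  unskew ((rotAngle R / (2 * Real.sin (rotAngle R))) • (R - Rᵀ))

/-- `α(y) = (y / 2) cot (y / 2)`. -/
def alpha (y : ℝ) : ℝ := y / 2 * Real.cot (y / 2)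

/-- `A⁻¹(ψ) = I - ψ̂ / 2 + (1 - α(‖ψ‖)) ψ̂² / ‖ψ‖²` (equal to `I` at `ψ = 0`). -/
def Ainv (w : Fin 3 → ℝ) : Mat3 :=
  1 - (1 / 2 : ℝ) • skew w + ((1 - alpha (euclNorm w)) / euclNorm w ^ 2) • (skew w * skew w)

/-- Exponential coordinates `ξ = [A⁻¹(ψ) p; ψ]` of `g = (R, p)`, `ξ̂ = log g`, for `tr R ≠ -1`. -/
def logSE3 (g : Mat4) : Vec6 :=
  Sum.elim (Ainv (logSO3 (rot g)) *ᵥ pos g) (logSO3 (rot g))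

/-! ### The manipulator -/

/-- A manipulator with six revolute joints. Functions of the joint angles are written as functions
on `ℝ⁶` that are `2π`-periodic in each joint angle. -/
structure Manipulator where
  /-- forward kinematics: the configuration `g(q) = (R(q), p(q))` of the end-effector -/
  g : Vec6 → Mat4
  /-- joint space inertia matrix `M(q)` -/
  M : Vec6 → Mat6
  /-- gravity term `G(q)` -/
  G : Vec6 → Vec6
  g_mem : ∀ q, g q ∈ SE3
  g_smooth : ∀ i j, ContDiff ℝ 3 fun q => g q i j
  g_periodic : ∀ q k, g (q + Pi.single k (2 * Real.pi)) = g q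
  M_posDef : ∀ q, (M q).PosDef
  M_smooth : ∀ i j, ContDiff ℝ 2 fun q => M q i j
  M_periodic : ∀ q k, M (q + Pi.single k (2 * Real.pi)) = M q

namespace Manipulator

variable (𝓜 : Manipulator)

/-- Body Jacobian `J_b(q)`: the `k`-th column is `(g⁻¹ ∂g/∂q_k)^∨`, so that `V^b = J_b(q) q̇`. -/
def J (q : Vec6) : Mat6 :=
  Matrix.of fun i k =>
    vee ((𝓜.g q)⁻¹ * Matrix.of fun a b => fderiv ℝ (fun x => 𝓜.g x a b) q (Pi.single k 1)) i

/-- `J̇`, the derivative of `J_b(q)` along the joint velocity `v`. -/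
def Jdot (q v : Vec6) : Mat6 :=
  Matrix.of fun i k => fderiv ℝ (fun x => 𝓜.J x i k) q v

/-- `∂M_ij / ∂q_k`. -/
def dM (i j k : Ix) (q : Vec6) : ℝ := fderiv ℝ (fun x => 𝓜.M x i j) q (Pi.single k 1)

/-- Coriolis matrix `C(q, q̇)` of the Lagrangian dynamics (Christoffel symbols of `M`). -/
def C (q v : Vec6) : Mat6 :=
  Matrix.of fun i j => ∑ k, (𝓜.dM i j k q + 𝓜.dM i k j q - 𝓜.dM k j i q) / 2 * v k

/-- `M̃ = J⁻ᵀ M J⁻¹`. -/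
def Mt (q : Vec6) : Mat6 := ((𝓜.J q)⁻¹)ᵀ * 𝓜.M q * (𝓜.J q)⁻¹

/-- `C̃ = J⁻ᵀ (C - M J⁻¹ J̇) J⁻¹`. -/
def Ct (q v : Vec6) : Mat6 :=
  ((𝓜.J q)⁻¹)ᵀ * (𝓜.C q v - 𝓜.M q * (𝓜.J q)⁻¹ * 𝓜.Jdot q v) * (𝓜.J q)⁻¹

/-- `G̃ = J⁻ᵀ G`. -/
def Gt (q : Vec6) : Vec6 := ((𝓜.J q)⁻¹)ᵀ *ᵥ 𝓜.G q

end Manipulator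

/-! ### Velocity error, control laws -/

/-- Desired velocity in the body frame of the end-effector, `V_d^* = Ad_{g_de⁻¹} V_d`. -/
def Vstar (g gd : Mat4) (Vd : Vec6) : Vec6 := Ad ((gde g gd)⁻¹) *ᵥ Vd

/-- Velocity error `e_V = V^b - V_d^*`, with `V^b = J_b(q) q̇`. -/
def eV (𝓜 : Manipulator) (gd : Mat4) (Vd q v : Vec6) : Vec6 :=
  𝓜.J q *ᵥ v - Vstar (𝓜.g q) gd Vd

/-- Elastic force of GIC-1, `[RᵀR_d K_p R_dᵀ(p - p_d); (K_R R_dᵀR - RᵀR_d K_R)^∨]`. -/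
def force1 (Kp KR : Mat3) (g gd : Mat4) : Vec6 :=
  Sum.elim (((rot g)ᵀ * rot gd * Kp * (rot gd)ᵀ) *ᵥ (pos g - pos gd))
    (unskew (KR * (rot gd)ᵀ * rot g - (rot g)ᵀ * rot gd * KR))

/-- Elastic force of GIC-2, `K_ξ ξ_de` with `ξ̂_de = log g_de`. -/
def force2 (Kξ : Mat6) (g gd : Mat4) : Vec6 := Kξ *ᵥ logSE3 (gde g gd)

/-- The control law `T̃ = M̃ V̇_d^* + C̃ V_d^* + G̃ - f_G - K_d e_V` at time `t`, along a joint
motion `q` with joint velocity `v` that starts at time `t₀`. -/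
def control (𝓜 : Manipulator) (gd : ℝ → Mat4) (Vd : ℝ → Vec6) (fG : Mat4 → Mat4 → Vec6)
    (Kd : Mat6) (t₀ : ℝ) (q v : ℝ → Vec6) (t : ℝ) : Vec6 :=
  𝓜.Mt (q t) *ᵥ derivWithin (fun s => Vstar (𝓜.g (q s)) (gd s) (Vd s)) (Ici t₀) t
    + 𝓜.Ct (q t) (v t) *ᵥ Vstar (𝓜.g (q t)) (gd t) (Vd t)
    + 𝓜.Gt (q t)
    - fG (𝓜.g (q t)) (gd t)
    - Kd *ᵥ eV 𝓜 (gd t) (Vd t) (q t) (v t)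

/-! ### Operating assumptions -/

/-- The manipulator can be operated in the region `D` and the desired trajectory `g_d`, with body
velocity `V_d`, is admissible. -/
structure Admissible (𝓜 : Manipulator) (D : Set Mat4) (gd : ℝ → Mat4) (Vd : ℝ → Vec6) : Prop where
  /-- `D` is an open subset of `SE(3)` ... -/
  region : ∃ U : Set Mat4, IsOpen U ∧ D = SE3 ∩ U
  /-- ... on which the body Jacobian is non-singular. -/
  nonsingular : ∀ q, 𝓜.g q ∈ D → IsUnit (𝓜.J q)
  /-- The desired trajectory stays in a compact part of `D`, -/
  desired_mem : ∃ K : Set Mat4, IsCompact K ∧ K ⊆ D ∧ ∀ t, 0 ≤ t → gd t ∈ K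
  /-- its positions are reachable, -/
  reachable : ∀ t, 0 ≤ t → pos (gd t) ∈ Set.range fun q => pos (𝓜.g q)
  /-- it satisfies `ġ_d = g_d V̂_d`, -/
  kinematics : ∀ t, 0 ≤ t → ∀ i j,
    HasDerivWithinAt (fun s => gd s i j) ((gd t * hat (Vd t)) i j) (Ici 0) t
  /-- and its velocity is differentiable (the control law contains `V̇_d`) -/
  velocity_diff : DifferentiableOn ℝ Vd (Ici 0)
  /-- and bounded. -/
  velocity_bdd : ∃ b : ℝ, ∀ t, 0 ≤ t → euclNorm (Vd t) ≤ b

/-! ### Closed loop and stability -/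

/-- `q`, with velocity `v`, is a motion of the closed-loop system without external disturbance on
`[t₀, T)`: the end-effector lies in `D` and `M̃ V̇^b + C̃ V^b + G̃ = T̃`. Derivatives are one-sided
at `t₀`. -/
structure IsMotion (𝓜 : Manipulator) (D : Set Mat4) (gd : ℝ → Mat4) (Vd : ℝ → Vec6)
    (fG : Mat4 → Mat4 → Vec6) (Kd : Mat6) (t₀ : ℝ) (T : EReal) (q v : ℝ → Vec6) : Prop where
  mem : ∀ t : ℝ, t₀ ≤ t → (t : EReal) < T → 𝓜.g (q t) ∈ D
  velocity : ∀ t : ℝ, t₀ ≤ t → (t : EReal) < T → HasDerivWithinAt q (v t) (Ici t₀) t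
  acceleration : ∀ t : ℝ, t₀ ≤ t → (t : EReal) < T → DifferentiableWithinAt ℝ v (Ici t₀) t
  dynamics : ∀ t : ℝ, t₀ ≤ t → (t : EReal) < T →
    𝓜.Mt (q t) *ᵥ derivWithin (fun s => 𝓜.J (q s) *ᵥ v s) (Ici t₀) t
      + 𝓜.Ct (q t) (v t) *ᵥ (𝓜.J (q t) *ᵥ v t) + 𝓜.Gt (q t)
      = control 𝓜 gd Vd fG Kd t₀ q v t

/-- Size of the error state `(g_de, e_V)`, that is, its distance `‖I - g_de‖_F + ‖e_V‖` from the
equilibrium `(I, 0)`. -/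
def err (𝓜 : Manipulator) (gd : Mat4) (Vd q v : Vec6) : ℝ :=
  frobenius (1 - gde (𝓜.g q) gd) + euclNorm (eV 𝓜 gd Vd q v)

/-- The equilibrium `(g_de, e_V) = (I, 0)` of the closed-loop system is (uniformly in the initial
time) asymptotically stable: motions with small initial error exist for all time, they keep the
error small (Lyapunov stability), and their error converges to zero (attractivity). -/
structure AsymptoticallyStable (𝓜 : Manipulator) (D : Set Mat4) (gd : ℝ → Mat4) (Vd : ℝ → Vec6)
    (fG : Mat4 → Mat4 → Vec6) (Kd : Mat6) : Prop where
  exists_motion : ∃ δ > 0, ∀ t₀ : ℝ, 0 ≤ t₀ → ∀ q₀ v₀ : Vec6,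
    err 𝓜 (gd t₀) (Vd t₀) q₀ v₀ < δ →
      ∃ q v : ℝ → Vec6, IsMotion 𝓜 D gd Vd fG Kd t₀ ⊤ q v ∧ q t₀ = q₀ ∧ v t₀ = v₀
  stable : ∀ ε > 0, ∃ δ > 0, ∀ t₀ : ℝ, 0 ≤ t₀ → ∀ T : EReal, ∀ q v : ℝ → Vec6,
    IsMotion 𝓜 D gd Vd fG Kd t₀ T q v → err 𝓜 (gd t₀) (Vd t₀) (q t₀) (v t₀) < δ →
      ∀ t : ℝ, t₀ ≤ t → (t : EReal) < T → err 𝓜 (gd t) (Vd t) (q t) (v t) < ε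
  attractive : ∃ δ > 0, ∀ ε > 0, ∃ τ : ℝ, 0 ≤ τ ∧
    ∀ t₀ : ℝ, 0 ≤ t₀ → ∀ T : EReal, ∀ q v : ℝ → Vec6,
      IsMotion 𝓜 D gd Vd fG Kd t₀ T q v → err 𝓜 (gd t₀) (Vd t₀) (q t₀) (v t₀) < δ →
        ∀ t : ℝ, t₀ + τ ≤ t → (t : EReal) < T → err 𝓜 (gd t) (Vd t) (q t) (v t) < ε

end GIC

end

noncomputable section

namespace GIC

/-! ### Algebra of `SE(3)` -/

/-! Write `h = g_de` and `e = e_V`. The feedforward terms of the control law cancel the drift of the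
desired motion, so that `ḣ = h ê` and `M̃ ė + C̃ e = -f_G - K_d e`. Near the identity use the
coordinates `x = ell h`, made of the position and the vector of the skew part of `R`. Since `R` is
orthogonal, the symmetric part of `R - 1` is quadratically small. Hence `x` controls `h - 1`, and `ẋ
= e + O(|x||e|)`.

The two laws enter only through `ElasticForce`: near the identity the force is a Lipschitz function
of `h` equal to `K x + O(|x|²)` with `K` positive definite. For GIC-1, `K` has the blocks `K_p` and
`tr(K_R) I - K_R`; for GIC-2 it is `K_ξ`, because `log h = x + O(|x|²)`.

The Lyapunov function is `V = x·Kx/2 + e·M̃e/2 + c (Kx)·e`. By skew symmetry of `Ṁ - 2C` the kinetic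
term has derivative `e·(-f_G - K_d e)`, and its part `-e·Kx` cancels against the derivative of the
potential. This leaves `-e·K_d e` and third-order terms, which is only semidefinite; the cross term
with small `c` adds a negative multiple of `|x|²`. So `V̇ ≤ -l V` while the error is small
(`lyapunov_deriv_le`, `exists_strict_lyapunov`, `exists_local_decay`). The decay is exponential, and
no invariance principle is needed for this time-varying system. A first-exit argument removes the
assumption that the error stays small (`lt_of_trapped`, `exists_decay`).

Uniformity in time rests on compactness: the manipulator data are periodic in the joint angles,
`g_d` stays in a compact part of `D`, so `det J` is bounded away from zero near it
(`Admissible.exists_region`), and `V_d` is bounded.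

For existence, the closed loop in the variables `(q, e)` is replaced by a globally bounded Lipschitz
field that agrees with it near the equilibrium. Its solutions are global, and the decay estimate
keeps those with small initial error where the two fields agree. -/

theorem rot_homog (R : Mat3) (p : Fin 3 → ℝ) : rot (homog R p) = R := by
  simp [rot, homog]

theorem pos_homog (R : Mat3) (p : Fin 3 → ℝ) : pos (homog R p) = p := by
  ext i; simp [pos, homog]

theorem homog_mul (R S : Mat3) (p s : Fin 3 → ℝ) :
    homog R p * homog S s = homog (R * S) (R *ᵥ s + p) := by
  simp only [homog, fromBlocks_multiply]
  congr 1
  · ext i j; simp [Matrix.mul_apply]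
  · ext i j; simp [Matrix.mul_apply, mulVec, dotProduct]
  · simp
  · simp

theorem homog_one : homog 1 0 = 1 := by
  rw [homog, ← fromBlocks_one]
  congr 1

theorem homog_mem {R : Mat3} (h : R ∈ Matrix.specialOrthogonalGroup (Fin 3) ℝ) (p : Fin 3 → ℝ) :
    homog R p ∈ SE3 := ⟨R, h, p, rfl⟩

theorem homog_rot_pos {g : Mat4} (hg : g ∈ SE3) : homog (rot g) (pos g) = g := by
  obtain ⟨R, -, p, rfl⟩ := hg
  rw [rot_homog, pos_homog]

theorem rot_mem {g : Mat4} (hg : g ∈ SE3) :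
    rot g ∈ Matrix.specialOrthogonalGroup (Fin 3) ℝ := by
  obtain ⟨R, h, p, rfl⟩ := hg
  rwa [rot_homog]

theorem transpose_mul_self_of_mem {R : Mat3}
    (h : R ∈ Matrix.specialOrthogonalGroup (Fin 3) ℝ) : Rᵀ * R = 1 := by
  have := (Matrix.mem_specialOrthogonalGroup_iff.1 h).1
  simpa [star_eq_conjTranspose] using (Matrix.mem_orthogonalGroup_iff' (Fin 3) ℝ).1 this

theorem mul_transpose_self_of_mem {R : Mat3}
    (h : R ∈ Matrix.specialOrthogonalGroup (Fin 3) ℝ) : R * Rᵀ = 1 :=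
  mul_eq_one_comm.1 (transpose_mul_self_of_mem h)

theorem transpose_mem {R : Mat3}
    (h : R ∈ Matrix.specialOrthogonalGroup (Fin 3) ℝ) :
    Rᵀ ∈ Matrix.specialOrthogonalGroup (Fin 3) ℝ := by
  rw [Matrix.mem_specialOrthogonalGroup_iff] at h ⊢
  refine ⟨?_, by rw [det_transpose]; exact h.2⟩
  rw [Matrix.mem_orthogonalGroup_iff]
  have := (Matrix.mem_orthogonalGroup_iff' (Fin 3) ℝ).1 h.1
  simpa [star_eq_conjTranspose] using this

theorem rot_transpose_mul {g : Mat4} (hg : g ∈ SE3) : (rot g)ᵀ * rot g = 1 :=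
  transpose_mul_self_of_mem (rot_mem hg)

theorem rot_mul_transpose {g : Mat4} (hg : g ∈ SE3) : rot g * (rot g)ᵀ = 1 :=
  mul_transpose_self_of_mem (rot_mem hg)

theorem inv_eq_homog {g : Mat4} (hg : g ∈ SE3) :
    g⁻¹ = homog (rot g)ᵀ (-((rot g)ᵀ *ᵥ pos g)) := by
  refine Matrix.inv_eq_left_inv ?_
  conv_lhs => rw [← homog_rot_pos hg]
  rw [homog_mul, rot_homog, pos_homog, rot_transpose_mul hg, add_neg_cancel, homog_one]

theorem mul_inv_cancel_SE3 {g : Mat4} (hg : g ∈ SE3) : g * g⁻¹ = 1 := by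
  rw [inv_eq_homog hg]
  conv_lhs => rw [← homog_rot_pos hg]
  rw [homog_mul, rot_homog, pos_homog, rot_mul_transpose hg, mulVec_neg, mulVec_mulVec,
    rot_mul_transpose hg, one_mulVec, neg_add_cancel, homog_one]

theorem inv_mul_cancel_SE3 {g : Mat4} (hg : g ∈ SE3) : g⁻¹ * g = 1 :=
  mul_eq_one_comm.1 (mul_inv_cancel_SE3 hg)

theorem inv_mem_SE3 {g : Mat4} (hg : g ∈ SE3) : g⁻¹ ∈ SE3 := by
  rw [inv_eq_homog hg]
  exact homog_mem (transpose_mem (rot_mem hg)) _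

theorem mul_mem_SE3 {g h : Mat4} (hg : g ∈ SE3) (hh : h ∈ SE3) : g * h ∈ SE3 := by
  obtain ⟨R, hR, p, rfl⟩ := hg
  obtain ⟨S, hS, s, rfl⟩ := hh
  rw [homog_mul]
  exact homog_mem (mul_mem hR hS) _

theorem gde_mem {g gd : Mat4} (hg : g ∈ SE3) (hgd : gd ∈ SE3) : gde g gd ∈ SE3 :=
  mul_mem_SE3 (inv_mem_SE3 hgd) hg

theorem mul_gde {g gd : Mat4} (hgd : gd ∈ SE3) : gd * gde g gd = g := by
  rw [gde, ← Matrix.mul_assoc, mul_inv_cancel_SE3 hgd, Matrix.one_mul]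


theorem gde_eq_homog {g gd : Mat4} (hg : g ∈ SE3) (hgd : gd ∈ SE3) :
    gde g gd = homog ((rot gd)ᵀ * rot g) ((rot gd)ᵀ *ᵥ (pos g - pos gd)) := by
  rw [gde, inv_eq_homog hgd]
  conv_lhs => rw [← homog_rot_pos hg]
  rw [homog_mul, mulVec_sub, sub_eq_add_neg]

theorem rot_gde {g gd : Mat4} (hg : g ∈ SE3) (hgd : gd ∈ SE3) :
    rot (gde g gd) = (rot gd)ᵀ * rot g := by
  rw [gde_eq_homog hg hgd, rot_homog]

theorem pos_gde {g gd : Mat4} (hg : g ∈ SE3) (hgd : gd ∈ SE3) :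
    pos (gde g gd) = (rot gd)ᵀ *ᵥ (pos g - pos gd) := by
  rw [gde_eq_homog hg hgd, pos_homog]

/-! ### Hat map -/

/-- Paired with two vectors `x` and `y`, both sides are triple products: that of the images under
`A` is `det A` times that of the originals. -/
theorem skew_mulVec_conj (A : Mat3) (w : Fin 3 → ℝ) :
    Aᵀ * skew (A *ᵥ w) * A = A.det • skew w := by
  ext i j
  fin_cases i <;> fin_cases j <;>
    simp [Matrix.mul_apply, Fin.sum_univ_three, skew, mulVec, dotProduct, det_fin_three] <;> ring

theorem skew_mulVec_mul {R : Mat3} (h : R ∈ Matrix.specialOrthogonalGroup (Fin 3) ℝ)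
    (w : Fin 3 → ℝ) : skew (R *ᵥ w) * R = R * skew w := by
  have := skew_mulVec_conj R w
  rw [(Matrix.mem_specialOrthogonalGroup_iff.1 h).2, one_smul] at this
  rw [← this, ← Matrix.mul_assoc, ← Matrix.mul_assoc, mul_transpose_self_of_mem h, Matrix.one_mul]

theorem skew_mulVec_comm (a b : Fin 3 → ℝ) : skew a *ᵥ b = -(skew b *ᵥ a) := by
  ext i
  fin_cases i <;> simp [skew, mulVec, dotProduct, Fin.sum_univ_three] <;> ring

theorem ang_Ad (g : Mat4) (V : Vec6) : ang (Ad g *ᵥ V) = rot g *ᵥ ang V := by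
  ext i
  simp [ang, Ad, mulVec, dotProduct, Fintype.sum_sum_type]

theorem lin_Ad (g : Mat4) (V : Vec6) :
    lin (Ad g *ᵥ V) = rot g *ᵥ lin V + skew (pos g) *ᵥ (rot g *ᵥ ang V) := by
  ext i
  rw [mulVec_mulVec]
  simp [ang, lin, Ad, mulVec, dotProduct, Fintype.sum_sum_type]

theorem homog_mul_hat (R : Mat3) (p : Fin 3 → ℝ) (V : Vec6) :
    homog R p * hat V = fromBlocks (R * skew (ang V)) (Matrix.of fun i _ => (R *ᵥ lin V) i) 0 0 := by
  simp only [homog, hat, fromBlocks_multiply]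
  congr 1
  · simp
  · ext i j; simp [Matrix.mul_apply, mulVec, dotProduct]
  · simp
  · simp

theorem hat_mul_homog (R : Mat3) (p : Fin 3 → ℝ) (V : Vec6) :
    hat V * homog R p =
      fromBlocks (skew (ang V) * R) (Matrix.of fun i _ => (skew (ang V) *ᵥ p + lin V) i) 0 0 := by
  simp only [homog, hat, fromBlocks_multiply]
  congr 1
  · simp
  · ext i j; simp [Matrix.mul_apply, mulVec, dotProduct]
  · simp
  · simp

theorem hat_Ad_mul {g : Mat4} (hg : g ∈ SE3) (V : Vec6) : hat (Ad g *ᵥ V) * g = g * hat V := by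
  suffices h : hat (Ad g *ᵥ V) * homog (rot g) (pos g) = homog (rot g) (pos g) * hat V by
    rwa [homog_rot_pos hg] at h
  rw [homog_mul_hat, hat_mul_homog, ang_Ad, lin_Ad, skew_mulVec_mul (rot_mem hg),
    skew_mulVec_comm _ (pos g)]
  congr 1
  ext i j
  simp

/-- Moves a twist across `g`: this is what makes `V_d^*` the desired velocity seen from the frame of
the end-effector. -/
theorem mul_hat_Ad_inv {g : Mat4} (hg : g ∈ SE3) (V : Vec6) :
    g * hat (Ad g⁻¹ *ᵥ V) = hat V * g := by
  have h := hat_Ad_mul (inv_mem_SE3 hg) V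
  calc g * hat (Ad g⁻¹ *ᵥ V) = g * (hat (Ad g⁻¹ *ᵥ V) * g⁻¹) * g := by
        rw [Matrix.mul_assoc, Matrix.mul_assoc, inv_mul_cancel_SE3 hg, Matrix.mul_one]
    _ = hat V * g := by
        rw [h, ← Matrix.mul_assoc, mul_inv_cancel_SE3 hg, Matrix.one_mul]

theorem hat_sub (V W : Vec6) : hat (V - W) = hat V - hat W := by
  ext i j
  rcases i with i | i <;> rcases j with j | j <;> simp [hat, lin]
  fin_cases i <;> fin_cases j <;> simp [skew, ang] <;> ring

theorem skew_unskew {X : Mat3} (h : Xᵀ = -X) : skew (unskew X) = X := by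
  have h' : ∀ i j, X j i = -X i j := fun i j => by
    simpa using congrFun (congrFun h i) j
  ext i j
  have h0 := h' 0 0; have h1 := h' 1 1; have h2 := h' 2 2
  have h3 := h' 0 1; have h4 := h' 0 2; have h5 := h' 1 2
  fin_cases i <;> fin_cases j <;> simp [skew, unskew] <;> linarith

theorem hat_vee {X : Mat4} (h : (rot X)ᵀ = -rot X) (h0 : ∀ j, X (Sum.inr ()) j = 0) :
    hat (vee X) = X := by
  have : ang (vee X) = unskew (rot X) := by ext i; simp [ang, vee]
  ext i j
  rcases i with i | i
  · rcases j with j | j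
    · simp only [hat, fromBlocks_apply₁₁, this, skew_unskew h]
      rfl
    · simp [hat, lin, vee, pos]
  · rcases j with j | j <;> simp [hat, h0]

/-! ### Entrywise calculus of matrix-valued functions -/

section Calculus

variable {m n k : Type}
  {E : Type} [NormedAddCommGroup E] [NormedSpace ℝ E]

/-- Entrywise derivative of a matrix-valued function of time. -/
def HasEntryDeriv (A : ℝ → Matrix m n ℝ) (A' : Matrix m n ℝ) (s : Set ℝ) (t : ℝ) :
    Prop :=
  ∀ i j, HasDerivWithinAt (fun τ => A τ i j) (A' i j) s t

theorem HasEntryDeriv.const (A : Matrix m n ℝ) (s : Set ℝ) (t : ℝ) :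
    HasEntryDeriv (fun _ => A) 0 s t := fun i j => hasDerivWithinAt_const t s (A i j)

variable [Fintype n]

theorem HasEntryDeriv.mul {A : ℝ → Matrix m n ℝ} {B : ℝ → Matrix n k ℝ} {A' : Matrix m n ℝ}
    {B' : Matrix n k ℝ} {s : Set ℝ} {t : ℝ} (hA : HasEntryDeriv A A' s t)
    (hB : HasEntryDeriv B B' s t) :
    HasEntryDeriv (fun τ => A τ * B τ) (A' * B t + A t * B') s t := by
  intro i j
  simp only [Matrix.mul_apply, Matrix.add_apply, ← Finset.sum_add_distrib]
  exact HasDerivWithinAt.fun_sum fun l _ => (hA i l).mul (hB l j)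

theorem HasEntryDeriv.mulVec {A : ℝ → Matrix m n ℝ} {x : ℝ → n → ℝ} {A' : Matrix m n ℝ}
    {x' : n → ℝ} {s : Set ℝ} {t : ℝ} (hA : HasEntryDeriv A A' s t)
    (hx : HasDerivWithinAt x x' s t) :
    HasDerivWithinAt (fun τ => A τ *ᵥ x τ) (A' *ᵥ x t + A t *ᵥ x') s t := by
  rw [hasDerivWithinAt_pi] at hx ⊢
  intro i
  simp only [Matrix.mulVec, dotProduct, Pi.add_apply, ← Finset.sum_add_distrib]
  exact HasDerivWithinAt.fun_sum fun l _ => (hA i l).mul (hx l)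

theorem hasDerivWithinAt_dotProduct {x y : ℝ → n → ℝ} {x' y' : n → ℝ} {s : Set ℝ} {t : ℝ}
    (hx : HasDerivWithinAt x x' s t) (hy : HasDerivWithinAt y y' s t) :
    HasDerivWithinAt (fun τ => x τ ⬝ᵥ y τ) (x' ⬝ᵥ y t + x t ⬝ᵥ y') s t := by
  rw [hasDerivWithinAt_pi] at hx hy
  simp only [dotProduct, ← Finset.sum_add_distrib]
  exact HasDerivWithinAt.fun_sum fun l _ => (hx l).mul (hy l)

variable [DecidableEq n]

theorem differentiableWithinAt_det {A : E → Matrix n n ℝ} {s : Set E} {x : E}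
    (h : ∀ i j, DifferentiableWithinAt ℝ (fun y => A y i j) s x) :
    DifferentiableWithinAt ℝ (fun y => (A y).det) s x := by
  simp only [Matrix.det_apply]
  refine DifferentiableWithinAt.fun_sum fun σ _ => ?_
  refine DifferentiableWithinAt.const_smul ?_ _
  exact (HasFDerivWithinAt.finsetProd fun i _ =>
    (h (σ i) i).hasFDerivWithinAt).differentiableWithinAt

/-- By Cramer's rule each entry of the inverse is a cofactor divided by the determinant. -/
theorem differentiableWithinAt_inv {A : E → Matrix n n ℝ} {s : Set E} {x : E}
    (h : ∀ i j, DifferentiableWithinAt ℝ (fun y => A y i j) s x) (h0 : (A x).det ≠ 0) (i j : n) :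
    DifferentiableWithinAt ℝ (fun y => (A y)⁻¹ i j) s x := by
  simp only [Matrix.inv_def, Ring.inverse_eq_inv', Matrix.smul_apply, smul_eq_mul,
    Matrix.adjugate_apply]
  refine DifferentiableWithinAt.mul ((differentiableWithinAt_det h).inv h0) ?_
  refine differentiableWithinAt_det fun a b => ?_
  simp only [Matrix.updateRow_apply]
  split_ifs
  · exact differentiableWithinAt_const _
  · exact h a b

theorem contDiff_det {r : WithTop ℕ∞} {A : E → Matrix n n ℝ}
    (h : ∀ i j, ContDiff ℝ r fun y => A y i j) : ContDiff ℝ r fun y => (A y).det := by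
  simp only [Matrix.det_apply]
  refine ContDiff.sum fun σ _ => ?_
  refine ContDiff.const_smul _ ?_
  exact contDiff_prod fun i _ => h _ _

theorem contDiff_inv {r : WithTop ℕ∞} {A : E → Matrix n n ℝ}
    (h : ∀ i j, ContDiff ℝ r fun y => A y i j) (h0 : ∀ x, (A x).det ≠ 0) (i j : n) :
    ContDiff ℝ r fun y => (A y)⁻¹ i j := by
  simp only [Matrix.inv_def, Ring.inverse_eq_inv', Matrix.smul_apply, smul_eq_mul,
    Matrix.adjugate_apply]
  refine ContDiff.mul ((contDiff_det h).inv h0) ?_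
  refine contDiff_det fun a b => ?_
  simp only [Matrix.updateRow_apply]
  split_ifs
  · exact contDiff_const
  · exact h a b

/-- Derivative of the inverse of a matrix-valued function. -/
theorem HasEntryDeriv.inv {A : ℝ → Matrix n n ℝ} {A' : Matrix n n ℝ} {s : Set ℝ} {t : ℝ}
    (hA : HasEntryDeriv A A' s t) (h0 : (A t).det ≠ 0) (hu : UniqueDiffWithinAt ℝ s t) :
    HasEntryDeriv (fun τ => (A τ)⁻¹) (-((A t)⁻¹ * A' * (A t)⁻¹)) s t := by
  have hd := differentiableWithinAt_inv (fun i j => (hA i j).differentiableWithinAt) h0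
  set B' : Matrix n n ℝ := Matrix.of fun i j => derivWithin (fun τ => (A τ)⁻¹ i j) s t with hB'
  have hB : HasEntryDeriv (fun τ => (A τ)⁻¹) B' s t := fun i j => (hd i j).hasDerivWithinAt
  have h1 := hA.mul hB
  have hdet : ContinuousWithinAt (fun τ => (A τ).det) s t :=
    (differentiableWithinAt_det fun i j => (hA i j).differentiableWithinAt).continuousWithinAt
  have hev : ∀ᶠ τ in nhdsWithin t s, A τ * (A τ)⁻¹ = 1 := by
    filter_upwards [hdet.eventually_ne h0] with τ hτ
    exact Matrix.mul_nonsing_inv _ (isUnit_iff_ne_zero.2 hτ)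
  have hone : A t * (A t)⁻¹ = 1 := Matrix.mul_nonsing_inv _ (isUnit_iff_ne_zero.2 h0)
  have hone' : (A t)⁻¹ * A t = 1 := Matrix.nonsing_inv_mul _ (isUnit_iff_ne_zero.2 h0)
  -- Product rule applied to `A A⁻¹ = 1`, which holds near `t` because the determinant stays
  -- nonzero.
  have h2 : A' * (A t)⁻¹ + A t * B' = 0 := by
    ext i j
    refine UniqueDiffWithinAt.eq_deriv s hu (h1 i j) ?_
    refine (hasDerivWithinAt_const t s ((1 : Matrix n n ℝ) i j)).congr_of_eventuallyEq ?_ ?_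
    · filter_upwards [hev] with τ hτ
      rw [hτ]
    · exact congrFun (congrFun hone i) j
  have h3 : B' = -((A t)⁻¹ * A' * (A t)⁻¹) := by
    have := congrArg (fun X => (A t)⁻¹ * X) h2
    simp only [Matrix.mul_add, ← Matrix.mul_assoc, hone', Matrix.one_mul, Matrix.mul_zero] at this
    exact eq_neg_of_add_eq_zero_right this
  rwa [← h3]

end Calculus

/-! ### Kinematics -/

theorem det_ne_zero_SE3 {g : Mat4} (hg : g ∈ SE3) : g.det ≠ 0 := by
  intro h
  have := congrArg Matrix.det (mul_inv_cancel_SE3 hg)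
  simp [h] at this

namespace Manipulator

variable (𝓜 : Manipulator)

/-- Derivative of the forward kinematics in the direction `v`. -/
def Dg (q v : Vec6) : Mat4 := Matrix.of fun a b => fderiv ℝ (fun x => 𝓜.g x a b) q v

theorem g_differentiable (a b) : Differentiable ℝ fun q => 𝓜.g q a b :=
  (𝓜.g_smooth a b).differentiable (by norm_num)

theorem eq_sum_single (v : Vec6) : v = ∑ k, v k • (Pi.single k (1 : ℝ) : Vec6) := by
  ext i
  simp [Finset.sum_apply, Pi.single_apply]

theorem fderiv_eq_sum (f : Vec6 → ℝ) (q v : Vec6) :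
    fderiv ℝ f q v = ∑ k, fderiv ℝ f q (Pi.single k 1) * v k := by
  conv_lhs => rw [eq_sum_single v]
  simp [mul_comm]

theorem hasEntryDeriv_g {q : ℝ → Vec6} {v : Vec6} {s : Set ℝ} {t : ℝ}
    (h : HasDerivWithinAt q v s t) : HasEntryDeriv (fun τ => 𝓜.g (q τ)) (𝓜.Dg (q t) v) s t :=
  fun a b => (𝓜.g_differentiable a b (q t)).hasFDerivAt.comp_hasDerivWithinAt t h

theorem Dg_inr (q v : Vec6) (b) : 𝓜.Dg q v (Sum.inr ()) b = 0 := by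
  have : (fun x => 𝓜.g x (Sum.inr ()) b) = fun _ => (1 : Mat4) (Sum.inr ()) b := by
    ext x
    rw [← homog_rot_pos (𝓜.g_mem x)]
    rcases b with b | b <;> simp [homog]
  simp only [Dg, Matrix.of_apply, this]
  simp

/-- Differentiate `RᵀR = 1` along the line through `q` with direction `v`. -/
theorem rot_Dg (q v : Vec6) : ((rot (𝓜.g q))ᵀ * rot (𝓜.Dg q v))ᵀ =
    -((rot (𝓜.g q))ᵀ * rot (𝓜.Dg q v)) := by
  have hline : HasDerivWithinAt (fun τ : ℝ => q + τ • v) v univ 0 := by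
    have := ((hasDerivAt_id (0 : ℝ)).smul_const v).const_add q
    simpa using this.hasDerivWithinAt (s := univ)
  have h1 := 𝓜.hasEntryDeriv_g hline
  simp only [zero_smul, add_zero] at h1
  have h2 : HasEntryDeriv (fun τ : ℝ => rot (𝓜.g (q + τ • v))) (rot (𝓜.Dg q v)) univ 0 :=
    fun i j => h1 (Sum.inl i) (Sum.inl j)
  have h3 : HasEntryDeriv (fun τ : ℝ => (rot (𝓜.g (q + τ • v)))ᵀ) (rot (𝓜.Dg q v))ᵀ univ 0 :=
    fun i j => h2 j i
  have h4 := h3.mul h2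
  simp only [rot_transpose_mul (𝓜.g_mem _), zero_smul, add_zero] at h4
  have h5 : (rot (𝓜.Dg q v))ᵀ * rot (𝓜.g q) + (rot (𝓜.g q))ᵀ * rot (𝓜.Dg q v) = 0 := by
    ext i j
    exact UniqueDiffWithinAt.eq_deriv univ uniqueDiffWithinAt_univ (h4 i j)
      (HasEntryDeriv.const _ _ _ i j)
  rw [Matrix.transpose_mul, Matrix.transpose_transpose]
  exact eq_neg_of_add_eq_zero_left h5

theorem homog_mul_Dg (R : Mat3) (p : Fin 3 → ℝ) (q v : Vec6) (i : Fin 3) (b) :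
    (homog R p * 𝓜.Dg q v) (Sum.inl i) b = ∑ j, R i j * 𝓜.Dg q v (Sum.inl j) b := by
  simp [Matrix.mul_apply, homog, Fintype.sum_sum_type, Dg_inr]

theorem sum_mul_Dg (A : Mat4) (q v : Vec6) (a b) :
    ∑ k, (A * 𝓜.Dg q (Pi.single k 1)) a b * v k = (A * 𝓜.Dg q v) a b := by
  simp only [Matrix.mul_apply, Finset.sum_mul]
  rw [Finset.sum_comm]
  refine Finset.sum_congr rfl fun c _ => ?_
  simp only [Dg, Matrix.of_apply]
  rw [fderiv_eq_sum _ q v, Finset.mul_sum]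
  exact Finset.sum_congr rfl fun k _ => by ring

theorem J_mulVec (q v : Vec6) : 𝓜.J q *ᵥ v = vee ((𝓜.g q)⁻¹ * 𝓜.Dg q v) := by
  ext i
  rcases i with i | i
  · exact 𝓜.sum_mul_Dg _ q v _ _
  · fin_cases i <;> exact 𝓜.sum_mul_Dg _ q v _ _

/-- The matrix `g⁻¹ Dg` lies in `se(3)`: its rotational block is skew and its last row vanishes.
Therefore `vee` loses no information and `hat` recovers it. -/
theorem Dg_eq (q v : Vec6) : 𝓜.Dg q v = 𝓜.g q * hat (𝓜.J q *ᵥ v) := by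
  rw [J_mulVec, hat_vee, ← Matrix.mul_assoc, mul_inv_cancel_SE3 (𝓜.g_mem q), Matrix.one_mul]
  · have : rot ((𝓜.g q)⁻¹ * 𝓜.Dg q v) = (rot (𝓜.g q))ᵀ * rot (𝓜.Dg q v) := by
      ext i j
      rw [inv_eq_homog (𝓜.g_mem q)]
      exact 𝓜.homog_mul_Dg _ _ q v i (Sum.inl j)
    rw [this, rot_Dg]
  · intro j
    rw [inv_eq_homog (𝓜.g_mem q)]
    simp [Matrix.mul_apply, homog, Fintype.sum_sum_type, Dg_inr]

end Manipulator

/-- Kinematics of the configuration error. -/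
theorem hasEntryDeriv_gde (𝓜 : Manipulator) {gd : ℝ → Mat4} {V v : Vec6} {q : ℝ → Vec6}
    {s : Set ℝ} {t : ℝ} (hgd : gd t ∈ SE3) (hd : HasEntryDeriv gd (gd t * hat V) s t)
    (hq : HasDerivWithinAt q v s t) (hu : UniqueDiffWithinAt ℝ s t) :
    HasEntryDeriv (fun τ => gde (𝓜.g (q τ)) (gd τ))
      (gde (𝓜.g (q t)) (gd t) * hat (eV 𝓜 (gd t) V (q t) v)) s t := by
  have h1 := (hd.inv (det_ne_zero_SE3 hgd) hu).mul (𝓜.hasEntryDeriv_g hq)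
  -- With `h = g_d⁻¹ g` the product rule gives `ḣ = -V̂_d h + h V̂^b`, and `V̂_d h = h (Ad_{h⁻¹}
  -- V_d)^`.
  have h2 : -((gd t)⁻¹ * (gd t * hat V) * (gd t)⁻¹) * 𝓜.g (q t) +
      (gd t)⁻¹ * 𝓜.Dg (q t) v =
      gde (𝓜.g (q t)) (gd t) * hat (eV 𝓜 (gd t) V (q t) v) := by
    rw [eV, Vstar, hat_sub, Matrix.mul_sub, mul_hat_Ad_inv (gde_mem (𝓜.g_mem _) hgd),
      𝓜.Dg_eq, ← Matrix.mul_assoc (gd t)⁻¹ (gd t), inv_mul_cancel_SE3 hgd, Matrix.one_mul, gde,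
      Matrix.neg_mul, Matrix.mul_assoc, Matrix.mul_assoc]
    abel
  rw [← h2]
  exact h1

/-! ### Periodic functions of the joint angles -/

/-- `2π`-periodicity in each joint angle. -/
def JointPeriodic {β : Type} (f : Vec6 → β) : Prop :=
  ∀ q k, f (q + Pi.single k (2 * Real.pi)) = f q

theorem JointPeriodic.add_zsmul {β : Type} {f : Vec6 → β} (hf : JointPeriodic f) (q : Vec6)
    (k : Ix) (n : ℤ) : f (q + n • (Pi.single k (2 * Real.pi) : Vec6)) = f q := by
  have h : Function.Periodic f (Pi.single k (2 * Real.pi) : Vec6) := fun x => hf x k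
  exact h.zsmul n q

theorem JointPeriodic.add_sum {β : Type} {f : Vec6 → β} (hf : JointPeriodic f) (q : Vec6)
    (n : Ix → ℤ) (s : Finset Ix) :
    f (q + ∑ k ∈ s, n k • (Pi.single k (2 * Real.pi) : Vec6)) = f q := by
  classical
  induction s using Finset.induction_on with
  | empty => simp
  | insert a s ha ih =>
    rw [Finset.sum_insert ha, add_comm (n a • _), ← add_assoc, hf.add_zsmul, ih]

/-- A compact set of joint angles that contains a full period. -/
def jointBox : Set Vec6 := Icc 0 (fun _ => 2 * Real.pi)

theorem isCompact_jointBox : IsCompact jointBox := isCompact_Icc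

/-- Subtract multiples of `2π` in every coordinate. The representative does not depend on the
periodic function, so `g`, `J` and `M` can be compared at the same point. -/
theorem exists_mem_jointBox (q : Vec6) :
    ∃ q' ∈ jointBox, ∀ {β : Type} (f : Vec6 → β), JointPeriodic f → f q' = f q := by
  have hpi : (0 : ℝ) < 2 * Real.pi := by positivity
  refine ⟨q + ∑ k, (-⌊q k / (2 * Real.pi)⌋) • (Pi.single k (2 * Real.pi) : Vec6), ?_,
    fun f hf => hf.add_sum q _ _⟩
  have hval : ∀ i, (q + ∑ k, (-⌊q k / (2 * Real.pi)⌋) • (Pi.single k (2 * Real.pi) : Vec6)) i =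
      q i - ⌊q i / (2 * Real.pi)⌋ * (2 * Real.pi) := by
    intro i
    rw [Pi.add_apply, Finset.sum_apply, Finset.sum_eq_single i]
    · simp [sub_eq_add_neg]
    · intro k _ hk
      simp [hk.symm]
    · simp
  constructor
  · intro i
    rw [hval]
    have := Int.floor_le (q i / (2 * Real.pi))
    rw [le_div_iff₀ hpi] at this
    simpa using this
  · intro i
    rw [hval]
    have := (Int.lt_floor_add_one (q i / (2 * Real.pi))).le
    rw [div_le_iff₀ hpi] at this
    simp only
    linarith

theorem JointPeriodic.exists_bound {f : Vec6 → ℝ} (hf : JointPeriodic f) (hc : Continuous f) :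
    ∃ C : ℝ, ∀ q, |f q| ≤ C := by
  obtain ⟨C, hC⟩ := isCompact_jointBox.exists_bound_of_continuousOn hc.continuousOn
  refine ⟨C, fun q => ?_⟩
  obtain ⟨q', hq', h⟩ := exists_mem_jointBox q
  rw [← h f hf]
  exact hC q' hq'

theorem JointPeriodic.fderiv {f : Vec6 → ℝ} (hf : JointPeriodic f) :
    JointPeriodic (fderiv ℝ f) := by
  intro q k
  rw [← fderiv_comp_add_right]
  congr 1
  ext x
  exact hf x k

/-- The derivative is periodic too, hence bounded by its bound on one period; then use the mean
value inequality. -/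
theorem JointPeriodic.exists_lipschitz {f : Vec6 → ℝ} (hf : JointPeriodic f)
    (hc : ContDiff ℝ 1 f) : ∃ C : ℝ, ∀ q q', |f q - f q'| ≤ C * ‖q - q'‖ := by
  obtain ⟨C, hC⟩ := isCompact_jointBox.exists_bound_of_continuousOn
    (hc.continuous_fderiv (by norm_num)).continuousOn
  refine ⟨C, fun q q' => ?_⟩
  refine Convex.norm_image_sub_le_of_norm_fderiv_le (𝕜 := ℝ) (s := univ)
    (fun x _ => (hc.differentiable (by norm_num)) x) (fun x _ => ?_) convex_univ (mem_univ _)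
    (mem_univ _)
  obtain ⟨x', hx', h⟩ := exists_mem_jointBox x
  rw [← h _ hf.fderiv]
  exact hC x' hx'

/-- A continuous family of positive definite matrices over a compact set is uniformly positive
definite. -/
theorem exists_posDef_lower {X ι : Type} [TopologicalSpace X] [Fintype ι] {S : Set X}
    (hS : IsCompact S)
    {A : X → Matrix ι ι ℝ} (hc : ∀ i j, Continuous fun x => A x i j) (hA : ∀ x, (A x).PosDef) :
    ∃ m > 0, ∀ x ∈ S, ∀ y, m * (y ⬝ᵥ y) ≤ y ⬝ᵥ A x *ᵥ y := by
  have hcomp : IsCompact {y : ι → ℝ | y ⬝ᵥ y = 1} := by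
    refine (isCompact_Icc (a := fun _ : ι => (-1 : ℝ)) (b := fun _ => 1)).of_isClosed_subset
      (isClosed_eq (by unfold dotProduct; fun_prop) continuous_const) ?_
    intro y hy
    have : ∀ i, y i * y i ≤ 1 := fun i => by
      rw [← show y ⬝ᵥ y = 1 from hy]
      exact Finset.single_le_sum (f := fun i => y i * y i) (fun j _ => mul_self_nonneg _)
        (Finset.mem_univ i)
    exact ⟨fun i => by nlinarith [this i], fun i => by nlinarith [this i]⟩
  have hcont : Continuous fun z : X × (ι → ℝ) => z.2 ⬝ᵥ A z.1 *ᵥ z.2 := by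
    unfold dotProduct Matrix.mulVec dotProduct
    have : ∀ i j, Continuous fun z : X × (ι → ℝ) => A z.1 i j := fun i j =>
      (hc i j).comp continuous_fst
    fun_prop
  have key : ∃ m > 0, ∀ z ∈ S ×ˢ {y : ι → ℝ | y ⬝ᵥ y = 1}, m ≤ z.2 ⬝ᵥ A z.1 *ᵥ z.2 := by
    rcases (S ×ˢ {y : ι → ℝ | y ⬝ᵥ y = 1}).eq_empty_or_nonempty with h | h
    · exact ⟨1, one_pos, by simp [h]⟩
    · obtain ⟨z, hz, hmin⟩ := (hS.prod hcomp).exists_isMinOn h hcont.continuousOn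
      refine ⟨_, ?_, fun y hy => hmin hy⟩
      have h0 : z.2 ≠ 0 := by
        intro h0
        have := hz.2
        simp [h0] at this
      simpa using (hA z.1).dotProduct_mulVec_pos h0
  obtain ⟨m, hm, h⟩ := key
  refine ⟨m, hm, fun x hx y => ?_⟩
  rcases eq_or_ne y 0 with rfl | hy
  · simp
  have hpos : 0 < y ⬝ᵥ y := by
    simpa using Matrix.dotProduct_star_self_pos_iff.2 hy
  set r := Real.sqrt (y ⬝ᵥ y) with hr
  have hr0 : 0 < r := Real.sqrt_pos.2 hpos
  have hrr : r * r = y ⬝ᵥ y := Real.mul_self_sqrt hpos.le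
  have h1 := h (x, r⁻¹ • y) ⟨hx, by
    simp only [mem_ofPred_eq, smul_dotProduct, dotProduct_smul, smul_eq_mul, ← hrr]
    field_simp⟩
  simp only [mulVec_smul, smul_dotProduct, dotProduct_smul, smul_eq_mul] at h1
  have h2 := mul_le_mul_of_nonneg_left h1 (mul_self_nonneg r)
  rw [← hrr]
  calc m * (r * r) = r * r * m := by ring
    _ ≤ _ := h2
    _ = _ := by field_simp

/-! ### Regularity of the manipulator data -/

namespace Manipulator

variable (𝓜 : Manipulator)

theorem g_inv_smooth (a b) : ContDiff ℝ 3 fun q => (𝓜.g q)⁻¹ a b :=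
  contDiff_inv 𝓜.g_smooth (fun q => det_ne_zero_SE3 (𝓜.g_mem q)) a b

theorem J_entry_smooth (a b : Fin 3 ⊕ Unit) (k : Ix) : ContDiff ℝ 2 fun q =>
    ((𝓜.g q)⁻¹ * Matrix.of fun a b => fderiv ℝ (fun x => 𝓜.g x a b) q (Pi.single k 1)) a b := by
  simp only [Matrix.mul_apply, Matrix.of_apply]
  refine ContDiff.sum fun c _ => ((𝓜.g_inv_smooth a c).of_le (by norm_num)).mul ?_
  exact ((𝓜.g_smooth c b).fderiv_right (m := 2) (by norm_num)).clm_apply contDiff_const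

theorem J_smooth (i k : Ix) : ContDiff ℝ 2 fun q => 𝓜.J q i k := by
  rcases i with i | i
  · exact 𝓜.J_entry_smooth (Sum.inl i) (Sum.inr ()) k
  · fin_cases i
    · exact 𝓜.J_entry_smooth (Sum.inl 2) (Sum.inl 1) k
    · exact 𝓜.J_entry_smooth (Sum.inl 0) (Sum.inl 2) k
    · exact 𝓜.J_entry_smooth (Sum.inl 1) (Sum.inl 0) k

theorem g_jointPeriodic (a b) : JointPeriodic fun q => 𝓜.g q a b := fun q k => by
  simp only [𝓜.g_periodic]

theorem M_jointPeriodic (i j) : JointPeriodic fun q => 𝓜.M q i j := fun q k => by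
  simp only [𝓜.M_periodic]

theorem J_periodic : JointPeriodic 𝓜.J := by
  intro q l
  ext i k
  simp only [J, Matrix.of_apply, 𝓜.g_periodic]
  congr 3
  ext a b
  exact congrArg (fun L => L (Pi.single k 1)) ((𝓜.g_jointPeriodic a b).fderiv q l)

theorem J_jointPeriodic (i j) : JointPeriodic fun q => 𝓜.J q i j := fun q k => by
  simp only [𝓜.J_periodic q k]

/-- `∂J_ij / ∂q_k`. -/
def dJ (i j k : Ix) (q : Vec6) : ℝ := fderiv ℝ (fun x => 𝓜.J x i j) q (Pi.single k 1)

theorem dJ_smooth (i j k : Ix) : ContDiff ℝ 1 (𝓜.dJ i j k) :=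
  ((𝓜.J_smooth i j).fderiv_right (m := 1) (by norm_num)).clm_apply contDiff_const

theorem dM_smooth (i j k : Ix) : ContDiff ℝ 1 (𝓜.dM i j k) :=
  ((𝓜.M_smooth i j).fderiv_right (m := 1) (by norm_num)).clm_apply contDiff_const

theorem dJ_jointPeriodic (i j k : Ix) : JointPeriodic (𝓜.dJ i j k) := fun q l => by
  simp only [dJ, (𝓜.J_jointPeriodic i j).fderiv q l]

theorem dM_jointPeriodic (i j k : Ix) : JointPeriodic (𝓜.dM i j k) := fun q l => by
  simp only [dM, (𝓜.M_jointPeriodic i j).fderiv q l]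

theorem Jdot_eq_sum (q v : Vec6) (i j : Ix) : 𝓜.Jdot q v i j = ∑ k, 𝓜.dJ i j k q * v k :=
  fderiv_eq_sum _ q v

/-- Derivative of the inertia matrix in the direction `v`. -/
def Mdot (q v : Vec6) : Mat6 := Matrix.of fun i j => ∑ k, 𝓜.dM i j k q * v k

theorem hasEntryDeriv_M {q : ℝ → Vec6} {v : Vec6} {s : Set ℝ} {t : ℝ}
    (h : HasDerivWithinAt q v s t) : HasEntryDeriv (fun τ => 𝓜.M (q τ)) (𝓜.Mdot (q t) v) s t := by
  intro i j
  have := (((𝓜.M_smooth i j).differentiable (by norm_num)) (q t)).hasFDerivAt.comp_hasDerivWithinAt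
    t h
  rwa [fderiv_eq_sum] at this

theorem hasEntryDeriv_J {q : ℝ → Vec6} {v : Vec6} {s : Set ℝ} {t : ℝ}
    (h : HasDerivWithinAt q v s t) : HasEntryDeriv (fun τ => 𝓜.J (q τ)) (𝓜.Jdot (q t) v) s t :=
  fun i j =>
    (((𝓜.J_smooth i j).differentiable (by norm_num)) (q t)).hasFDerivAt.comp_hasDerivWithinAt t h

theorem M_symm (q : Vec6) : (𝓜.M q)ᵀ = 𝓜.M q := by
  have := (𝓜.M_posDef q).1
  rwa [Matrix.IsHermitian, conjTranspose_eq_transpose_of_trivial] at this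

theorem M_det (q : Vec6) : IsUnit (𝓜.M q).det := (𝓜.M_posDef q).det_pos.ne'.isUnit

theorem dM_symm (i j k : Ix) (q : Vec6) : 𝓜.dM i j k q = 𝓜.dM j i k q := by
  unfold dM
  congr 2
  ext x
  exact congrFun (congrFun (𝓜.M_symm x) j) i

/-- Skew symmetry of `Ṁ - 2C`, as an identity of quadratic forms. -/
theorem dotProduct_C (q v w : Vec6) : w ⬝ᵥ 𝓜.C q v *ᵥ w = (w ⬝ᵥ 𝓜.Mdot q v *ᵥ w) / 2 := by
  have h : w ⬝ᵥ (𝓜.C q v - (1 / 2 : ℝ) • 𝓜.Mdot q v) *ᵥ w = 0 := by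
    set N := 𝓜.C q v - (1 / 2 : ℝ) • 𝓜.Mdot q v with hN
    -- The entries of `N` are `½ ∑ₖ (∂ⱼ M_ik - ∂ᵢ M_kj) vₖ`, which change sign under exchange of `i`
    -- and `j` by symmetry of `M`.
    have hskew : Nᵀ = -N := by
      ext i j
      simp only [hN, transpose_apply, Matrix.sub_apply, Matrix.smul_apply, C, Mdot, Matrix.of_apply,
        Matrix.neg_apply, smul_eq_mul, Finset.mul_sum, ← Finset.sum_sub_distrib,
        ← Finset.sum_neg_distrib]
      refine Finset.sum_congr rfl fun k _ => ?_
      rw [𝓜.dM_symm j k i, 𝓜.dM_symm k i j, 𝓜.dM_symm j i k]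
      ring
    have h1 : w ⬝ᵥ N *ᵥ w = w ⬝ᵥ Nᵀ *ᵥ w := by
      rw [mulVec_transpose, dotProduct_mulVec, dotProduct_comm]
    rw [hskew, neg_mulVec, dotProduct_neg] at h1
    linarith
  rw [sub_mulVec, dotProduct_sub, smul_mulVec, dotProduct_smul, smul_eq_mul] at h
  linarith

variable {𝓜}

/-- The dynamics of the velocity error in explicit form. -/
theorem dynamics_iff {q v e e' F : Vec6} (hJ : IsUnit (𝓜.J q)) :
    𝓜.Mt q *ᵥ e' + 𝓜.Ct q v *ᵥ e = F ↔
      e' = (𝓜.J q * (𝓜.M q)⁻¹ * (𝓜.J q)ᵀ) *ᵥ F -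
        (𝓜.J q * (𝓜.M q)⁻¹ * 𝓜.C q v - 𝓜.Jdot q v) *ᵥ ((𝓜.J q)⁻¹ *ᵥ e) := by
  have hd : IsUnit (𝓜.J q).det := (Matrix.isUnit_iff_isUnit_det _).1 hJ
  have hJ1 : 𝓜.J q * (𝓜.J q)⁻¹ = 1 := Matrix.mul_nonsing_inv _ hd
  have hJ2 : (𝓜.J q)⁻¹ * 𝓜.J q = 1 := Matrix.nonsing_inv_mul _ hd
  have hJ3 : (𝓜.J q)ᵀ * ((𝓜.J q)⁻¹)ᵀ = 1 := by rw [← transpose_mul, hJ2, transpose_one]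
  have hJ4 : ((𝓜.J q)⁻¹)ᵀ * (𝓜.J q)ᵀ = 1 := by rw [← transpose_mul, hJ1, transpose_one]
  have hM1 : 𝓜.M q * (𝓜.M q)⁻¹ = 1 := Matrix.mul_nonsing_inv _ (𝓜.M_det q)
  have hM2 : (𝓜.M q)⁻¹ * 𝓜.M q = 1 := Matrix.nonsing_inv_mul _ (𝓜.M_det q)
  set P := 𝓜.J q * (𝓜.M q)⁻¹ * (𝓜.J q)ᵀ with hP
  -- `J M⁻¹ Jᵀ` inverts `M̃`, so the dynamics can be solved for `e'`.
  have hPM : P * 𝓜.Mt q = 1 := by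
    rw [hP, Mt]
    calc 𝓜.J q * (𝓜.M q)⁻¹ * (𝓜.J q)ᵀ * ((𝓜.J q)⁻¹ᵀ * 𝓜.M q * (𝓜.J q)⁻¹)
        = 𝓜.J q * ((𝓜.M q)⁻¹ * ((𝓜.J q)ᵀ * (𝓜.J q)⁻¹ᵀ) * 𝓜.M q) * (𝓜.J q)⁻¹ := by
          simp only [Matrix.mul_assoc]
      _ = 1 := by rw [hJ3, Matrix.mul_one, hM2, Matrix.mul_one, hJ1]
  have hMP : 𝓜.Mt q * P = 1 := mul_eq_one_comm.1 hPM
  have hPC : P * 𝓜.Ct q v =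
      (𝓜.J q * (𝓜.M q)⁻¹ * 𝓜.C q v - 𝓜.Jdot q v) * (𝓜.J q)⁻¹ := by
    rw [hP, Ct]
    calc 𝓜.J q * (𝓜.M q)⁻¹ * (𝓜.J q)ᵀ *
          ((𝓜.J q)⁻¹ᵀ * (𝓜.C q v - 𝓜.M q * (𝓜.J q)⁻¹ * 𝓜.Jdot q v) * (𝓜.J q)⁻¹)
        = 𝓜.J q * (𝓜.M q)⁻¹ * ((𝓜.J q)ᵀ * (𝓜.J q)⁻¹ᵀ) *
          (𝓜.C q v - 𝓜.M q * (𝓜.J q)⁻¹ * 𝓜.Jdot q v) * (𝓜.J q)⁻¹ := by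
          simp only [Matrix.mul_assoc]
      _ = (𝓜.J q * (𝓜.M q)⁻¹ * 𝓜.C q v -
          𝓜.J q * ((𝓜.M q)⁻¹ * 𝓜.M q) * (𝓜.J q)⁻¹ * 𝓜.Jdot q v) * (𝓜.J q)⁻¹ := by
          rw [hJ3, Matrix.mul_one, Matrix.mul_sub]
          simp only [Matrix.mul_assoc]
      _ = _ := by rw [hM2, Matrix.mul_one, hJ1, Matrix.one_mul]
  rw [mulVec_mulVec, ← hPC]
  constructor
  · rintro rfl
    rw [mulVec_add, mulVec_mulVec, hPM, one_mulVec, mulVec_mulVec, add_sub_cancel_right]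
  · rintro rfl
    rw [mulVec_sub, mulVec_mulVec, hMP, one_mulVec, mulVec_mulVec, ← Matrix.mul_assoc, hMP,
      Matrix.one_mul, sub_add_cancel]

/-- Passivity: the power balance of the kinetic energy of the velocity error. -/
theorem hasDerivWithinAt_kinetic {q e : ℝ → Vec6} {v e' F : Vec6} {s : Set ℝ} {t : ℝ}
    (hu : UniqueDiffWithinAt ℝ s t) (hq : HasDerivWithinAt q v s t)
    (he : HasDerivWithinAt e e' s t) (hJ : IsUnit (𝓜.J (q t)))
    (hdyn : 𝓜.Mt (q t) *ᵥ e' + 𝓜.Ct (q t) v *ᵥ e t = F) :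
    HasDerivWithinAt (fun τ => (((𝓜.J (q τ))⁻¹ *ᵥ e τ) ⬝ᵥ
      𝓜.M (q τ) *ᵥ ((𝓜.J (q τ))⁻¹ *ᵥ e τ)) / 2) (e t ⬝ᵥ F) s t := by
  have hd : IsUnit (𝓜.J (q t)).det := (Matrix.isUnit_iff_isUnit_det _).1 hJ
  have hw := ((𝓜.hasEntryDeriv_J hq).inv hd.ne_zero hu).mulVec he
  have hT := (hasDerivWithinAt_dotProduct hw ((𝓜.hasEntryDeriv_M hq).mulVec hw)).div_const 2
  have hJ1 : 𝓜.J (q t) * (𝓜.J (q t))⁻¹ = 1 := Matrix.mul_nonsing_inv _ hd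
  have hJ2 : (𝓜.J (q t))⁻¹ * 𝓜.J (q t) = 1 := Matrix.nonsing_inv_mul _ hd
  have hJ3 : (𝓜.J (q t))ᵀ * ((𝓜.J (q t))⁻¹)ᵀ = 1 := by rw [← transpose_mul, hJ2, transpose_one]
  refine hT.congr_deriv ?_
  set w := (𝓜.J (q t))⁻¹ *ᵥ e t with hw_def
  have hew : e t = 𝓜.J (q t) *ᵥ w := by
    rw [hw_def, mulVec_mulVec, hJ1, one_mulVec]
  set w' := -((𝓜.J (q t))⁻¹ * 𝓜.Jdot (q t) v * (𝓜.J (q t))⁻¹) *ᵥ e t + (𝓜.J (q t))⁻¹ *ᵥ e'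
    with hw'
  have hsymm : w' ⬝ᵥ 𝓜.M (q t) *ᵥ w = w ⬝ᵥ 𝓜.M (q t) *ᵥ w' := by
    conv_lhs => rw [← 𝓜.M_symm, mulVec_transpose, dotProduct_comm, ← dotProduct_mulVec]
  -- With `w = J⁻¹ e` one has `w' = J⁻¹ (e' - J̇ w)`. The `J̇` term in `C̃` is exactly the one
  -- produced here, and the error dynamics pulls back to `M w' + C w = Jᵀ F`. The term `w·Cw` is the
  -- half of `w·Ṁw` that the kinetic energy needs.
  have hF : e t ⬝ᵥ F = w ⬝ᵥ 𝓜.M (q t) *ᵥ w' + w ⬝ᵥ 𝓜.C (q t) v *ᵥ w := by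
    have h1 : (𝓜.J (q t))ᵀ *ᵥ F = 𝓜.M (q t) *ᵥ w' + 𝓜.C (q t) v *ᵥ w := by
      rw [← hdyn, mulVec_add, mulVec_mulVec, mulVec_mulVec, Mt, Ct, ← Matrix.mul_assoc,
        ← Matrix.mul_assoc, ← Matrix.mul_assoc, ← Matrix.mul_assoc, hJ3, Matrix.one_mul,
        Matrix.one_mul, hw', hw_def, mulVec_add, mulVec_mulVec, mulVec_mulVec, mulVec_mulVec,
        Matrix.sub_mul, sub_mulVec]
      simp only [Matrix.mul_neg, Matrix.mul_assoc, neg_mulVec]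
      abel
    rw [hew, dotProduct_comm, ← dotProduct_add, ← h1, mulVec_transpose, dotProduct_mulVec,
      dotProduct_comm]
  rw [hF, dotProduct_add, hsymm, 𝓜.dotProduct_C]
  ring

end Manipulator

/-! ### Global solutions of bounded Lipschitz differential equations -/

/-- In time `n` a solution moves at most `C n`, so Picard–Lindelöf on the ball of that radius covers
all of `[t₀, t₀ + n]`. Uniqueness glues these solutions together. -/
theorem exists_global_solution {E : Type} [NormedAddCommGroup E] [NormedSpace ℝ E]
    [CompleteSpace E] {W : ℝ → E → E} {C K : NNReal} {t₀ : ℝ}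
    (hb : ∀ t, t₀ ≤ t → ∀ x, ‖W t x‖ ≤ C) (hl : ∀ t, t₀ ≤ t → LipschitzWith K (W t))
    (hc : ∀ x, ContinuousOn (fun t => W t x) (Ici t₀)) (x₀ : E) :
    ∃ α : ℝ → E, α t₀ = x₀ ∧ ∀ t, t₀ ≤ t → HasDerivWithinAt α (W t (α t)) (Ici t₀) t := by
  have hex : ∀ n : ℕ, ∃ α : ℝ → E, α t₀ = x₀ ∧ ∀ t ∈ Icc t₀ (t₀ + n),
      HasDerivWithinAt α (W t (α t)) (Icc t₀ (t₀ + n)) t := by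
    intro n
    have hPL : IsPicardLindelof W (tmin := t₀) (tmax := t₀ + n) ⟨t₀, by simp⟩ x₀ (C * n) 0 C K :=
      { lipschitzOnWith := fun t ht => (hl t ht.1).lipschitzOnWith
        continuousOn := fun x _ => (hc x).mono fun t ht => ht.1
        norm_le := fun t ht x _ => hb t ht.1 x
        mul_max_le := by simp }
    exact hPL.exists_eq_forall_mem_Icc_hasDerivWithinAt₀
  choose α hα0 hα using hex
  have hder : ∀ n : ℕ, ∀ t ∈ Ico t₀ (t₀ + n),
      HasDerivWithinAt (α n) (W t (α n t)) (Ici t₀) t := by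
    intro n t ht
    refine (hα n t ⟨ht.1, ht.2.le⟩).mono_of_mem_nhdsWithin ?_
    filter_upwards [self_mem_nhdsWithin, mem_nhdsWithin_of_mem_nhds (Iio_mem_nhds ht.2)]
      with s h1 h2
    exact ⟨h1, h2.le⟩
  have huniq : ∀ n m : ℕ, n ≤ m → EqOn (α n) (α m) (Icc t₀ (t₀ + n)) := by
    intro n m hnm
    have hnm' : (n : ℝ) ≤ m := Nat.cast_le.2 hnm
    refine ODE_solution_unique_of_mem_Icc_right (v := W) (K := K) (s := fun _ => univ)
      (fun t ht => (hl t ht.1).lipschitzOnWith)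
      (fun t ht => (hα n t ht).continuousWithinAt)
      (fun t ht => (hder n t ht).mono (Ici_subset_Ici.2 ht.1)) (fun _ _ => mem_univ _)
      (fun t ht => ((hα m t ⟨ht.1, by linarith [ht.2]⟩).continuousWithinAt).mono
        (Icc_subset_Icc_right (by linarith)))
      (fun t ht => (hder m t ⟨ht.1, by linarith [ht.2]⟩).mono (Ici_subset_Ici.2 ht.1))
      (fun _ _ => mem_univ _) ?_
    rw [hα0, hα0]
  -- The ceiling selects a solution whose interval contains `t`.
  set β : ℝ → E := fun t => α ⌈t - t₀⌉₊ t with hβ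
  have hβ_eq : ∀ n : ℕ, ∀ t ∈ Icc t₀ (t₀ + n), β t = α n t := by
    intro n t ht
    refine huniq _ _ (Nat.ceil_le.2 (by linarith [ht.2])) ⟨ht.1, ?_⟩
    linarith [Nat.le_ceil (t - t₀)]
  refine ⟨β, ?_, fun t ht => ?_⟩
  · rw [hβ_eq 0 t₀ (by simp), hα0]
  · obtain ⟨n, hn⟩ := exists_nat_gt (t - t₀)
    have htn : t < t₀ + n := by linarith
    rw [hβ_eq n t ⟨ht, htn.le⟩]
    refine (hder n t ⟨ht, htn⟩).congr_of_eventuallyEq ?_ (hβ_eq n t ⟨ht, htn.le⟩)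
    filter_upwards [self_mem_nhdsWithin, mem_nhdsWithin_of_mem_nhds (Iio_mem_nhds htn)]
      with s h1 h2
    exact hβ_eq n s ⟨h1, h2.le⟩

/-! ### Bounded, uniformly Lipschitz time-dependent functions -/

/-- `f t x` is bounded and Lipschitz in `x`, uniformly in the time `t ≥ 0`, and continuous in
`t ≥ 0`. -/
def UnifLip {E : Type} [NormedAddCommGroup E] (f : ℝ → E → ℝ) : Prop :=
  ∃ C : ℝ, 0 ≤ C ∧ (∀ t, 0 ≤ t → ∀ x, |f t x| ≤ C) ∧
    (∀ t, 0 ≤ t → ∀ x y, |f t x - f t y| ≤ C * ‖x - y‖) ∧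
    ∀ x, ContinuousOn (fun t => f t x) (Ici 0)

namespace UnifLip

variable {E : Type} [NormedAddCommGroup E] {f h : ℝ → E → ℝ}

theorem mk' {C D : ℝ} (hb : ∀ t, 0 ≤ t → ∀ x, |f t x| ≤ C)
    (hl : ∀ t, 0 ≤ t → ∀ x y, |f t x - f t y| ≤ D * ‖x - y‖)
    (hc : ∀ x, ContinuousOn (fun t => f t x) (Ici 0)) : UnifLip f :=
  ⟨max C D, ((abs_nonneg _).trans (hb 0 le_rfl 0)).trans (le_max_left _ _),
    fun t ht x => (hb t ht x).trans (le_max_left _ _), fun t ht x y => (hl t ht x y).trans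
      (mul_le_mul_of_nonneg_right (le_max_right _ _) (norm_nonneg _)), hc⟩

theorem congr (hf : UnifLip f) (hfh : ∀ t, 0 ≤ t → ∀ x, h t x = f t x) : UnifLip h := by
  obtain ⟨C, hC, hb, hl, hc⟩ := hf
  refine ⟨C, hC, fun t ht x => ?_, fun t ht x y => ?_, fun x => ?_⟩
  · rw [hfh t ht]; exact hb t ht x
  · rw [hfh t ht, hfh t ht]; exact hl t ht x y
  · exact (hc x).congr fun t ht => hfh t ht x

theorem of_time {u : ℝ → ℝ} {C : ℝ} (hb : ∀ t, 0 ≤ t → |u t| ≤ C) (hc : ContinuousOn u (Ici 0)) :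
    UnifLip fun t (_ : E) => u t :=
  mk' (D := 0) (fun t ht _ => hb t ht) (fun t _ x y => by simp) fun _ => hc

theorem const (c : ℝ) : UnifLip fun _ (_ : E) => c :=
  of_time (fun _ _ => le_rfl) continuousOn_const

theorem add (hf : UnifLip f) (hh : UnifLip h) : UnifLip fun t x => f t x + h t x := by
  obtain ⟨C, hC, hb, hl, hc⟩ := hf
  obtain ⟨D, hD, hb', hl', hc'⟩ := hh
  refine mk' (C := C + D) (D := C + D) (fun t ht x => ?_) (fun t ht x y => ?_)
    fun x => (hc x).add (hc' x)
  · exact (abs_add_le _ _).trans (add_le_add (hb t ht x) (hb' t ht x))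
  · rw [add_sub_add_comm, add_mul]
    exact (abs_add_le _ _).trans (add_le_add (hl t ht x y) (hl' t ht x y))

theorem neg (hf : UnifLip f) : UnifLip fun t x => -f t x := by
  obtain ⟨C, hC, hb, hl, hc⟩ := hf
  refine ⟨C, hC, fun t ht x => by rw [abs_neg]; exact hb t ht x, fun t ht x y => ?_,
    fun x => (hc x).neg⟩
  rw [neg_sub_neg, abs_sub_comm]
  exact hl t ht x y

theorem sub (hf : UnifLip f) (hh : UnifLip h) : UnifLip fun t x => f t x - h t x := by
  simpa [sub_eq_add_neg] using hf.add hh.neg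

theorem mul (hf : UnifLip f) (hh : UnifLip h) : UnifLip fun t x => f t x * h t x := by
  obtain ⟨C, hC, hb, hl, hc⟩ := hf
  obtain ⟨D, hD, hb', hl', hc'⟩ := hh
  refine mk' (C := C * D) (D := C * D + C * D) (fun t ht x => ?_) (fun t ht x y => ?_)
    fun x => (hc x).mul (hc' x)
  · rw [abs_mul]
    exact mul_le_mul (hb t ht x) (hb' t ht x) (abs_nonneg _) hC
  · have h1 : f t x * h t x - f t y * h t y =
        f t x * (h t x - h t y) + (f t x - f t y) * h t y := by ring
    rw [h1]
    refine (abs_add_le _ _).trans ?_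
    rw [abs_mul, abs_mul, add_mul]
    refine add_le_add ?_ ?_
    · rw [mul_assoc]
      exact mul_le_mul (hb t ht x) (hl' t ht x y) (abs_nonneg _) hC
    · calc |f t x - f t y| * |h t y| ≤ (C * ‖x - y‖) * D :=
            mul_le_mul (hl t ht x y) (hb' t ht y) (abs_nonneg _) (by positivity)
        _ = C * D * ‖x - y‖ := by ring

theorem sum {ι : Type} {F : ι → ℝ → E → ℝ} (s : Finset ι) (hF : ∀ i ∈ s, UnifLip (F i)) :
    UnifLip fun t x => ∑ i ∈ s, F i t x := by
  classical
  induction s using Finset.induction_on with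
  | empty => simpa using const 0
  | insert a s ha ih =>
    simp only [Finset.sum_insert ha]
    exact (hF a (by simp)).add (ih fun i hi => hF i (by simp [hi]))

theorem prod {ι : Type} {F : ι → ℝ → E → ℝ} (s : Finset ι) (hF : ∀ i ∈ s, UnifLip (F i)) :
    UnifLip fun t x => ∏ i ∈ s, F i t x := by
  classical
  induction s using Finset.induction_on with
  | empty => simpa using const 1
  | insert a s ha ih =>
    simp only [Finset.prod_insert ha]
    exact (hF a (by simp)).mul (ih fun i hi => hF i (by simp [hi]))

theorem max_const (hf : UnifLip f) (c : ℝ) : UnifLip fun t x => max (f t x) c := by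
  obtain ⟨C, hC, hb, hl, hc⟩ := hf
  refine mk' (C := max C |c|) (D := C) (fun t ht x => ?_) (fun t ht x y => ?_)
    fun x => ContinuousOn.sup (hc x) continuousOn_const
  · exact abs_max_le_max_abs_abs.trans (max_le_max (hb t ht x) le_rfl)
  · exact (abs_max_sub_max_le_abs _ _ _).trans (hl t ht x y)

theorem inv (hf : UnifLip f) {m : ℝ} (hm : 0 < m) (hfm : ∀ t, 0 ≤ t → ∀ x, m ≤ f t x) :
    UnifLip fun t x => (f t x)⁻¹ := by
  obtain ⟨C, hC, hb, hl, hc⟩ := hf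
  refine mk' (C := m⁻¹) (D := m⁻¹ * m⁻¹ * C) (fun t ht x => ?_) (fun t ht x y => ?_)
    fun x => (hc x).inv₀ fun t ht => (hm.trans_le (hfm t ht x)).ne'
  · rw [abs_of_pos (inv_pos.2 (hm.trans_le (hfm t ht x)))]
    exact inv_anti₀ hm (hfm t ht x)
  · have hx := hm.trans_le (hfm t ht x)
    have hy := hm.trans_le (hfm t ht y)
    have h1 : (f t x)⁻¹ - (f t y)⁻¹ = (f t x)⁻¹ * (f t y)⁻¹ * (f t y - f t x) := by
      field_simp
    rw [h1, abs_mul, abs_mul, abs_of_pos (inv_pos.2 hx), abs_of_pos (inv_pos.2 hy), mul_assoc _ C,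
      abs_sub_comm]
    refine mul_le_mul (mul_le_mul (inv_anti₀ hm (hfm t ht x)) (inv_anti₀ hm (hfm t ht y))
      (inv_pos.2 hy).le (inv_pos.2 hm).le) (hl t ht x y) (abs_nonneg _) (by positivity)

theorem det {n : Type} [Fintype n] [DecidableEq n] {A : ℝ → E → Matrix n n ℝ}
    (hA : ∀ i j, UnifLip fun t x => A t x i j) : UnifLip fun t x => (A t x).det := by
  simp only [Matrix.det_apply']
  exact sum _ fun σ _ => (const _).mul (prod _ fun i _ => hA _ _)

theorem adjugate {n : Type} [Fintype n] [DecidableEq n] {A : ℝ → E → Matrix n n ℝ}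
    (hA : ∀ i j, UnifLip fun t x => A t x i j) (i j : n) :
    UnifLip fun t x => (A t x).adjugate i j := by
  simp only [Matrix.adjugate_apply]
  refine det fun a b => ?_
  simp only [Matrix.updateRow_apply]
  split_ifs
  · exact const _
  · exact hA a b

theorem matrix_mul {l m n : Type} [Fintype m] {A : ℝ → E → Matrix l m ℝ}
    {B : ℝ → E → Matrix m n ℝ} (hA : ∀ i j, UnifLip fun t x => A t x i j)
    (hB : ∀ i j, UnifLip fun t x => B t x i j) (i j) :
    UnifLip fun t x => (A t x * B t x) i j := by
  simp only [Matrix.mul_apply]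
  exact sum _ fun k _ => (hA i k).mul (hB k j)

theorem mulVec {l m : Type} [Fintype m] {A : ℝ → E → Matrix l m ℝ}
    {y : ℝ → E → m → ℝ} (hA : ∀ i j, UnifLip fun t x => A t x i j)
    (hy : ∀ j, UnifLip fun t x => y t x j) (i) :
    UnifLip fun t x => (A t x *ᵥ y t x) i := by
  simp only [Matrix.mulVec, dotProduct]
  exact sum _ fun k _ => (hA i k).mul (hy k)

/-- On `SE(3)` the inverse is polynomial in the entries, `(Rᵀ, -Rᵀp)`, so no lower bound on a
determinant is needed. -/
theorem inv_SE3 {A : ℝ → E → Mat4} (hA : ∀ i j, UnifLip fun t x => A t x i j)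
    (hmem : ∀ t, 0 ≤ t → ∀ x, A t x ∈ SE3) (i j) : UnifLip fun t x => (A t x)⁻¹ i j := by
  have h : ∀ i j, UnifLip fun t x =>
      homog (rot (A t x))ᵀ (-((rot (A t x))ᵀ *ᵥ pos (A t x))) i j := by
    intro i j
    rcases i with i | i <;> rcases j with j | j
    · exact hA (Sum.inl j) (Sum.inl i)
    · exact (mulVec (A := fun t x => (rot (A t x))ᵀ) (y := fun t x => pos (A t x))
        (fun a b => hA (Sum.inl b) (Sum.inl a)) (fun a => hA (Sum.inl a) (Sum.inr ())) i).neg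
    · exact const 0
    · exact const _
  exact (h i j).congr fun t ht x => by rw [inv_eq_homog (hmem t ht x)]

theorem Ad {A : ℝ → E → Mat4} (hA : ∀ i j, UnifLip fun t x => A t x i j) (i j) :
    UnifLip fun t x => GIC.Ad (A t x) i j := by
  have hrot : ∀ a b, UnifLip fun t x => rot (A t x) a b := fun a b => hA _ _
  have hpos : ∀ a, UnifLip fun t x => pos (A t x) a := fun a => hA _ _
  have hskew : ∀ a b, UnifLip fun t x => skew (pos (A t x)) a b := by
    intro a b
    fin_cases a <;> fin_cases b
    · exact const 0
    · exact (hpos 2).neg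
    · exact hpos 1
    · exact hpos 2
    · exact const 0
    · exact (hpos 0).neg
    · exact (hpos 1).neg
    · exact hpos 0
    · exact const 0
  rcases i with i | i <;> rcases j with j | j
  · exact hrot i j
  · exact matrix_mul hskew hrot i j
  · exact const 0
  · exact hrot i j

theorem comp_lipschitz {A : ℝ → E → Mat4} (hA : ∀ i j, UnifLip fun t x => A t x i j)
    {F : Mat4 → ℝ} {L : ℝ} (hF : ∀ X Y δ, (∀ a b, |X a b - Y a b| ≤ δ) → |F X - F Y| ≤ L * δ) :
    UnifLip fun t x => F (A t x) := by
  choose C hC hb hl hc using hA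
  set D : ℝ := ∑ a, ∑ b, C a b with hD
  have hCD : ∀ a b, C a b ≤ D := fun a b =>
    (Finset.single_le_sum (f := fun b => C a b) (fun b _ => hC a b) (Finset.mem_univ b)).trans
      (Finset.single_le_sum (f := fun a => ∑ b, C a b)
        (fun a _ => Finset.sum_nonneg fun b _ => hC a b) (Finset.mem_univ a))
  refine mk' (C := L * D + |F 0|) (D := L * D) (fun t ht x => ?_) (fun t ht x y => ?_)
    fun x t ht => ?_
  · have := hF (A t x) 0 D fun a b => by simpa using (hb a b t ht x).trans (hCD a b)
    have h2 := abs_add_le (F (A t x) - F 0) (F 0)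
    rw [sub_add_cancel] at h2
    linarith
  · rw [mul_assoc]
    exact hF _ _ _ fun a b => (hl a b t ht x y).trans
      (mul_le_mul_of_nonneg_right (hCD a b) (norm_nonneg _))
  · have h1 : ContinuousWithinAt (fun s => L * ∑ a, ∑ b, |A s x a b - A t x a b|) (Ici 0) t := by
      refine ContinuousWithinAt.mul continuousWithinAt_const ?_
      refine tendsto_finsetSum _ fun a _ => tendsto_finsetSum _ fun b _ => ?_
      exact ((hc a b x t ht).sub continuousWithinAt_const).abs
    have h2 : Filter.Tendsto (fun s => L * ∑ a, ∑ b, |A s x a b - A t x a b|)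
        (nhdsWithin t (Ici 0)) (nhds 0) := by
      simpa [ContinuousWithinAt] using h1
    rw [ContinuousWithinAt, tendsto_iff_dist_tendsto_zero]
    refine squeeze_zero (fun _ => dist_nonneg) (fun s => ?_) h2
    rw [Real.dist_eq]
    refine hF _ _ _ fun a b => ?_
    exact (Finset.single_le_sum (f := fun b => |A s x a b - A t x a b|)
      (fun b _ => abs_nonneg _) (Finset.mem_univ b)).trans
      (Finset.single_le_sum (f := fun a => ∑ b, |A s x a b - A t x a b|)
        (fun a _ => Finset.sum_nonneg fun b _ => abs_nonneg _) (Finset.mem_univ a))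

theorem of_joint {f : Vec6 → ℝ} (hf : JointPeriodic f) (hc : ContDiff ℝ 1 f) :
    UnifLip fun _ (z : Vec6 × Vec6) => f z.1 := by
  obtain ⟨C, hC⟩ := hf.exists_bound hc.continuous
  obtain ⟨D, hD⟩ := hf.exists_lipschitz hc
  refine mk' (C := C) (D := |D|) (fun t _ z => hC z.1) (fun t _ z z' => ?_)
    fun _ => continuousOn_const
  exact (hD _ _).trans (mul_le_mul (le_abs_self D) (norm_fst_le (z - z')) (norm_nonneg _)
    (abs_nonneg _))

end UnifLip

theorem exists_global_solution_of_unifLip {W : ℝ → Vec6 × Vec6 → Vec6 × Vec6}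
    (h1 : ∀ i, UnifLip fun t z => (W t z).1 i) (h2 : ∀ i, UnifLip fun t z => (W t z).2 i)
    {t₀ : ℝ} (ht₀ : 0 ≤ t₀) (z₀ : Vec6 × Vec6) :
    ∃ z : ℝ → Vec6 × Vec6, z t₀ = z₀ ∧
      ∀ t, t₀ ≤ t → HasDerivWithinAt z (W t (z t)) (Ici t₀) t := by
  choose C hC hCb hCl hCc using h1
  choose D hD hDb hDl hDc using h2
  set B : ℝ := ∑ i, C i + ∑ i, D i with hB
  have hB0 : 0 ≤ B := add_nonneg (Finset.sum_nonneg fun i _ => hC i)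
    (Finset.sum_nonneg fun i _ => hD i)
  have hCB : ∀ i, C i ≤ B := fun i =>
    (Finset.single_le_sum (fun i _ => hC i) (Finset.mem_univ i)).trans
      (le_add_of_nonneg_right (Finset.sum_nonneg fun i _ => hD i))
  have hDB : ∀ i, D i ≤ B := fun i =>
    (Finset.single_le_sum (fun i _ => hD i) (Finset.mem_univ i)).trans
      (le_add_of_nonneg_left (Finset.sum_nonneg fun i _ => hC i))
  refine exists_global_solution (C := ⟨B, hB0⟩) (K := ⟨B, hB0⟩) (fun t ht z => ?_)
    (fun t ht => ?_) (fun z => ?_) z₀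
  · refine norm_prod_le_iff.2 ⟨?_, ?_⟩ <;> refine (pi_norm_le_iff_of_nonneg hB0).2 fun i => ?_
    · exact (hCb i t (ht₀.trans ht) z).trans (hCB i)
    · exact (hDb i t (ht₀.trans ht) z).trans (hDB i)
  · refine LipschitzWith.of_dist_le_mul fun z z' => ?_
    rw [dist_eq_norm, dist_eq_norm]
    have h0 : 0 ≤ B * ‖z - z'‖ := by positivity
    refine norm_prod_le_iff.2 ⟨?_, ?_⟩ <;> refine (pi_norm_le_iff_of_nonneg h0).2 fun i => ?_
    · exact (hCl i t (ht₀.trans ht) z z').trans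
        (mul_le_mul_of_nonneg_right (hCB i) (norm_nonneg _))
    · exact (hDl i t (ht₀.trans ht) z z').trans
        (mul_le_mul_of_nonneg_right (hDB i) (norm_nonneg _))
  · have hs : Ici t₀ ⊆ Ici 0 := Ici_subset_Ici.2 ht₀
    exact ContinuousOn.prodMk (continuousOn_pi.2 fun i => (hCc i z).mono hs)
      (continuousOn_pi.2 fun i => (hDc i z).mono hs)

/-! ### Norm estimates -/

theorem norm_mulVec_le {m n : Type} [Fintype m] [Fintype n] {A : Matrix m n ℝ} {c : ℝ}
    (hA : ∀ i j, |A i j| ≤ c) (hc : 0 ≤ c) (y : n → ℝ) :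
    ‖A *ᵥ y‖ ≤ Fintype.card n * c * ‖y‖ := by
  refine (pi_norm_le_iff_of_nonneg (by positivity)).2 fun i => ?_
  calc ‖(A *ᵥ y) i‖ ≤ ∑ j, ‖A i j * y j‖ := norm_sum_le _ _
    _ ≤ ∑ _j : n, c * ‖y‖ := Finset.sum_le_sum fun j _ => by
        rw [norm_mul]
        exact mul_le_mul (hA i j) (norm_le_pi_norm y j) (norm_nonneg _) hc
    _ = _ := by simp [mul_assoc]

theorem abs_dotProduct_le {n : Type} [Fintype n] (x y : n → ℝ) :
    |x ⬝ᵥ y| ≤ Fintype.card n * ‖x‖ * ‖y‖ := by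
  calc |x ⬝ᵥ y| ≤ ∑ j, ‖x j * y j‖ := Finset.abs_sum_le_sum_abs _ _
    _ ≤ ∑ _j : n, ‖x‖ * ‖y‖ := Finset.sum_le_sum fun j _ => by
        rw [norm_mul]
        exact mul_le_mul (norm_le_pi_norm x j) (norm_le_pi_norm y j) (norm_nonneg _)
          (norm_nonneg _)
    _ = _ := by simp [mul_assoc]

theorem norm_sq_le_dotProduct {n : Type} [Fintype n] (y : n → ℝ) : ‖y‖ ^ 2 ≤ y ⬝ᵥ y := by
  have h0 : 0 ≤ y ⬝ᵥ y := Finset.sum_nonneg fun i _ => mul_self_nonneg (y i)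
  have h : ‖y‖ ≤ Real.sqrt (y ⬝ᵥ y) := by
    refine (pi_norm_le_iff_of_nonneg (Real.sqrt_nonneg _)).2 fun i => ?_
    refine Real.abs_le_sqrt ?_
    rw [pow_two]
    exact Finset.single_le_sum (f := fun i => y i * y i) (fun i _ => mul_self_nonneg _)
      (Finset.mem_univ i)
  calc ‖y‖ ^ 2 ≤ Real.sqrt (y ⬝ᵥ y) ^ 2 := by gcongr
    _ = y ⬝ᵥ y := Real.sq_sqrt h0

theorem norm_le_euclNorm {n : Type} [Fintype n] (y : n → ℝ) : ‖y‖ ≤ euclNorm y := by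
  refine (pi_norm_le_iff_of_nonneg (Real.sqrt_nonneg _)).2 fun i => ?_
  exact Real.abs_le_sqrt (Finset.single_le_sum (f := fun i => y i ^ 2) (fun i _ => sq_nonneg _)
    (Finset.mem_univ i))

theorem euclNorm_le {n : Type} [Fintype n] (y : n → ℝ) : euclNorm y ≤ Fintype.card n * ‖y‖ := by
  refine Real.sqrt_le_iff.2 ⟨by positivity, ?_⟩
  calc ∑ i, y i ^ 2 ≤ ∑ _i : n, ‖y‖ ^ 2 := Finset.sum_le_sum fun i _ => by
        rw [← sq_abs]
        exact pow_le_pow_left₀ (abs_nonneg _) (norm_le_pi_norm y i) 2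
    _ = Fintype.card n * ‖y‖ ^ 2 := by simp
    _ ≤ Fintype.card n ^ 2 * ‖y‖ ^ 2 := by
        gcongr
        exact_mod_cast Nat.le_self_pow two_ne_zero _
    _ = _ := by ring

theorem frobenius_sq (X : Mat4) : frobenius X ^ 2 = ∑ i, ∑ j, X i j ^ 2 := by
  have h : (Xᵀ * X).trace = ∑ i, ∑ j, X i j ^ 2 := by
    rw [Finset.sum_comm]
    simp [Matrix.trace, Matrix.mul_apply, pow_two]
  rw [frobenius, h, Real.sq_sqrt]
  exact Finset.sum_nonneg fun i _ => Finset.sum_nonneg fun j _ => sq_nonneg _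

theorem frobenius_nonneg (X : Mat4) : 0 ≤ frobenius X := Real.sqrt_nonneg _

theorem abs_le_frobenius (X : Mat4) (a b) : |X a b| ≤ frobenius X := by
  refine abs_le_of_sq_le_sq ?_ (frobenius_nonneg X)
  rw [frobenius_sq]
  exact (Finset.single_le_sum (f := fun b => X a b ^ 2) (fun b _ => sq_nonneg _)
    (Finset.mem_univ b)).trans (Finset.single_le_sum (f := fun a => ∑ b, X a b ^ 2)
      (fun a _ => Finset.sum_nonneg fun b _ => sq_nonneg _) (Finset.mem_univ a))

theorem frobenius_le {X : Mat4} {δ : ℝ} (h0 : 0 ≤ δ) (h : ∀ a b, |X a b| ≤ δ) :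
    frobenius X ≤ 4 * δ := by
  refine le_of_sq_le_sq ?_ (by positivity)
  rw [frobenius_sq]
  calc ∑ i, ∑ j, X i j ^ 2 ≤ ∑ _i : Fin 3 ⊕ Unit, ∑ _j : Fin 3 ⊕ Unit, δ ^ 2 :=
        Finset.sum_le_sum fun i _ => Finset.sum_le_sum fun j _ => by
          rw [← sq_abs]
          exact pow_le_pow_left₀ (abs_nonneg _) (h i j) 2
    _ = (4 * δ) ^ 2 := by
        simp only [Finset.sum_const, Finset.card_univ, Fintype.card_sum, Fintype.card_fin,
          Fintype.card_unit, nsmul_eq_mul]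
        push_cast
        ring

theorem UnifLip.exists_norm_mulVec_le {E : Type} [NormedAddCommGroup E] {m n : Type} [Fintype m]
    [Fintype n] {A : ℝ → E → Matrix m n ℝ} (hA : ∀ i j, UnifLip fun t x => A t x i j) :
    ∃ B : ℝ, 0 < B ∧ ∀ t, 0 ≤ t → ∀ x y, ‖A t x *ᵥ y‖ ≤ B * ‖y‖ := by
  choose C hC hb hl hc using hA
  set D : ℝ := ∑ a, ∑ b, C a b with hD
  have hD0 : 0 ≤ D := Finset.sum_nonneg fun a _ => Finset.sum_nonneg fun b _ => hC a b
  have hCD : ∀ a b, C a b ≤ D := fun a b =>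
    (Finset.single_le_sum (f := fun b => C a b) (fun b _ => hC a b) (Finset.mem_univ b)).trans
      (Finset.single_le_sum (f := fun a => ∑ b, C a b)
        (fun a _ => Finset.sum_nonneg fun b _ => hC a b) (Finset.mem_univ a))
  refine ⟨Fintype.card n * D + 1, by positivity, fun t ht x y => ?_⟩
  refine (norm_mulVec_le (fun i j => (hb i j t ht x).trans (hCD i j)) hD0 y).trans ?_
  gcongr
  linarith

/-! ### Consequences of admissibility -/

section Admissible

variable {𝓜 : Manipulator} {D : Set Mat4} {gd : ℝ → Mat4} {Vd : ℝ → Vec6}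

theorem Admissible.gd_mem (h : Admissible 𝓜 D gd Vd) {t : ℝ} (ht : 0 ≤ t) : gd t ∈ SE3 := by
  obtain ⟨U, -, hD⟩ := h.region
  obtain ⟨K, -, hKD, hK⟩ := h.desired_mem
  have := hKD (hK t ht)
  rw [hD] at this
  exact this.1

theorem Admissible.exists_gd_bound (h : Admissible 𝓜 D gd Vd) :
    ∃ B : ℝ, 0 < B ∧ ∀ t, 0 ≤ t → ∀ a b, |gd t a b| ≤ B := by
  obtain ⟨K, hKc, -, hK⟩ := h.desired_mem
  have : ∀ a b, ∃ C : ℝ, ∀ X ∈ K, |X a b| ≤ C := fun a b =>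
    hKc.exists_bound_of_continuousOn (f := fun X : Mat4 => X a b) (by fun_prop)
  choose C hC using this
  refine ⟨∑ a, ∑ b, |C a b| + 1, by positivity, fun t ht a b => ?_⟩
  have h1 := (hC a b _ (hK t ht)).trans (le_abs_self _)
  have h2 := (Finset.single_le_sum (f := fun b => |C a b|) (fun b _ => abs_nonneg _)
    (Finset.mem_univ b)).trans (Finset.single_le_sum (f := fun a => ∑ b, |C a b|)
      (fun a _ => Finset.sum_nonneg fun b _ => abs_nonneg _) (Finset.mem_univ a))
  exact h1.trans (h2.trans (by linarith))

theorem Admissible.unifLip_gd (h : Admissible 𝓜 D gd Vd) {E : Type} [NormedAddCommGroup E]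
    (a b) : UnifLip fun t (_ : E) => gd t a b := by
  obtain ⟨B, -, hB⟩ := h.exists_gd_bound
  exact UnifLip.of_time (fun t ht => hB t ht a b)
    fun t ht => (h.kinematics t ht a b).continuousWithinAt

theorem Admissible.unifLip_Vd (h : Admissible 𝓜 D gd Vd) {E : Type} [NormedAddCommGroup E]
    (i) : UnifLip fun t (_ : E) => Vd t i := by
  obtain ⟨b, hb⟩ := h.velocity_bdd
  refine UnifLip.of_time (C := b) (fun t ht => ?_) ?_
  · exact (norm_le_pi_norm (Vd t) i).trans ((norm_le_euclNorm _).trans (hb t ht))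
  · exact (continuous_apply i).comp_continuousOn h.velocity_diff.continuousOn

theorem Manipulator.unifLip_g (𝓜 : Manipulator) (a b) :
    UnifLip fun _ (z : Vec6 × Vec6) => 𝓜.g z.1 a b :=
  UnifLip.of_joint (𝓜.g_jointPeriodic a b) ((𝓜.g_smooth a b).of_le (by norm_num))

theorem Admissible.unifLip_gde (h : Admissible 𝓜 D gd Vd) (a b) :
    UnifLip fun t (z : Vec6 × Vec6) => gde (𝓜.g z.1) (gd t) a b :=
  UnifLip.matrix_mul (UnifLip.inv_SE3 (fun i j => h.unifLip_gd i j) fun _ ht _ => h.gd_mem ht)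
    𝓜.unifLip_g a b

theorem Admissible.unifLip_Vstar (h : Admissible 𝓜 D gd Vd) (i) :
    UnifLip fun t (z : Vec6 × Vec6) => Vstar (𝓜.g z.1) (gd t) (Vd t) i :=
  UnifLip.mulVec (UnifLip.Ad (UnifLip.inv_SE3 h.unifLip_gde
    fun _ ht _ => gde_mem (𝓜.g_mem _) (h.gd_mem ht))) (fun j => h.unifLip_Vd j) i

/-- Near the desired configuration the end-effector lies in the operating region, and the Jacobian
determinant is bounded away from zero. -/
theorem Admissible.exists_region (h : Admissible 𝓜 D gd Vd) :
    ∃ r > 0, ∃ d > 0, ∀ t, 0 ≤ t → ∀ q, (∀ a b, |(gde (𝓜.g q) (gd t) - 1) a b| ≤ r) →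
      𝓜.g q ∈ D ∧ d ≤ |(𝓜.J q).det| := by
  obtain ⟨U, hU, hD⟩ := h.region
  obtain ⟨K, hKc, hKD, hK⟩ := h.desired_mem
  obtain ⟨B, hB0, hB⟩ := h.exists_gd_bound
  have hKU : K ⊆ U := fun X hX => by
    have := hKD hX
    rw [hD] at this
    exact this.2
  let I := Fin 3 ⊕ Unit
  obtain ⟨ρ, hρ, hρU⟩ : ∃ ρ, 0 < ρ ∧
      Metric.cthickening ρ (show Set (I → I → ℝ) from K) ⊆ (show Set (I → I → ℝ) from U) :=
    IsCompact.exists_cthickening_subset_open (α := I → I → ℝ) hKc hU hKU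
  have hgc : Continuous fun q => (show I → I → ℝ from 𝓜.g q) :=
    continuous_pi fun a => continuous_pi fun b => (𝓜.g_differentiable a b).continuous
  -- One period of the joint angles with the end-effector near the desired set: a compact set on
  -- which `det J` has no zero.
  set S : Set Vec6 := jointBox ∩
    (fun q => (show I → I → ℝ from 𝓜.g q)) ⁻¹'
      (Metric.cthickening ρ (show Set (I → I → ℝ) from K)) with hS
  have hSc : IsCompact S := isCompact_jointBox.inter_right (Metric.isClosed_cthickening.preimage hgc)
  have hJc : Continuous fun q => |(𝓜.J q).det| :=
    (contDiff_det fun i j => 𝓜.J_smooth i j).continuous.abs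
  have hmem : ∀ q, (show I → I → ℝ from 𝓜.g q) ∈
      Metric.cthickening ρ (show Set (I → I → ℝ) from K) → 𝓜.g q ∈ D := fun q hq => by
    rw [hD]
    exact ⟨𝓜.g_mem q, hρU hq⟩
  obtain ⟨d, hd, hdS⟩ : ∃ d > 0, ∀ q ∈ S, d ≤ |(𝓜.J q).det| := by
    rcases S.eq_empty_or_nonempty with h0 | h0
    · exact ⟨1, one_pos, by simp [h0]⟩
    · obtain ⟨q, hq, hmin⟩ := hSc.exists_isMinOn h0 hJc.continuousOn
      refine ⟨_, ?_, fun y hy => hmin hy⟩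
      have := (Matrix.isUnit_iff_isUnit_det _).1 (h.nonsingular q (hmem q hq.2))
      exact abs_pos.2 this.ne_zero
  -- `g - g_d = g_d (g_de - 1)`; each entry is a sum of four products bounded by `B` times the
  -- radius.
  refine ⟨ρ / (4 * B), by positivity, d, hd, fun t ht q hq => ?_⟩
  have hclose : (show I → I → ℝ from 𝓜.g q) ∈
      Metric.cthickening ρ (show Set (I → I → ℝ) from K) := by
    refine Metric.mem_cthickening_of_dist_le (α := I → I → ℝ) _ (gd t) ρ _ (hK t ht) ?_
    refine (dist_pi_le_iff hρ.le).2 fun a => (dist_pi_le_iff hρ.le).2 fun b => ?_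
    have h1 : 𝓜.g q a b - gd t a b = (gd t * (gde (𝓜.g q) (gd t) - 1)) a b := by
      rw [Matrix.mul_sub, mul_gde (h.gd_mem ht), Matrix.mul_one, Matrix.sub_apply]
    rw [Real.dist_eq]
    change |𝓜.g q a b - gd t a b| ≤ ρ
    rw [h1, Matrix.mul_apply]
    calc |∑ c, gd t a c * (gde (𝓜.g q) (gd t) - 1) c b|
        ≤ ∑ c, |gd t a c * (gde (𝓜.g q) (gd t) - 1) c b| := Finset.abs_sum_le_sum_abs _ _
      _ ≤ ∑ _c : Fin 3 ⊕ Unit, B * (ρ / (4 * B)) := Finset.sum_le_sum fun c _ => by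
          rw [abs_mul]
          exact mul_le_mul (hB t ht a c) (hq c b) (abs_nonneg _) hB0.le
      _ = ρ := by
          simp only [Finset.sum_const, Finset.card_univ, Fintype.card_sum, Fintype.card_fin,
            Fintype.card_unit, nsmul_eq_mul]
          field_simp
          norm_num
  refine ⟨hmem q hclose, ?_⟩
  obtain ⟨q', hq', hper⟩ := exists_mem_jointBox q
  rw [← hper 𝓜.J 𝓜.J_periodic]
  refine hdS q' ⟨hq', ?_⟩
  have hq : 𝓜.g q' = 𝓜.g q := hper 𝓜.g 𝓜.g_periodic
  rw [← hq] at hclose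
  exact hclose

end Admissible

/-! ### Regularised closed-loop vector field -/

namespace Manipulator

variable (𝓜 : Manipulator)

/-- A globally bounded and Lipschitz substitute for `J⁻¹`, equal to it where `d ≤ |det J|`. -/
def Jreg (d : ℝ) (q : Vec6) : Mat6 :=
  ((𝓜.J q).det * (max ((𝓜.J q).det * (𝓜.J q).det) (d * d))⁻¹) • (𝓜.J q).adjugate

theorem Jreg_eq {d : ℝ} (hd : 0 < d) {q : Vec6} (h : d ≤ |(𝓜.J q).det|) :
    𝓜.Jreg d q = (𝓜.J q)⁻¹ := by
  have h0 : (𝓜.J q).det ≠ 0 := abs_pos.1 (hd.trans_le h)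
  have h1 : d * d ≤ (𝓜.J q).det * (𝓜.J q).det := by
    rw [← abs_mul_abs_self (𝓜.J q).det]
    exact mul_self_le_mul_self hd.le h
  rw [Jreg, max_eq_left h1, Matrix.inv_def, Ring.inverse_eq_inv', mul_inv, ← mul_assoc,
    mul_inv_cancel₀ h0, one_mul]

theorem unifLip_J (i j) : UnifLip fun _ (z : Vec6 × Vec6) => 𝓜.J z.1 i j :=
  UnifLip.of_joint (𝓜.J_jointPeriodic i j) ((𝓜.J_smooth i j).of_le (by norm_num))

theorem unifLip_M (i j) : UnifLip fun _ (z : Vec6 × Vec6) => 𝓜.M z.1 i j :=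
  UnifLip.of_joint (𝓜.M_jointPeriodic i j) ((𝓜.M_smooth i j).of_le (by norm_num))

theorem unifLip_Minv (i j) : UnifLip fun _ (z : Vec6 × Vec6) => (𝓜.M z.1)⁻¹ i j :=
  UnifLip.of_joint (f := fun q => (𝓜.M q)⁻¹ i j) (fun q k => by simp only [𝓜.M_periodic])
    ((contDiff_inv 𝓜.M_smooth (fun q => (𝓜.M_det q).ne_zero) i j).of_le (by norm_num))

/-- The denominator is at least `d²`, and everything else is polynomial in the entries of `J`. -/
theorem unifLip_Jreg {d : ℝ} (hd : 0 < d) (i j) :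
    UnifLip fun _ (z : Vec6 × Vec6) => 𝓜.Jreg d z.1 i j := by
  simp only [Jreg, Matrix.smul_apply, smul_eq_mul]
  have h1 := UnifLip.det 𝓜.unifLip_J
  exact (h1.mul (((h1.mul h1).max_const (d * d)).inv (mul_pos hd hd)
    fun _ _ _ => le_max_right _ _)).mul (UnifLip.adjugate 𝓜.unifLip_J i j)

variable {𝓜} in
theorem unifLip_C {u : ℝ → Vec6 × Vec6 → Vec6} (hu : ∀ i, UnifLip fun t z => u t z i) (i j) :
    UnifLip fun t z => 𝓜.C z.1 (u t z) i j := by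
  have h1 : ∀ i j k, UnifLip fun _ (z : Vec6 × Vec6) => 𝓜.dM i j k z.1 := fun i j k =>
    UnifLip.of_joint (𝓜.dM_jointPeriodic i j k) (𝓜.dM_smooth i j k)
  simp only [C, Matrix.of_apply, div_eq_mul_inv]
  exact UnifLip.sum _ fun k _ =>
    ((((h1 i j k).add (h1 i k j)).sub (h1 k j i)).mul (UnifLip.const _)).mul (hu k)

variable {𝓜} in
theorem unifLip_Jdot {u : ℝ → Vec6 × Vec6 → Vec6} (hu : ∀ i, UnifLip fun t z => u t z i) (i j) :
    UnifLip fun t z => 𝓜.Jdot z.1 (u t z) i j := by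
  simp only [Jdot_eq_sum]
  exact UnifLip.sum _ fun k _ =>
    (UnifLip.of_joint (𝓜.dJ_jointPeriodic i j k) (𝓜.dJ_smooth i j k)).mul (hu k)

end Manipulator

/-- Componentwise truncation to `[-1, 1]`. -/
def clamp (e : Vec6) : Vec6 := fun i => -max (-max (e i) (-1)) (-1)

theorem clamp_eq {e : Vec6} (h : ‖e‖ ≤ 1) : clamp e = e := by
  ext i
  have := abs_le.1 ((norm_le_pi_norm e i).trans h)
  rw [clamp, max_eq_left this.1, max_eq_left (by linarith [this.2]), neg_neg]

theorem unifLip_clamp (i) : UnifLip fun _ (z : Vec6 × Vec6) => clamp z.2 i := by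
  refine UnifLip.mk' (C := 1) (D := 1) (fun _ _ z => ?_) (fun _ _ z z' => ?_)
    fun _ => continuousOn_const
  · rw [clamp, abs_le]
    refine ⟨?_, by linarith [le_max_right (-max (z.2 i) (-1)) (-1)]⟩
    have : max (-max (z.2 i) (-1)) (-1) ≤ 1 :=
      max_le (by linarith [le_max_right (z.2 i) (-1)]) (by norm_num)
    linarith
  · rw [clamp, clamp, neg_sub_neg, abs_sub_comm, one_mul]
    refine (abs_max_sub_max_le_abs _ _ _).trans ?_
    rw [neg_sub_neg, abs_sub_comm]
    refine (abs_max_sub_max_le_abs _ _ _).trans ?_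
    exact (norm_le_pi_norm (z - z').2 i).trans (norm_snd_le _)

section Field

variable (𝓜 : Manipulator) (gd : ℝ → Mat4) (Vd : ℝ → Vec6) (d : ℝ)

/-- Regularised joint velocity as a function of joint angles and velocity error. -/
def regVel (t : ℝ) (z : Vec6 × Vec6) : Vec6 :=
  𝓜.Jreg d z.1 *ᵥ (clamp z.2 + Vstar (𝓜.g z.1) (gd t) (Vd t))

/-- Inverse of the operational space inertia matrix, `M̃⁻¹ = J M⁻¹ Jᵀ`. -/
def Minvt (q : Vec6) : Mat6 := 𝓜.J q * (𝓜.M q)⁻¹ * (𝓜.J q)ᵀ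

/-- Regularisation of `M̃⁻¹ C̃ = (J M⁻¹ C - J̇) J⁻¹`. -/
def regCoriolis (t : ℝ) (z : Vec6 × Vec6) : Mat6 :=
  (𝓜.J z.1 * (𝓜.M z.1)⁻¹ * 𝓜.C z.1 (regVel 𝓜 gd Vd d t z) -
    𝓜.Jdot z.1 (regVel 𝓜 gd Vd d t z)) * 𝓜.Jreg d z.1

/-- Regularised closed-loop vector field for an elastic force given as a function of the
configuration error. -/
def regField (F : Mat4 → Vec6) (Kd : Mat6) (t : ℝ) (z : Vec6 × Vec6) : Vec6 × Vec6 :=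
  (regVel 𝓜 gd Vd d t z,
    Minvt 𝓜 z.1 *ᵥ (-F (gde (𝓜.g z.1) (gd t)) - Kd *ᵥ clamp z.2) -
      regCoriolis 𝓜 gd Vd d t z *ᵥ clamp z.2)

variable {𝓜 gd Vd d} {D : Set Mat4}

theorem unifLip_regVel (h : Admissible 𝓜 D gd Vd) (hd : 0 < d) (i) :
    UnifLip fun t z => regVel 𝓜 gd Vd d t z i :=
  UnifLip.mulVec (𝓜.unifLip_Jreg hd) (fun j => (unifLip_clamp j).add (h.unifLip_Vstar j)) i

variable (𝓜) in
theorem unifLip_Minvt (i j) : UnifLip fun _ (z : Vec6 × Vec6) => Minvt 𝓜 z.1 i j :=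
  UnifLip.matrix_mul (UnifLip.matrix_mul 𝓜.unifLip_J 𝓜.unifLip_Minv)
    (fun a b => 𝓜.unifLip_J b a) i j

/-- `C` and `J̇` are linear in the joint velocity, so they are bounded only because the regularised
velocity is: the error is clamped and `V_d` is bounded. -/
theorem unifLip_regCoriolis (h : Admissible 𝓜 D gd Vd) (hd : 0 < d) (i j) :
    UnifLip fun t z => regCoriolis 𝓜 gd Vd d t z i j :=
  UnifLip.matrix_mul (fun a b => (UnifLip.matrix_mul (UnifLip.matrix_mul 𝓜.unifLip_J
    𝓜.unifLip_Minv) (Manipulator.unifLip_C (unifLip_regVel h hd)) a b).sub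
      (Manipulator.unifLip_Jdot (unifLip_regVel h hd) a b)) (𝓜.unifLip_Jreg hd) i j

theorem unifLip_regField_snd (h : Admissible 𝓜 D gd Vd) (hd : 0 < d) {F : Mat4 → Vec6} {L : ℝ}
    (hF : ∀ i X Y δ, (∀ a b, |X a b - Y a b| ≤ δ) → |F X i - F Y i| ≤ L * δ) (Kd : Mat6) (i) :
    UnifLip fun t z => (regField 𝓜 gd Vd d F Kd t z).2 i := by
  refine UnifLip.sub (UnifLip.mulVec (unifLip_Minvt 𝓜) (fun j => ?_) i)
    (UnifLip.mulVec (unifLip_regCoriolis h hd) unifLip_clamp i)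
  exact (UnifLip.comp_lipschitz (F := fun X => F X j) h.unifLip_gde (hF j)).neg.sub
    (UnifLip.mulVec (fun a b => UnifLip.const (Kd a b)) unifLip_clamp j)

end Field

/-! ### Lyapunov estimates -/

/-- A quadratic Lyapunov function with a small cross term is strict near the origin. -/
theorem exists_strict_lyapunov {D κ a k m : ℝ} (hD : 0 < D) (hκ : 0 < κ) (ha : 0 < a) (hk : 0 < k)
    (hm : 0 < m) :
    ∃ c > 0, ∃ ρ > 0, ∃ l > 0, ∃ α > 0, ∃ β > 0, ρ ≤ 1 ∧ ∀ X Y P T S V' : ℝ,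
      0 ≤ X → X ≤ ρ → 0 ≤ Y → Y ≤ ρ → k * X ^ 2 ≤ P → P ≤ D * X ^ 2 → m * Y ^ 2 ≤ T →
      T ≤ D * Y ^ 2 → |S| ≤ D * X * Y →
      V' ≤ D * X ^ 2 * Y - κ * Y ^ 2 + c * (D * Y ^ 2 - a * X ^ 2 + D * X ^ 3 + D * X * Y) →
      α * (X ^ 2 + Y ^ 2) ≤ P + T + c * S ∧ P + T + c * S ≤ β * (X ^ 2 + Y ^ 2) ∧
        V' ≤ -l * (P + T + c * S) := by
  -- Total coefficient of `Y²` inside the bracket, after Young's inequality `D X Y ≤ (a/2) X² +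
  -- D²/(2a) Y²`.
  set E := D + D ^ 2 / (2 * a) with hE
  have hE0 : 0 < E := by positivity
  set μ₀ := min k m with hμ₀
  have hμ₀p : 0 < μ₀ := lt_min hk hm
  -- The bound by `κ / (2E)` lets half of the damping absorb the `Y²` terms; the bound by `μ₀ / D`
  -- keeps the function positive definite.
  set c := min 1 (min (κ / (2 * E)) (μ₀ / D)) with hc
  have hc0 : 0 < c := lt_min one_pos (lt_min (by positivity) (by positivity))
  have hc1 : c ≤ 1 := min_le_left _ _
  have hcE : c * E ≤ κ / 2 := by
    have : c ≤ κ / (2 * E) := (min_le_right _ _).trans (min_le_left _ _)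
    calc c * E ≤ κ / (2 * E) * E := by gcongr
      _ = κ / 2 := by field_simp
  have hcD : c * D ≤ μ₀ := by
    have : c ≤ μ₀ / D := (min_le_right _ _).trans (min_le_right _ _)
    calc c * D ≤ μ₀ / D * D := by gcongr
      _ = μ₀ := by field_simp
  -- Each of the two cubic terms is then at most `c a X² / 8`, so of `-c a X²` a quarter survives
  -- after Young has used half.
  set ρ := min 1 (c * a / (8 * D)) with hρ
  have hρ0 : 0 < ρ := lt_min one_pos (by positivity)
  have hρD : D * ρ ≤ c * a / 8 := by
    have : ρ ≤ c * a / (8 * D) := min_le_right _ _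
    calc D * ρ ≤ D * (c * a / (8 * D)) := by gcongr
      _ = c * a / 8 := by field_simp
  set μ := min (κ / 2) (c * a / 4) with hμ
  have hμp : 0 < μ := lt_min (by positivity) (by positivity)
  refine ⟨c, hc0, ρ, hρ0, μ / (2 * D), by positivity, μ₀ / 2, by positivity, 2 * D, by positivity,
    min_le_left _ _, ?_⟩
  intro X Y P T S V' hX hXρ hY hYρ hP1 hP2 hT1 hT2 hS hV
  have hXY : X * Y ≤ (X ^ 2 + Y ^ 2) / 2 := by nlinarith [sq_nonneg (X - Y)]
  have hcS : |c * S| ≤ c * D * ((X ^ 2 + Y ^ 2) / 2) := by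
    rw [abs_mul, abs_of_pos hc0, mul_assoc]
    refine mul_le_mul_of_nonneg_left (hS.trans ?_) hc0.le
    rw [mul_assoc]
    exact mul_le_mul_of_nonneg_left hXY hD.le
  have hcS' := abs_le.1 hcS
  have hN : 0 ≤ X ^ 2 + Y ^ 2 := by positivity
  have hlow : μ₀ / 2 * (X ^ 2 + Y ^ 2) ≤ P + T + c * S := by
    have h1 : μ₀ * X ^ 2 ≤ k * X ^ 2 := by gcongr; exact min_le_left _ _
    have h2 : μ₀ * Y ^ 2 ≤ m * Y ^ 2 := by gcongr; exact min_le_right _ _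
    have h3 : c * D * ((X ^ 2 + Y ^ 2) / 2) ≤ μ₀ * ((X ^ 2 + Y ^ 2) / 2) := by gcongr
    linarith [hcS'.1]
  have hup : P + T + c * S ≤ 2 * D * (X ^ 2 + Y ^ 2) := by
    have h3 : c * D * ((X ^ 2 + Y ^ 2) / 2) ≤ 1 * D * ((X ^ 2 + Y ^ 2) / 2) := by gcongr
    have : 0 ≤ D * (X ^ 2 + Y ^ 2) := by positivity
    linarith [hcS'.2]
  refine ⟨hlow, hup, ?_⟩
  have h1 : D * X ^ 2 * Y ≤ c * a / 8 * X ^ 2 := by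
    calc D * X ^ 2 * Y ≤ D * X ^ 2 * ρ := by gcongr
      _ = D * ρ * X ^ 2 := by ring
      _ ≤ _ := by gcongr
  have h2 : c * (D * X ^ 3) ≤ c * a / 8 * X ^ 2 := by
    calc c * (D * X ^ 3) ≤ 1 * (D * (X ^ 2 * ρ)) := by
          rw [pow_succ]
          gcongr
      _ = D * ρ * X ^ 2 := by ring
      _ ≤ _ := by gcongr
  have h3 : D * X * Y ≤ a / 2 * X ^ 2 + D ^ 2 / (2 * a) * Y ^ 2 := by
    have h := sq_nonneg (a * X - D * Y)
    have : a / 2 * X ^ 2 + D ^ 2 / (2 * a) * Y ^ 2 - D * X * Y = (a * X - D * Y) ^ 2 / (2 * a) := by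
      field_simp
      ring
    have : 0 ≤ (a * X - D * Y) ^ 2 / (2 * a) := by positivity
    linarith
  have h4 : c * (D * X * Y) ≤ c * (a / 2 * X ^ 2 + D ^ 2 / (2 * a) * Y ^ 2) := by gcongr
  have h5 : c * E * Y ^ 2 ≤ κ / 2 * Y ^ 2 := by gcongr
  have h6 : V' ≤ -(κ / 2) * Y ^ 2 - c * a / 4 * X ^ 2 := by
    rw [hE] at h5
    nlinarith
  have h7 : V' ≤ -μ * (X ^ 2 + Y ^ 2) := by
    have i1 : μ * Y ^ 2 ≤ κ / 2 * Y ^ 2 := by gcongr; exact min_le_left _ _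
    have i2 : μ * X ^ 2 ≤ c * a / 4 * X ^ 2 := by gcongr; exact min_le_right _ _
    linarith
  have h8 : μ / (2 * D) * (P + T + c * S) ≤ μ * (X ^ 2 + Y ^ 2) := by
    calc μ / (2 * D) * (P + T + c * S) ≤ μ / (2 * D) * (2 * D * (X ^ 2 + Y ^ 2)) := by gcongr
      _ = _ := by field_simp
  linarith

/-- A continuous function that starts below `ρ`, and is bounded by `ρ / 2` as long as it stays below
`ρ`, stays below `ρ`. -/
theorem lt_of_trapped {η : ℝ → ℝ} {t₀ t₁ ρ : ℝ} (hρ : 0 < ρ) (hc : ContinuousOn η (Icc t₀ t₁))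
    (h0 : η t₀ < ρ)
    (hstep : ∀ s ∈ Icc t₀ t₁, (∀ u ∈ Ico t₀ s, η u < ρ) → ∀ u ∈ Ico t₀ s, η u ≤ ρ / 2) :
    ∀ s ∈ Icc t₀ t₁, η s < ρ := by
  by_contra! hcon
  obtain ⟨s, hs, hsρ⟩ := hcon
  -- A first time with value at least `ρ` exists. Before it the function is at most `ρ / 2`, and by
  -- continuity also at that time.
  have hcl : IsCompact (Icc t₀ t₁ ∩ η ⁻¹' Ici ρ) :=
    isCompact_Icc.of_isClosed_subset (hc.preimage_isClosed_of_isClosed isClosed_Icc isClosed_Ici)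
      inter_subset_left
  obtain ⟨s₀, ⟨hs₀, hs₀ρ⟩, hmin⟩ := hcl.exists_isLeast ⟨s, hs, hsρ⟩
  have hlt : ∀ u ∈ Ico t₀ s₀, η u < ρ := by
    intro u hu
    by_contra! hcon
    exact absurd (hmin ⟨⟨hu.1, hu.2.le.trans hs₀.2⟩, hcon⟩) (not_le.2 hu.2)
  have ht : t₀ < s₀ := by
    rcases eq_or_lt_of_le hs₀.1 with h | h
    · rw [← h] at hs₀ρ
      exact absurd h0 (not_lt.2 hs₀ρ)
    · exact h
  have hle := hstep s₀ hs₀ hlt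
  have hcw : ContinuousWithinAt η (Ico t₀ s₀) s₀ :=
    (hc s₀ hs₀).mono fun u hu => ⟨hu.1, hu.2.le.trans hs₀.2⟩
  have hmem : s₀ ∈ closure (Ico t₀ s₀) := by
    rw [closure_Ico ht.ne]
    exact ⟨ht.le, le_rfl⟩
  have : η s₀ ≤ ρ / 2 := hcw.closure_le hmem continuousWithinAt_const hle
  have h2 : ρ ≤ η s₀ := hs₀ρ
  linarith

/-- Exponential decay from a differential inequality. -/
theorem le_mul_exp_of_deriv_le {V V' : ℝ → ℝ} {l t₀ s : ℝ}
    (hV : ∀ t ∈ Ico t₀ s, HasDerivWithinAt V (V' t) (Ici t₀) t)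
    (hle : ∀ t ∈ Ico t₀ s, V' t ≤ -l * V t) :
    ∀ t ∈ Ico t₀ s, V t ≤ V t₀ * Real.exp (-l * (t - t₀)) := by
  intro t ht
  -- The integrating factor makes this product antitone.
  set U : ℝ → ℝ := fun τ => V τ * Real.exp (l * (τ - t₀)) with hU
  have hexp : ∀ τ, HasDerivAt (fun τ => Real.exp (l * (τ - t₀))) (Real.exp (l * (τ - t₀)) * l) τ := by
    intro τ
    have := (((hasDerivAt_id τ).sub_const t₀).const_mul l).exp
    simpa using this
  have hUd : ∀ τ ∈ Icc t₀ t, HasDerivWithinAt U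
      (V' τ * Real.exp (l * (τ - t₀)) + V τ * (Real.exp (l * (τ - t₀)) * l)) (Ici t₀) τ :=
    fun τ hτ => (hV τ ⟨hτ.1, hτ.2.trans_lt ht.2⟩).mul (hexp τ).hasDerivWithinAt
  have hanti : AntitoneOn U (Icc t₀ t) := by
    refine antitoneOn_of_hasDerivWithinAt_nonpos (convex_Icc _ _)
      (f' := fun τ => V' τ * Real.exp (l * (τ - t₀)) + V τ * (Real.exp (l * (τ - t₀)) * l))
      (fun τ hτ => ((hUd τ hτ).continuousWithinAt).mono fun u hu => hu.1) (fun τ hτ => ?_)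
      fun τ hτ => ?_
    · exact (hUd τ (interior_subset hτ)).mono fun u hu => (interior_subset hu).1
    · have h1 := interior_subset hτ
      have h2 := hle τ ⟨h1.1, h1.2.trans_lt ht.2⟩
      have h3 : V' τ * Real.exp (l * (τ - t₀)) ≤ -l * V τ * Real.exp (l * (τ - t₀)) := by gcongr
      linarith
  have h := hanti (left_mem_Icc.2 ht.1) (right_mem_Icc.2 ht.1) ht.1
  simp only [hU, sub_self, mul_zero, Real.exp_zero, mul_one] at h
  calc V t = V t * Real.exp (l * (t - t₀)) * Real.exp (-l * (t - t₀)) := by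
        rw [mul_assoc, ← Real.exp_add]
        simp
    _ ≤ _ := by gcongr

/-- Estimate for the derivative of the Lyapunov function `x ⬝ K x / 2 + T + c (K x) ⬝ e`. -/
theorem lyapunov_deriv_le {K Kd P B : Mat6} {a κ k b C c : ℝ} (hb : 0 ≤ b)
    (hC : 0 ≤ C) (hc : 0 ≤ c) (ha : 0 ≤ a) (hk : 0 ≤ k)
    (hK : ∀ y, ‖K *ᵥ y‖ ≤ b * ‖y‖) (hKd : ∀ y, ‖Kd *ᵥ y‖ ≤ b * ‖y‖) (hP : ∀ y, ‖P *ᵥ y‖ ≤ b * ‖y‖)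
    (hB : ∀ y, ‖B *ᵥ y‖ ≤ b * ‖y‖) (hKl : ∀ y, k * ‖y‖ ^ 2 ≤ y ⬝ᵥ K *ᵥ y)
    (hKdl : ∀ y, κ * ‖y‖ ^ 2 ≤ y ⬝ᵥ Kd *ᵥ y) (hPl : ∀ y, a * ‖y‖ ^ 2 ≤ y ⬝ᵥ P *ᵥ y)
    {x e r₁ r₂ : Vec6} (hx : ‖x‖ ≤ 1) (hr₁ : ‖r₁‖ ≤ C * ‖x‖ * ‖e‖) (hr₂ : ‖r₂‖ ≤ C * ‖x‖ ^ 2) {D : ℝ}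
    (hD : 6 * (b + 1) ^ 3 * (C + 1) ≤ D) :
    (e + r₁) ⬝ᵥ K *ᵥ x + e ⬝ᵥ (-(K *ᵥ x + r₂) - Kd *ᵥ e) +
      c * ((K *ᵥ (e + r₁)) ⬝ᵥ e +
        (K *ᵥ x) ⬝ᵥ (P *ᵥ (-(K *ᵥ x + r₂) - Kd *ᵥ e) - B *ᵥ e)) ≤
    D * ‖x‖ ^ 2 * ‖e‖ - κ * ‖e‖ ^ 2 +
      c * (D * ‖e‖ ^ 2 - a * (k / 6) ^ 2 * ‖x‖ ^ 2 + D * ‖x‖ ^ 3 + D * ‖x‖ * ‖e‖) := by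
  set X := ‖x‖ with hX
  set Y := ‖e‖ with hY
  have hX0 : 0 ≤ X := norm_nonneg _
  have hY0 : 0 ≤ Y := norm_nonneg _
  have dot : ∀ y z : Vec6, ∀ p r : ℝ, ‖y‖ ≤ p → ‖z‖ ≤ r → |y ⬝ᵥ z| ≤ 6 * (p * r) := by
    intro y z p r hy hz
    have h := abs_dotProduct_le y z
    have hcard : (Fintype.card Ix : ℝ) = 6 := by simp [Ix]
    rw [hcard, mul_assoc] at h
    have h0 : 0 ≤ p := (norm_nonneg _).trans hy
    exact h.trans (by gcongr)
  have hKx : ‖K *ᵥ x‖ ≤ b * X := hK x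
  have e1 := (abs_le.1 (dot r₁ (K *ᵥ x) _ _ hr₁ hKx)).2
  have e2 := (abs_le.1 (dot e r₂ _ _ le_rfl hr₂)).1
  have e3 := hKdl e
  have her : ‖e + r₁‖ ≤ (1 + C) * Y := by
    calc ‖e + r₁‖ ≤ ‖e‖ + ‖r₁‖ := norm_add_le _ _
      _ ≤ Y + C * 1 * Y := by gcongr; exact hr₁.trans (by gcongr)
      _ = _ := by ring
  have e4 := (abs_le.1 (dot (K *ᵥ (e + r₁)) e (b * ((1 + C) * Y)) Y
    ((hK _).trans (by gcongr)) le_rfl)).2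
  have e5 : a * (k / 6) ^ 2 * X ^ 2 ≤ (K *ᵥ x) ⬝ᵥ P *ᵥ (K *ᵥ x) := by
    refine le_trans ?_ (hPl _)
    have h1 := (hKl x).trans ((le_abs_self _).trans (dot x (K *ᵥ x) X _ le_rfl le_rfl))
    -- From `k X² ≤ x·Kx ≤ 6 X ‖Kx‖`; the factor six compares the dot product with sup norms on
    -- `ℝ⁶`. The case `X = 0` is separate since `X` is cancelled.
    have h2 : k / 6 * X ≤ ‖K *ᵥ x‖ := by
      rcases eq_or_lt_of_le hX0 with h | h
      · rw [← h]; simp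
      · have : k / 6 * X * X ≤ ‖K *ᵥ x‖ * X := by
          rw [← hX] at h1
          nlinarith
        exact le_of_mul_le_mul_right this h
    rw [mul_assoc, ← mul_pow]
    gcongr
  have e6 := (abs_le.1 (dot (K *ᵥ x) (P *ᵥ r₂) _ (b * (C * X ^ 2)) hKx
    ((hP _).trans (by gcongr)))).1
  have e7 := (abs_le.1 (dot (K *ᵥ x) (P *ᵥ (Kd *ᵥ e)) _ (b * (b * Y)) hKx
    ((hP _).trans (by gcongr; exact hKd e)))).1
  have e8 := (abs_le.1 (dot (K *ᵥ x) (B *ᵥ e) _ _ hKx (hB e))).1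
  have hsymm : (e + r₁) ⬝ᵥ K *ᵥ x = e ⬝ᵥ K *ᵥ x + r₁ ⬝ᵥ K *ᵥ x := add_dotProduct _ _ _
  have h1 : e ⬝ᵥ (-(K *ᵥ x + r₂) - Kd *ᵥ e) = -(e ⬝ᵥ K *ᵥ x) - e ⬝ᵥ r₂ - e ⬝ᵥ Kd *ᵥ e := by
    rw [dotProduct_sub, dotProduct_neg, dotProduct_add]
    ring
  have h2 : (K *ᵥ x) ⬝ᵥ (P *ᵥ (-(K *ᵥ x + r₂) - Kd *ᵥ e) - B *ᵥ e) =
      -((K *ᵥ x) ⬝ᵥ P *ᵥ (K *ᵥ x)) - (K *ᵥ x) ⬝ᵥ P *ᵥ r₂ - (K *ᵥ x) ⬝ᵥ P *ᵥ (Kd *ᵥ e) -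
        (K *ᵥ x) ⬝ᵥ B *ᵥ e := by
    rw [dotProduct_sub, mulVec_sub, mulVec_neg, mulVec_add, dotProduct_sub, dotProduct_neg,
      dotProduct_add]
    ring
  rw [hsymm, h1, h2]
  -- The constant `D` dominates every remaining coefficient because each is six times a sum of
  -- monomials of the expansion of `(b + 1)³ (C + 1)`.
  have hDb : ∀ z : ℝ, z ≤ (b + 1) ^ 3 * (C + 1) → 6 * z ≤ D := fun z hz => by linarith
  have hexp : (b + 1) ^ 3 * (C + 1) = b ^ 3 * C + b ^ 3 + 3 * (b ^ 2 * C) + 3 * b ^ 2 + 3 * (b * C) +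
      3 * b + C + 1 := by ring
  have hbC : 0 ≤ b * C := by positivity
  have hb2 : 0 ≤ b ^ 2 := by positivity
  have hb3 : 0 ≤ b ^ 3 := by positivity
  have hb2C : 0 ≤ b ^ 2 * C := by positivity
  have hb3C : 0 ≤ b ^ 3 * C := by positivity
  have d1 : 6 * (b * C + C) ≤ D := hDb _ (by linarith)
  have d2 : 6 * (b + b * C) ≤ D := hDb _ (by linarith)
  have d3 : 6 * (b ^ 2 * C) ≤ D := hDb _ (by linarith)
  have d4 : 6 * (b ^ 3 + b ^ 2) ≤ D := hDb _ (by linarith)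
  have p1 : 6 * (b * C + C) * (X ^ 2 * Y) ≤ D * (X ^ 2 * Y) := by gcongr
  have p2 : 6 * (b + b * C) * Y ^ 2 ≤ D * Y ^ 2 := by gcongr
  have p3 : 6 * (b ^ 2 * C) * X ^ 3 ≤ D * X ^ 3 := by gcongr
  have p4 : 6 * (b ^ 3 + b ^ 2) * (X * Y) ≤ D * (X * Y) := by gcongr
  have hcl : (K *ᵥ (e + r₁)) ⬝ᵥ e + (-((K *ᵥ x) ⬝ᵥ P *ᵥ (K *ᵥ x)) - (K *ᵥ x) ⬝ᵥ P *ᵥ r₂ -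
      (K *ᵥ x) ⬝ᵥ P *ᵥ (Kd *ᵥ e) - (K *ᵥ x) ⬝ᵥ B *ᵥ e) ≤
      D * Y ^ 2 - a * (k / 6) ^ 2 * X ^ 2 + D * X ^ 3 + D * X * Y := by
    linarith
  have := mul_le_mul_of_nonneg_left hcl hc
  linarith

/-! ### Coordinates near the identity of `SE(3)` -/

/-- The coordinates `[p; ((R - Rᵀ) / 2)^∨]` of `(R, p)`. -/
def ell (X : Mat4) : Vec6 :=
  Sum.elim (pos X) (unskew ((1 / 2 : ℝ) • (rot X - (rot X)ᵀ)))

theorem abs_sub_transpose_le (X : Mat4) (i j : Fin 3) :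
    |X (Sum.inl i) (Sum.inl j) - X (Sum.inl j) (Sum.inl i)| ≤ 2 * ‖ell X‖ := by
  have h : ∀ k, |ell X (Sum.inr k)| ≤ ‖ell X‖ := fun k => norm_le_pi_norm (ell X) (Sum.inr k)
  have hN := norm_nonneg (ell X)
  generalize ‖ell X‖ = N at h hN ⊢
  have h0 := abs_le.1 (h 0)
  have h1 := abs_le.1 (h 1)
  have h2 := abs_le.1 (h 2)
  simp only [ell, Sum.elim_inr, unskew, rot, Matrix.toBlocks₁₁, Matrix.smul_apply, Matrix.sub_apply,
    Matrix.transpose_apply, smul_eq_mul, Matrix.of_apply, Matrix.cons_val] at h0 h1 h2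
  rw [abs_le]
  fin_cases i <;> fin_cases j <;> simp only [Fin.zero_eta, Fin.mk_one, Fin.reduceFinMk] <;>
    constructor <;> linarith

theorem norm_ell_le {X : Mat4} {δ : ℝ} (h0 : 0 ≤ δ) (h : ∀ a b, |X a b| ≤ δ) : ‖ell X‖ ≤ δ := by
  refine (pi_norm_le_iff_of_nonneg h0).2 fun i => ?_
  have h' := fun a b => abs_le.1 (h a b)
  rcases i with i | i
  · exact h _ _
  · rw [Real.norm_eq_abs, abs_le]
    fin_cases i <;> simp [ell, unskew, rot, Matrix.toBlocks₁₁] <;>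
      constructor <;> linarith [h' (Sum.inl 2) (Sum.inl 1), h' (Sum.inl 1) (Sum.inl 2),
        h' (Sum.inl 0) (Sum.inl 2), h' (Sum.inl 2) (Sum.inl 0), h' (Sum.inl 1) (Sum.inl 0),
        h' (Sum.inl 0) (Sum.inl 1)]

theorem ell_add (X Y : Mat4) : ell (X + Y) = ell X + ell Y := by
  ext i
  rcases i with i | i
  · rfl
  · fin_cases i <;> simp [ell, unskew, rot, Matrix.toBlocks₁₁] <;> ring

theorem ell_hat (e : Vec6) : ell (hat e) = e := by
  ext i
  rcases i with i | i
  · simp [ell, pos, hat, lin]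
  · fin_cases i <;> simp [ell, unskew, rot, hat, skew, ang] <;> ring

theorem ell_one : ell 1 = 0 := by
  ext i
  rcases i with i | i
  · simp [ell, pos]
  · fin_cases i <;> simp [ell, unskew, rot, Matrix.toBlocks₁₁]

theorem ell_sub_one (X : Mat4) : ell (X - 1) = ell X := by
  have := ell_add (X - 1) 1
  rw [sub_add_cancel, ell_one, add_zero] at this
  exact this.symm

theorem HasEntryDeriv.ell {X : ℝ → Mat4} {X' : Mat4} {s : Set ℝ} {t : ℝ}
    (h : HasEntryDeriv X X' s t) : HasDerivWithinAt (fun τ => ell (X τ)) (GIC.ell X') s t := by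
  rw [hasDerivWithinAt_pi]
  intro i
  rcases i with i | i
  · exact h _ _
  · fin_cases i
    · exact ((h (Sum.inl 2) (Sum.inl 1)).sub (h (Sum.inl 1) (Sum.inl 2))).const_mul (1 / 2)
    · exact ((h (Sum.inl 0) (Sum.inl 2)).sub (h (Sum.inl 2) (Sum.inl 0))).const_mul (1 / 2)
    · exact ((h (Sum.inl 1) (Sum.inl 0)).sub (h (Sum.inl 0) (Sum.inl 1))).const_mul (1 / 2)

/-- The symmetric part of `R - 1` is quadratically small. -/
theorem rot_sub_one_add_transpose {h : Mat4} (hh : h ∈ SE3) :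
    (rot h - 1) + (rot h - 1)ᵀ = -((rot h - 1)ᵀ * (rot h - 1)) := by
  rw [transpose_sub, transpose_one, Matrix.mul_sub, Matrix.sub_mul, Matrix.sub_mul,
    rot_transpose_mul hh]
  simp only [Matrix.mul_one, Matrix.one_mul]
  abel

/-- The skew part of `R - 1` is read off from `ell`. The symmetric part is quadratic in `R - 1`, so
for entries at most `1/3` it can be absorbed into the left side. -/
theorem abs_sub_one_le {h : Mat4} (hh : h ∈ SE3) {r : ℝ} (hr : r ≤ 1 / 3)
    (hr' : ∀ a b, |(h - 1) a b| ≤ r) (a b) : |(h - 1) a b| ≤ 2 * ‖ell h‖ := by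
  set E : Fin 3 → Fin 3 → ℝ := fun i j => (h - 1) (Sum.inl i) (Sum.inl j) with hE
  have hEr : ∀ i j, E i j = (rot h - 1) i j := fun i j => by
    simp [hE, rot, Matrix.toBlocks₁₁, Matrix.one_apply]
  set η := ‖E‖ with hη
  have hEη : ∀ i j, |E i j| ≤ η := fun i j =>
    (norm_le_pi_norm (E i) j).trans (norm_le_pi_norm E i)
  have hη0 : 0 ≤ η := norm_nonneg _
  have hr0 : 0 ≤ r := (abs_nonneg _).trans (hr' (Sum.inl 0) (Sum.inl 0))
  have hηr : η ≤ r := (pi_norm_le_iff_of_nonneg hr0).2 fun i =>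
    (pi_norm_le_iff_of_nonneg hr0).2 fun j => hr' _ _
  -- Three products, each at most `η / 3`.
  have hsym : ∀ i j, |E i j + E j i| ≤ η := by
    intro i j
    have h1 := congrFun (congrFun (rot_sub_one_add_transpose hh) i) j
    simp only [Matrix.add_apply, Matrix.transpose_apply, Matrix.neg_apply, Matrix.mul_apply,
      ← hEr] at h1
    rw [h1, abs_neg]
    calc |∑ k, E k i * E k j| ≤ ∑ k, |E k i * E k j| := Finset.abs_sum_le_sum_abs _ _
      _ ≤ ∑ _k : Fin 3, η * (1 / 3) := Finset.sum_le_sum fun k _ => by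
          rw [abs_mul]
          exact mul_le_mul (hEη _ _) ((hEη _ _).trans (hηr.trans hr)) (abs_nonneg _) hη0
      _ = η := by simp; ring
  have hskew : ∀ i j, |E i j - E j i| ≤ 2 * ‖ell h‖ := fun i j => by
    have := abs_sub_transpose_le (h - 1) i j
    rwa [ell_sub_one] at this
  have hη2 : η ≤ 2 * ‖ell h‖ := by
    have : η ≤ ‖ell h‖ + η / 2 := by
      refine (pi_norm_le_iff_of_nonneg (by positivity)).2 fun i =>
        (pi_norm_le_iff_of_nonneg (by positivity)).2 fun j => ?_
      have h1 := abs_le.1 (hsym i j)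
      have h2 := abs_le.1 (hskew i j)
      exact abs_le.2 ⟨by linarith, by linarith⟩
    linarith
  rcases a with a | a
  · rcases b with b | b
    · exact (hEη a b).trans hη2
    · have h1 : |ell (h - 1) (Sum.inl a)| ≤ ‖ell (h - 1)‖ :=
        norm_le_pi_norm (ell (h - 1)) (Sum.inl a)
      rw [ell_sub_one] at h1
      have h2 : (h - 1) (Sum.inl a) (Sum.inr b) = ell h (Sum.inl a) := by
        simp [ell, pos]
      rw [h2]
      linarith [norm_nonneg (ell h)]
  · have : (h - 1) (Sum.inr a) b = 0 := by
      rw [← homog_rot_pos hh, ← homog_one]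
      rcases b with b | b <;> simp [homog]
    rw [this, abs_zero]
    positivity

/-- Along the error kinematics `ḣ = h ê` the coordinates satisfy `ẋ ≈ e`. -/
theorem norm_ell_mul_hat_sub_le {h : Mat4} (hh : h ∈ SE3) {r : ℝ} (hr : r ≤ 1 / 3)
    (hr' : ∀ a b, |(h - 1) a b| ≤ r) (e : Vec6) :
    ‖ell (h * hat e) - e‖ ≤ 8 * ‖ell h‖ * ‖e‖ := by
  have h1 : ell (h * hat e) - e = ell ((h - 1) * hat e) := by
    have := ell_add ((h - 1) * hat e) (hat e)
    rw [Matrix.sub_mul, Matrix.one_mul, sub_add_cancel, ell_hat] at this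
    rw [this, Matrix.sub_mul, Matrix.one_mul, add_sub_cancel_right]
  have hhat : ∀ a b, |hat e a b| ≤ ‖e‖ := by
    have hn : ∀ i, |e i| ≤ ‖e‖ := fun i => norm_le_pi_norm e i
    intro a b
    rcases a with a | a <;> rcases b with b | b
    · fin_cases a <;> fin_cases b <;> simp [hat, skew, ang, hn]
    · exact hn _
    · simp [hat]
    · simp [hat]
  rw [h1]
  refine norm_ell_le (by positivity) fun a b => ?_
  rw [Matrix.mul_apply]
  calc |∑ c, (h - 1) a c * hat e c b| ≤ ∑ c, |(h - 1) a c * hat e c b| :=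
        Finset.abs_sum_le_sum_abs _ _
    _ ≤ ∑ _c : Fin 3 ⊕ Unit, 2 * ‖ell h‖ * ‖e‖ := Finset.sum_le_sum fun c _ => by
        rw [abs_mul]
        exact mul_le_mul (abs_sub_one_le hh hr hr' a c) (hhat c b) (abs_nonneg _) (by positivity)
    _ = _ := by
        simp only [Finset.sum_const, Finset.card_univ, Fintype.card_sum, Fintype.card_fin,
          Fintype.card_unit, nsmul_eq_mul]
        push_cast
        ring

/-! ### Uniform bounds near the desired configuration -/

theorem exists_posDef_bounds {K : Mat6} (hK : K.PosDef) :
    ∃ k > 0, ∃ b > 0, (∀ y, k * ‖y‖ ^ 2 ≤ y ⬝ᵥ K *ᵥ y) ∧ ∀ y, ‖K *ᵥ y‖ ≤ b * ‖y‖ := by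
  obtain ⟨k, hk, h⟩ := exists_posDef_lower (X := Unit) (S := univ) isCompact_univ
    (A := fun _ => K) (fun _ _ => continuous_const) fun _ => hK
  obtain ⟨b, hb, h'⟩ := UnifLip.exists_norm_mulVec_le (E := ℝ) (A := fun _ _ => K)
    fun i j => UnifLip.const (K i j)
  refine ⟨k, hk, b, hb, fun y => ?_, h' 0 le_rfl 0⟩
  exact (mul_le_mul_of_nonneg_left (norm_sq_le_dotProduct y) hk.le).trans (h () (mem_univ _) y)

theorem Manipulator.exists_inertia_lower (𝓜 : Manipulator) :
    ∃ m > 0, ∀ q y, m * ‖y‖ ^ 2 ≤ y ⬝ᵥ 𝓜.M q *ᵥ y := by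
  obtain ⟨m, hm, h⟩ := exists_posDef_lower isCompact_jointBox
    (fun i j => (𝓜.M_smooth i j).continuous) 𝓜.M_posDef
  refine ⟨m, hm, fun q y => ?_⟩
  obtain ⟨q', hq', hper⟩ := exists_mem_jointBox q
  rw [← hper 𝓜.M 𝓜.M_periodic]
  exact (mul_le_mul_of_nonneg_left (norm_sq_le_dotProduct y) hm.le).trans (h q' hq' y)

section

variable {𝓜 : Manipulator} {D : Set Mat4} {gd : ℝ → Mat4} {Vd : ℝ → Vec6}

theorem regVel_eq {d : ℝ} (hd : 0 < d) {t : ℝ} {q e : Vec6} (hq : d ≤ |(𝓜.J q).det|)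
    (he : ‖e‖ ≤ 1) : regVel 𝓜 gd Vd d t (q, e) =
      (𝓜.J q)⁻¹ *ᵥ (e + Vstar (𝓜.g q) (gd t) (Vd t)) := by
  simp only [regVel, clamp_eq he, 𝓜.Jreg_eq hd hq]

/-- The condition on `J v` says that `v` is the regularised velocity at `(q, e)`. So the global
bounds of the regularised data become uniform bounds for the true matrices near the desired
configuration. -/
theorem Admissible.exists_bounds (h : Admissible 𝓜 D gd Vd) :
    ∃ r > 0, ∃ b > 0, ∃ a > 0, ∃ m > 0, ∀ t, 0 ≤ t → ∀ q e v : Vec6,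
      (∀ a b, |(gde (𝓜.g q) (gd t) - 1) a b| ≤ r) → ‖e‖ ≤ 1 →
      𝓜.J q *ᵥ v = e + Vstar (𝓜.g q) (gd t) (Vd t) →
      (∀ y, ‖Minvt 𝓜 q *ᵥ y‖ ≤ b * ‖y‖) ∧
      (∀ y, ‖((𝓜.J q * (𝓜.M q)⁻¹ * 𝓜.C q v - 𝓜.Jdot q v) * (𝓜.J q)⁻¹) *ᵥ y‖ ≤ b * ‖y‖) ∧
      (∀ y, a * ‖y‖ ^ 2 ≤ y ⬝ᵥ Minvt 𝓜 q *ᵥ y) ∧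
      m * ‖e‖ ^ 2 ≤ (((𝓜.J q)⁻¹ *ᵥ e) ⬝ᵥ 𝓜.M q *ᵥ ((𝓜.J q)⁻¹ *ᵥ e)) / 2 ∧
      (((𝓜.J q)⁻¹ *ᵥ e) ⬝ᵥ 𝓜.M q *ᵥ ((𝓜.J q)⁻¹ *ᵥ e)) / 2 ≤ b * ‖e‖ ^ 2 := by
  obtain ⟨r, hr, d, hd, hreg⟩ := h.exists_region
  obtain ⟨m, hm, hM⟩ := 𝓜.exists_inertia_lower
  obtain ⟨b₁, hb₁, hP⟩ := UnifLip.exists_norm_mulVec_le (unifLip_Minvt 𝓜)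
  obtain ⟨b₂, hb₂, hB⟩ := UnifLip.exists_norm_mulVec_le (unifLip_regCoriolis h hd)
  obtain ⟨b₃, hb₃, hJ⟩ := UnifLip.exists_norm_mulVec_le 𝓜.unifLip_J
  obtain ⟨b₄, hb₄, hN⟩ := UnifLip.exists_norm_mulVec_le (𝓜.unifLip_Jreg hd)
  obtain ⟨b₅, hb₅, hNT⟩ := UnifLip.exists_norm_mulVec_le
    (A := fun _ (z : Vec6 × Vec6) => (𝓜.Jreg d z.1)ᵀ) fun i j => 𝓜.unifLip_Jreg hd j i
  obtain ⟨b₆, hb₆, hMb⟩ := UnifLip.exists_norm_mulVec_le 𝓜.unifLip_M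
  refine ⟨r, hr, b₁ + b₂ + 3 * b₄ * (b₆ * b₄), by positivity, m / (b₅ * b₆) ^ 2, by positivity,
    m / (2 * b₃ ^ 2), by positivity, fun t ht q e v hq he hv => ?_⟩
  obtain ⟨hqD, hqd⟩ := hreg t ht q hq
  have hJu : IsUnit (𝓜.J q).det := (Matrix.isUnit_iff_isUnit_det _).1 (h.nonsingular q hqD)
  have hJ1 : 𝓜.J q * (𝓜.J q)⁻¹ = 1 := Matrix.mul_nonsing_inv _ hJu
  have hJ2 : (𝓜.J q)⁻¹ * 𝓜.J q = 1 := Matrix.nonsing_inv_mul _ hJu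
  have hreg_eq := 𝓜.Jreg_eq hd hqd
  have hv' : v = regVel 𝓜 gd Vd d t (q, e) := by
    rw [regVel_eq hd hqd he, ← hv, mulVec_mulVec, hJ2, one_mulVec]
  have hpos1 : 0 ≤ 3 * b₄ * (b₆ * b₄) := by positivity
  refine ⟨fun y => (hP t ht (q, e) y).trans (by gcongr; linarith), fun y => ?_, fun y => ?_, ?_, ?_⟩
  · have := hB t ht (q, e) y
    rw [regCoriolis, ← hv'] at this
    simp only [hreg_eq] at this
    exact this.trans (by gcongr; linarith)
  -- With `M z = Jᵀ y` one has `y·M̃⁻¹y = z·Mz`, and `y = J⁻ᵀ M z` is bounded by a multiple of `z`.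
  · set z := (𝓜.M q)⁻¹ *ᵥ ((𝓜.J q)ᵀ *ᵥ y) with hz
    have hMz : 𝓜.M q *ᵥ z = (𝓜.J q)ᵀ *ᵥ y := by
      rw [hz, mulVec_mulVec, Matrix.mul_nonsing_inv _ (𝓜.M_det q), one_mulVec]
    have hy : y = (𝓜.Jreg d q)ᵀ *ᵥ (𝓜.M q *ᵥ z) := by
      rw [hMz, hreg_eq, mulVec_mulVec, ← transpose_mul, hJ1, transpose_one, one_mulVec]
    have hyz : ‖y‖ ≤ b₅ * b₆ * ‖z‖ := by
      conv_lhs => rw [hy]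
      rw [mul_assoc]
      exact (hNT t ht (q, e) _).trans (mul_le_mul_of_nonneg_left (hMb t ht (q, e) z) hb₅.le)
    have hq : y ⬝ᵥ Minvt 𝓜 q *ᵥ y = z ⬝ᵥ 𝓜.M q *ᵥ z := by
      rw [Minvt, ← mulVec_mulVec, ← mulVec_mulVec, ← hz, hMz, dotProduct_mulVec, dotProduct_comm,
        mulVec_transpose]
    rw [hq]
    refine le_trans ?_ (hM q z)
    calc m / (b₅ * b₆) ^ 2 * ‖y‖ ^ 2 ≤ m / (b₅ * b₆) ^ 2 * (b₅ * b₆ * ‖z‖) ^ 2 := by gcongr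
      _ = m * ‖z‖ ^ 2 := by field_simp
  · set w := (𝓜.J q)⁻¹ *ᵥ e with hw
    have he' : ‖e‖ ≤ b₃ * ‖w‖ := by
      have : e = 𝓜.J q *ᵥ w := by rw [hw, mulVec_mulVec, hJ1, one_mulVec]
      conv_lhs => rw [this]
      exact hJ t ht (q, e) w
    calc m / (2 * b₃ ^ 2) * ‖e‖ ^ 2 ≤ m / (2 * b₃ ^ 2) * (b₃ * ‖w‖) ^ 2 := by gcongr
      _ = m * ‖w‖ ^ 2 / 2 := by field_simp
      _ ≤ _ := by gcongr; exact hM q w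
  · set w := (𝓜.J q)⁻¹ *ᵥ e with hw
    have hwe : ‖w‖ ≤ b₄ * ‖e‖ := by
      have := hN t ht (q, e) e
      simp only [hreg_eq] at this
      exact this
    have h1 := (le_abs_self _).trans (abs_dotProduct_le w (𝓜.M q *ᵥ w))
    have hcard : (Fintype.card Ix : ℝ) = 6 := by simp [Ix]
    rw [hcard] at h1
    have h2 : ‖𝓜.M q *ᵥ w‖ ≤ b₆ * (b₄ * ‖e‖) :=
      (hMb t ht (q, e) w).trans (by gcongr)
    calc _ ≤ 6 * ‖w‖ * ‖𝓜.M q *ᵥ w‖ / 2 := by gcongr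
      _ ≤ 6 * (b₄ * ‖e‖) * (b₆ * (b₄ * ‖e‖)) / 2 := by gcongr
      _ = 3 * b₄ * (b₆ * b₄) * ‖e‖ ^ 2 := by ring
      _ ≤ _ := by gcongr; linarith

/-! ### Error dynamics along a motion -/

theorem differentiableWithinAt_Ad {A : ℝ → Mat4} {s : Set ℝ} {t : ℝ}
    (hA : ∀ a b, DifferentiableWithinAt ℝ (fun τ => A τ a b) s t) (i j) :
    DifferentiableWithinAt ℝ (fun τ => Ad (A τ) i j) s t := by
  have hrot : ∀ a b, DifferentiableWithinAt ℝ (fun τ => rot (A τ) a b) s t := fun a b => hA _ _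
  have hpos : ∀ a, DifferentiableWithinAt ℝ (fun τ => pos (A τ) a) s t := fun a => hA _ _
  have hskew : ∀ a b, DifferentiableWithinAt ℝ (fun τ => skew (pos (A τ)) a b) s t := by
    intro a b
    fin_cases a <;> fin_cases b
    · exact differentiableWithinAt_const 0
    · exact (hpos 2).neg
    · exact hpos 1
    · exact hpos 2
    · exact differentiableWithinAt_const 0
    · exact (hpos 0).neg
    · exact (hpos 1).neg
    · exact hpos 0
    · exact differentiableWithinAt_const 0
  rcases i with i | i <;> rcases j with j | j
  · exact hrot i j
  · have : (fun τ => Ad (A τ) (Sum.inl i) (Sum.inr j)) =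
        fun τ => ∑ k, skew (pos (A τ)) i k * rot (A τ) k j := by
      ext τ
      simp [Ad, Matrix.mul_apply]
    rw [this]
    exact DifferentiableWithinAt.fun_sum fun k _ => (hskew i k).mul (hrot k j)
  · exact differentiableWithinAt_const 0
  · exact hrot i j

theorem Admissible.hasEntryDeriv_gd (h : Admissible 𝓜 D gd Vd) {t₀ t : ℝ} (ht₀ : 0 ≤ t₀)
    (ht : t₀ ≤ t) : HasEntryDeriv gd (gd t * hat (Vd t)) (Ici t₀) t :=
  fun i j => (h.kinematics t (ht₀.trans ht) i j).mono (Ici_subset_Ici.2 ht₀)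

/-- Ensures that the `derivWithin` in the control law is a genuine derivative and not the default
value zero. -/
theorem Admissible.differentiableWithinAt_Vstar (h : Admissible 𝓜 D gd Vd) {t₀ t : ℝ}
    (ht₀ : 0 ≤ t₀) (ht : t₀ ≤ t) {q : ℝ → Vec6} {v : Vec6}
    (hq : HasDerivWithinAt q v (Ici t₀) t) :
    DifferentiableWithinAt ℝ (fun s => Vstar (𝓜.g (q s)) (gd s) (Vd s)) (Ici t₀) t := by
  have hu := uniqueDiffOn_Ici t₀ t ht
  have hgd := h.gd_mem (ht₀.trans ht)
  have h1 := hasEntryDeriv_gde 𝓜 hgd (h.hasEntryDeriv_gd ht₀ ht) hq hu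
  have h2 := h1.inv (det_ne_zero_SE3 (gde_mem (𝓜.g_mem _) hgd)) hu
  have h3 := differentiableWithinAt_Ad fun a b => (h2 a b).differentiableWithinAt
  have h4 : DifferentiableWithinAt ℝ Vd (Ici t₀) t :=
    (h.velocity_diff t (ht₀.trans ht)).mono (Ici_subset_Ici.2 ht₀)
  rw [differentiableWithinAt_pi] at h4 ⊢
  intro i
  simp only [Vstar, Matrix.mulVec, dotProduct]
  exact DifferentiableWithinAt.fun_sum fun k _ => (h3 i k).mul (h4 k)

variable {f : Mat4 → Mat4 → Vec6} {Kd : Mat6}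

/-- `V^b = e_V + V_d^*`, so subtracting the control law from the dynamics removes the gravity term
and all terms in `V_d^*`. -/
theorem IsMotion.error_dynamics (h : Admissible 𝓜 D gd Vd) {t₀ : ℝ} (ht₀ : 0 ≤ t₀) {T : EReal}
    {q v : ℝ → Vec6} (hm : IsMotion 𝓜 D gd Vd f Kd t₀ T q v) {t : ℝ} (ht : t₀ ≤ t)
    (htT : (t : EReal) < T) :
    ∃ e', HasDerivWithinAt (fun s => eV 𝓜 (gd s) (Vd s) (q s) (v s)) e' (Ici t₀) t ∧
      𝓜.Mt (q t) *ᵥ e' + 𝓜.Ct (q t) (v t) *ᵥ eV 𝓜 (gd t) (Vd t) (q t) (v t) =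
        -f (𝓜.g (q t)) (gd t) - Kd *ᵥ eV 𝓜 (gd t) (Vd t) (q t) (v t) := by
  have hq := hm.velocity t ht htT
  have hV := (h.differentiableWithinAt_Vstar ht₀ ht hq).hasDerivWithinAt
  have hJv := ((𝓜.hasEntryDeriv_J hq).mulVec
    (hm.acceleration t ht htT).hasDerivWithinAt).differentiableWithinAt.hasDerivWithinAt
  refine ⟨_, hJv.sub hV, ?_⟩
  have hdyn := hm.dynamics t ht htT
  rw [control] at hdyn
  have h1 : 𝓜.Ct (q t) (v t) *ᵥ eV 𝓜 (gd t) (Vd t) (q t) (v t) =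
      𝓜.Ct (q t) (v t) *ᵥ (𝓜.J (q t) *ᵥ v t) -
        𝓜.Ct (q t) (v t) *ᵥ Vstar (𝓜.g (q t)) (gd t) (Vd t) := by
    rw [eV, mulVec_sub]
  rw [h1, mulVec_sub]
  ext i
  have := congrFun hdyn i
  simp only [Pi.add_apply, Pi.sub_apply, Pi.neg_apply] at this ⊢
  linarith

theorem frobenius_eq (X : Mat4) : frobenius X = Real.sqrt (∑ i, ∑ j, X i j ^ 2) := by
  rw [← frobenius_sq, Real.sqrt_sq (frobenius_nonneg X)]

theorem continuousWithinAt_error {q e : ℝ → Vec6} {v : Vec6} (h : Admissible 𝓜 D gd Vd)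
    {t₀ : ℝ} (ht₀ : 0 ≤ t₀) {t : ℝ} (ht : t₀ ≤ t) (hq : HasDerivWithinAt q v (Ici t₀) t)
    (he : ContinuousWithinAt e (Ici t₀) t) :
    ContinuousWithinAt (fun s => frobenius (1 - gde (𝓜.g (q s)) (gd s)) + euclNorm (e s))
      (Ici t₀) t := by
  have h1 := hasEntryDeriv_gde 𝓜 (h.gd_mem (ht₀.trans ht)) (h.hasEntryDeriv_gd ht₀ ht) hq
    (uniqueDiffOn_Ici t₀ t ht)
  refine ContinuousWithinAt.add ?_ ?_
  · simp only [frobenius_eq, Matrix.sub_apply]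
    refine ContinuousWithinAt.sqrt ?_
    exact tendsto_finsetSum _ fun i _ => tendsto_finsetSum _ fun j _ =>
      (continuousWithinAt_const.sub (h1 i j).continuousWithinAt).pow 2
  · refine ContinuousWithinAt.sqrt ?_
    exact tendsto_finsetSum _ fun i _ => (continuousWithinAt_pi.1 he i).pow 2

/-! ### Exponential decay of the error -/

/-- `f` is an elastic force with stiffness `K` near the identity: it is a function `F` of the
configuration error that is Lipschitz near the identity and has linearisation `K`. -/
structure ElasticForce (f : Mat4 → Mat4 → Vec6) (K : Mat6) (F : Mat4 → Vec6) (r C L : ℝ) :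
    Prop where
  posDef : K.PosDef
  r_pos : 0 < r
  C_nonneg : 0 ≤ C
  eq_gde : ∀ g ∈ SE3, ∀ gd ∈ SE3, f g gd = F (gde g gd)
  approx : ∀ h ∈ SE3, (∀ a b, |(h - 1) a b| ≤ r) → ‖F h - K *ᵥ ell h‖ ≤ C * ‖ell h‖ ^ 2
  lipschitz : ∀ X ∈ SE3, ∀ Y ∈ SE3, (∀ a b, |(X - 1) a b| ≤ r) → (∀ a b, |(Y - 1) a b| ≤ r) →
    ∀ δ, (∀ a b, |X a b - Y a b| ≤ δ) → ∀ i, |F X i - F Y i| ≤ L * δ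

theorem abs_gde_sub_one_le_err (t : ℝ) (q v : Vec6) (a b) :
    |(gde (𝓜.g q) (gd t) - 1) a b| ≤ err 𝓜 (gd t) (Vd t) q v := by
  have h1 := abs_le_frobenius (1 - gde (𝓜.g q) (gd t)) a b
  have h2 : |(gde (𝓜.g q) (gd t) - 1) a b| = |(1 - gde (𝓜.g q) (gd t)) a b| := by
    rw [Matrix.sub_apply, Matrix.sub_apply, abs_sub_comm]
  rw [h2]
  exact h1.trans (le_add_of_nonneg_right (Real.sqrt_nonneg _))

theorem norm_eV_le_err (t : ℝ) (q v : Vec6) :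
    ‖eV 𝓜 (gd t) (Vd t) q v‖ ≤ err 𝓜 (gd t) (Vd t) q v :=
  (norm_le_euclNorm _).trans (le_add_of_nonneg_left (frobenius_nonneg _))

theorem err_nonneg (t : ℝ) (q v : Vec6) : 0 ≤ err 𝓜 (gd t) (Vd t) q v :=
  add_nonneg (frobenius_nonneg _) (Real.sqrt_nonneg _)

/-- The error is equivalent to the norm of the coordinates. -/
theorem norm_ell_le_err (t : ℝ) (q v : Vec6) :
    ‖ell (gde (𝓜.g q) (gd t))‖ ≤ err 𝓜 (gd t) (Vd t) q v := by
  rw [← ell_sub_one]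
  exact norm_ell_le (err_nonneg t q v) (abs_gde_sub_one_le_err t q v)

theorem coordinates_sq_le_err_sq (t : ℝ) (q v : Vec6) :
    ‖ell (gde (𝓜.g q) (gd t))‖ ^ 2 + ‖eV 𝓜 (gd t) (Vd t) q v‖ ^ 2 ≤
      2 * err 𝓜 (gd t) (Vd t) q v ^ 2 := by
  have h1 := pow_le_pow_left₀ (norm_nonneg _) (norm_ell_le_err (Vd := Vd) (gd := gd) (𝓜 := 𝓜) t q v) 2
  have h2 := pow_le_pow_left₀ (norm_nonneg _) (norm_eV_le_err (Vd := Vd) (gd := gd) (𝓜 := 𝓜) t q v) 2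
  linarith

theorem err_sq_le {t : ℝ} {q v : Vec6} (hgd : gd t ∈ SE3)
    (hsmall : err 𝓜 (gd t) (Vd t) q v ≤ 1 / 3) :
    err 𝓜 (gd t) (Vd t) q v ^ 2 ≤
      128 * (‖ell (gde (𝓜.g q) (gd t))‖ ^ 2 + ‖eV 𝓜 (gd t) (Vd t) q v‖ ^ 2) := by
  have h1 : ∀ a b, |(1 - gde (𝓜.g q) (gd t)) a b| ≤ 2 * ‖ell (gde (𝓜.g q) (gd t))‖ := fun a b => by
    have := abs_sub_one_le (gde_mem (𝓜.g_mem q) hgd) hsmall (abs_gde_sub_one_le_err t q v) a b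
    rwa [Matrix.sub_apply, abs_sub_comm] at this
  have h2 : frobenius (1 - gde (𝓜.g q) (gd t)) ≤ 8 * ‖ell (gde (𝓜.g q) (gd t))‖ :=
    (frobenius_le (by positivity) h1).trans (le_of_eq (by ring))
  have h3 := euclNorm_le (eV 𝓜 (gd t) (Vd t) q v)
  have hcard : (Fintype.card Ix : ℝ) = 6 := by simp [Ix]
  rw [hcard] at h3
  have h5 := pow_le_pow_left₀ (err_nonneg t q v) (add_le_add h2 h3) 2
  refine h5.trans ?_
  generalize ‖ell (gde (𝓜.g q) (gd t))‖ = X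
  generalize ‖eV 𝓜 (gd t) (Vd t) q v‖ = Y
  -- `(8X + 6Y)² ≤ 2 (64 X² + 36 Y²) ≤ 128 (X² + Y²)`.
  nlinarith [sq_nonneg (8 * X - 6 * Y), sq_nonneg Y]

theorem half_le_of_le {x y : ℝ} (h : x ≤ y) (hy : 0 ≤ y) : x / 2 ≤ y := by linarith

-- While the error stays below `ρ`, the strict Lyapunov function decays exponentially and is
-- equivalent to the squared error. All constants are chosen before `t₀`, `T` and the motion, which
-- gives uniformity.
set_option maxHeartbeats 1000000 in
theorem exists_local_decay {K : Mat6} {F : Mat4 → Vec6} {r C L : ℝ} (h : Admissible 𝓜 D gd Vd)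
    (hF : ElasticForce f K F r C L) (hKd : Kd.PosDef) :
    ∃ ρ > 0, ∃ A, 1 ≤ A ∧ ∃ l > 0, ∀ t₀, 0 ≤ t₀ → ∀ (T : EReal) (q v : ℝ → Vec6),
      IsMotion 𝓜 D gd Vd f Kd t₀ T q v → ∀ s : ℝ,
      (∀ t ∈ Ico t₀ s, (t : EReal) < T ∧ err 𝓜 (gd t) (Vd t) (q t) (v t) < ρ) →
      ∀ t ∈ Ico t₀ s, err 𝓜 (gd t) (Vd t) (q t) (v t) ≤
        A * err 𝓜 (gd t₀) (Vd t₀) (q t₀) (v t₀) * Real.exp (-l * (t - t₀)) := by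
  obtain ⟨r₁, hr₁, b₁, hb₁, a, ha, m, hm, hbounds⟩ := h.exists_bounds
  obtain ⟨k, hk, b₂, hb₂, hKl, hKb⟩ := exists_posDef_bounds hF.posDef
  obtain ⟨κ, hκ, b₃, hb₃, hKdl, hKdb⟩ := exists_posDef_bounds hKd
  set b := b₁ + b₂ + b₃ with hb
  have hb0 : 0 < b := by positivity
  -- One constant for both remainders: `C` from the force, `8` from the kinematics of `ell`.
  set C' := max C 8 with hC'
  have hC'0 : 0 ≤ C' := hF.C_nonneg.trans (le_max_left _ _)
  set E := 6 * (b + 1) ^ 3 * (C' + 1) with hE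
  have hE0 : 0 < E := by positivity
  have hbE : 6 * b ≤ E := by
    have h1 : b ≤ (b + 1) ^ 3 := by
      have : b + 1 ≤ (b + 1) ^ 3 := le_self_pow₀ (by linarith) (by norm_num)
      linarith
    calc 6 * b ≤ 6 * (b + 1) ^ 3 * 1 := by linarith
      _ ≤ E := by rw [hE]; gcongr; linarith
  obtain ⟨c, hc, ρ₀, hρ₀, l, hl, α, hα, β, hβ, hρ₁, hlyap⟩ := exists_strict_lyapunov
    (a := a * (k / 6) ^ 2) (k := k / 2) (m := m) hE0 hκ (by positivity) (by positivity) hm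
  set ρ := min ρ₀ (min r₁ (min r (1 / 3))) with hρ
  have hρρ₀ : ρ ≤ ρ₀ := min_le_left _ _
  have hρr₁ : ρ ≤ r₁ := (min_le_right _ _).trans (min_le_left _ _)
  have hρr : ρ ≤ r := (min_le_right _ _).trans ((min_le_right _ _).trans (min_le_left _ _))
  have hρ3 : ρ ≤ 1 / 3 := (min_le_right _ _).trans ((min_le_right _ _).trans (min_le_right _ _))
  -- `err² ≤ 128 (X² + Y²)` at time `t` and `X² + Y² ≤ 2 err²` at time `t₀` give the factor `256 β /
  -- α`. The square root halves the rate, and `+ 1` ensures `1 ≤ A`.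
  refine ⟨ρ, lt_min hρ₀ (lt_min hr₁ (lt_min hF.r_pos (by norm_num))), Real.sqrt (256 * β / α) + 1,
    by linarith [Real.sqrt_nonneg (256 * β / α)], l / 2, by positivity, ?_⟩
  intro t₀ ht₀ T q v hmot s hs
  set e : ℝ → Vec6 := fun t => eV 𝓜 (gd t) (Vd t) (q t) (v t) with he
  set H : ℝ → Mat4 := fun t => gde (𝓜.g (q t)) (gd t) with hH
  set η : ℝ → ℝ := fun t => err 𝓜 (gd t) (Vd t) (q t) (v t) with hη
  -- The potential is the quadratic form of the stiffness rather than an exact potential of the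
  -- force; the mismatch is the remainder `r₂'`, which enters the derivative at third order.
  set V : ℝ → ℝ := fun t => (ell (H t) ⬝ᵥ K *ᵥ ell (H t)) / 2 +
    (((𝓜.J (q t))⁻¹ *ᵥ e t) ⬝ᵥ 𝓜.M (q t) *ᵥ ((𝓜.J (q t))⁻¹ *ᵥ e t)) / 2 +
    c * ((K *ᵥ ell (H t)) ⬝ᵥ e t) with hV
  have hcard : (Fintype.card Ix : ℝ) = 6 := by simp [Ix]
  have key : ∀ t ∈ Ico t₀ s, ∃ V', HasDerivWithinAt V V' (Ici t₀) t ∧ V' ≤ -l * V t ∧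
      α * (‖ell (H t)‖ ^ 2 + ‖e t‖ ^ 2) ≤ V t ∧ V t ≤ β * (‖ell (H t)‖ ^ 2 + ‖e t‖ ^ 2) := by
    intro t ht
    obtain ⟨htT, hηt⟩ := hs t ht
    have ht0 : 0 ≤ t := ht₀.trans ht.1
    have hgd := h.gd_mem ht0
    have hHmem : H t ∈ SE3 := gde_mem (𝓜.g_mem _) hgd
    have hH1 : ∀ a b, |(H t - 1) a b| ≤ η t := fun a b => abs_gde_sub_one_le_err t (q t) (v t) a b
    have heη : ‖e t‖ ≤ η t := norm_eV_le_err t (q t) (v t)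
    have hη0 : 0 ≤ η t := err_nonneg t (q t) (v t)
    have hxη : ‖ell (H t)‖ ≤ η t := norm_ell_le_err t (q t) (v t)
    have hηρ : η t ≤ ρ := hηt.le
    have hJu := h.nonsingular _ (hmot.mem t ht.1 htT)
    have hq := hmot.velocity t ht.1 htT
    have hu := uniqueDiffOn_Ici t₀ t ht.1
    obtain ⟨e', he', hdyn⟩ := hmot.error_dynamics h ht₀ ht.1 htT
    have hJv : 𝓜.J (q t) *ᵥ v t = e t + Vstar (𝓜.g (q t)) (gd t) (Vd t) := by
      simp [he, eV]
    obtain ⟨hPb, hBb, hPl, hTl, hTu⟩ := hbounds t ht0 (q t) (e t) (v t)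
      (fun a b => (hH1 a b).trans (hηρ.trans hρr₁)) (by linarith) hJv
    have hx := (hasEntryDeriv_gde 𝓜 hgd (h.hasEntryDeriv_gd ht₀ ht.1) hq hu).ell
    set r₁' := ell (H t * hat (e t)) - e t with hr₁'
    set r₂' := F (H t) - K *ᵥ ell (H t) with hr₂'
    have hx' : HasDerivWithinAt (fun τ => ell (H τ)) (e t + r₁') (Ici t₀) t := by
      rw [hr₁', add_sub_cancel]
      exact hx
    have hf : -f (𝓜.g (q t)) (gd t) - Kd *ᵥ e t = -(K *ᵥ ell (H t) + r₂') - Kd *ᵥ e t := by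
      rw [hF.eq_gde _ (𝓜.g_mem _) _ hgd, hr₂', add_sub_cancel]
    have hT := Manipulator.hasDerivWithinAt_kinetic hu hq he' hJu hdyn
    have he'_eq := (Manipulator.dynamics_iff hJu).1 hdyn
    rw [mulVec_mulVec] at he'_eq
    have hKc : ∀ {x : ℝ → Vec6} {x' : Vec6}, HasDerivWithinAt x x' (Ici t₀) t →
        HasDerivWithinAt (fun τ => K *ᵥ x τ) (K *ᵥ x') (Ici t₀) t := fun hx => by
      simpa using (HasEntryDeriv.const K (Ici t₀) t).mulVec hx
    have hVd := (((hasDerivWithinAt_dotProduct hx' (hKc hx')).div_const 2).add hT).add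
      ((hasDerivWithinAt_dotProduct (hKc hx') he').const_mul c)
    have hKsymm : ell (H t) ⬝ᵥ K *ᵥ (e t + r₁') = (e t + r₁') ⬝ᵥ K *ᵥ ell (H t) := by
      have hKt : Kᵀ = K := by
        have := hF.posDef.1
        rwa [Matrix.IsHermitian, conjTranspose_eq_transpose_of_trivial] at this
      conv_lhs => rw [← hKt, mulVec_transpose, dotProduct_comm, ← dotProduct_mulVec]
    refine ⟨_, hVd, ?_⟩
    have hmain := lyapunov_deriv_le (K := K) (Kd := Kd) (P := Minvt 𝓜 (q t))
      (B := (𝓜.J (q t) * (𝓜.M (q t))⁻¹ * 𝓜.C (q t) (v t) - 𝓜.Jdot (q t) (v t)) * (𝓜.J (q t))⁻¹)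
      (a := a) (κ := κ) (k := k) (b := b) (C := C') (c := c) hb0.le hC'0 hc.le ha.le hk.le
      (fun y => (hKb y).trans (by gcongr; linarith)) (fun y => (hKdb y).trans (by gcongr; linarith))
      (fun y => (hPb y).trans (by gcongr; linarith)) (fun y => (hBb y).trans (by gcongr; linarith))
      hKl hKdl hPl (x := ell (H t)) (e := e t) (r₁ := r₁') (r₂ := r₂') (by linarith)
      ((norm_ell_mul_hat_sub_le hHmem hρ3 (fun a b => (hH1 a b).trans hηρ) (e t)).trans
        (by gcongr; exact le_max_right _ _))
      ((hF.approx _ hHmem fun a b => (hH1 a b).trans (hηρ.trans hρr)).trans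
        (by gcongr; exact le_max_left _ _)) (D := E) le_rfl
    have hdot : ∀ y z : Vec6, |(K *ᵥ y) ⬝ᵥ z| ≤ E * ‖y‖ * ‖z‖ := fun y z => by
      have h1 := abs_dotProduct_le (K *ᵥ y) z
      rw [hcard] at h1
      calc _ ≤ 6 * ‖K *ᵥ y‖ * ‖z‖ := h1
        _ ≤ 6 * (b₂ * ‖y‖) * ‖z‖ := by gcongr; exact hKb y
        _ = 6 * b₂ * ‖y‖ * ‖z‖ := by ring
        _ ≤ E * ‖y‖ * ‖z‖ := by gcongr; linarith
    have hPot : (ell (H t) ⬝ᵥ K *ᵥ ell (H t)) / 2 ≤ E * ‖ell (H t)‖ ^ 2 := by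
      have h1 := (le_abs_self _).trans (hdot (ell (H t)) (ell (H t)))
      rw [dotProduct_comm] at h1
      rw [mul_assoc, ← pow_two] at h1
      exact (half_le_of_le h1 (by positivity))
    have hfin := hlyap ‖ell (H t)‖ ‖e t‖ _ _ _ _ (norm_nonneg _) (hxη.trans (hηρ.trans hρρ₀))
      (norm_nonneg _) (heη.trans (hηρ.trans hρρ₀))
      (show k / 2 * ‖ell (H t)‖ ^ 2 ≤ (ell (H t) ⬝ᵥ K *ᵥ ell (H t)) / 2 by
        linarith [hKl (ell (H t))]) hPot hTl
      (hTu.trans (by gcongr; linarith)) (hdot (ell (H t)) (e t)) hmain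
    refine ⟨?_, hfin.1, hfin.2.1⟩
    refine le_trans (le_of_eq ?_) hfin.2.2
    rw [hKsymm, add_self_div_two]
    have hF' : e t ⬝ᵥ (-f (𝓜.g (q t)) (gd t) - Kd *ᵥ e t) =
        e t ⬝ᵥ (-(K *ᵥ ell (H t) + r₂') - Kd *ᵥ e t) := by rw [hf]
    have he'' : e' = Minvt 𝓜 (q t) *ᵥ (-(K *ᵥ ell (H t) + r₂') - Kd *ᵥ e t) -
        ((𝓜.J (q t) * (𝓜.M (q t))⁻¹ * 𝓜.C (q t) (v t) - 𝓜.Jdot (q t) (v t)) *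
          (𝓜.J (q t))⁻¹) *ᵥ e t := by
      rw [← hf]
      exact he'_eq
    rw [← he'']
    congr 2
  choose! V' hVd hVle hVlow hVup using key
  have hexp := le_mul_exp_of_deriv_le hVd hVle
  intro t ht
  have ht₀' : t₀ ∈ Ico t₀ s := ⟨le_rfl, ht.1.trans_lt ht.2⟩
  have hXY : ∀ τ, ‖ell (H τ)‖ ^ 2 + ‖e τ‖ ^ 2 ≤ 2 * η τ ^ 2 := fun τ =>
    coordinates_sq_le_err_sq τ (q τ) (v τ)
  have hηXY : η t ^ 2 ≤ 128 * (‖ell (H t)‖ ^ 2 + ‖e t‖ ^ 2) :=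
    err_sq_le (h.gd_mem (ht₀.trans ht.1)) ((hs t ht).2.le.trans hρ3)
  have hsq : η t ^ 2 ≤ (Real.sqrt (256 * β / α) * η t₀ * Real.exp (-(l / 2) * (t - t₀))) ^ 2 := by
    have h1 := hVlow t ht
    have h2 := hexp t ht
    have h3 := (hVup t₀ ht₀').trans (mul_le_mul_of_nonneg_left (hXY t₀) hβ.le)
    have h4 : V t₀ * Real.exp (-l * (t - t₀)) ≤
        β * (2 * η t₀ ^ 2) * Real.exp (-l * (t - t₀)) := by gcongr
    have h5 : ‖ell (H t)‖ ^ 2 + ‖e t‖ ^ 2 ≤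
        β * (2 * η t₀ ^ 2) * Real.exp (-l * (t - t₀)) / α := by
      rw [le_div_iff₀ hα]
      linarith
    have h6 : Real.exp (-(l / 2) * (t - t₀)) ^ 2 = Real.exp (-l * (t - t₀)) := by
      rw [← Real.exp_nat_mul]
      congr 1
      push_cast
      ring
    rw [mul_pow, mul_pow, h6, Real.sq_sqrt (by positivity)]
    calc η t ^ 2 ≤ 128 * (β * (2 * η t₀ ^ 2) * Real.exp (-l * (t - t₀)) / α) := by linarith
      _ = _ := by ring
  have hη₀ : 0 ≤ η t₀ := err_nonneg t₀ (q t₀) (v t₀)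
  have hfin := le_of_sq_le_sq hsq (by positivity)
  refine hfin.trans ?_
  gcongr
  linarith

end

/-! ### Decay without an a priori bound on the error -/

section

variable {𝓜 : Manipulator} {D : Set Mat4} {gd : ℝ → Mat4} {Vd : ℝ → Vec6}
  {f : Mat4 → Mat4 → Vec6} {Kd K : Mat6} {F : Mat4 → Vec6} {r C L : ℝ}

theorem continuousWithinAt_err (h : Admissible 𝓜 D gd Vd) {t₀ : ℝ} (ht₀ : 0 ≤ t₀) {T : EReal}
    {q v : ℝ → Vec6} (hm : IsMotion 𝓜 D gd Vd f Kd t₀ T q v) {t : ℝ} (ht : t₀ ≤ t)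
    (htT : (t : EReal) < T) :
    ContinuousWithinAt (fun s => err 𝓜 (gd s) (Vd s) (q s) (v s)) (Ici t₀) t := by
  obtain ⟨e', he', -⟩ := hm.error_dynamics h ht₀ ht htT
  exact continuousWithinAt_error h ht₀ ht (hm.velocity t ht htT) he'.continuousWithinAt

/-- Motions with small initial error decay exponentially. -/
theorem exists_decay (h : Admissible 𝓜 D gd Vd) (hF : ElasticForce f K F r C L)
    (hKd : Kd.PosDef) :
    ∃ δ > 0, ∃ A, 1 ≤ A ∧ ∃ l > 0, ∀ t₀, 0 ≤ t₀ → ∀ (T : EReal) (q v : ℝ → Vec6),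
      IsMotion 𝓜 D gd Vd f Kd t₀ T q v → err 𝓜 (gd t₀) (Vd t₀) (q t₀) (v t₀) < δ →
      ∀ t : ℝ, t₀ ≤ t → (t : EReal) < T → err 𝓜 (gd t) (Vd t) (q t) (v t) ≤
        A * err 𝓜 (gd t₀) (Vd t₀) (q t₀) (v t₀) * Real.exp (-l * (t - t₀)) := by
  obtain ⟨ρ, hρ, A, hA, l, hl, hdecay⟩ := exists_local_decay h hF hKd
  have hA0 : 0 < A := one_pos.trans_le hA
  -- The decay estimate then gives at most `ρ / 2` as long as the error is below `ρ`, as the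
  -- trapping argument requires.
  refine ⟨ρ / (2 * A), by positivity, A, hA, l, hl, ?_⟩
  intro t₀ ht₀ T q v hm herr t ht htT
  -- The local estimate is for half-open intervals, so a time strictly between `t` and `T` is needed
  -- to include `t`.
  obtain ⟨s, hts, hsT⟩ := EReal.lt_iff_exists_real_btwn.1 htT
  have hts' : t < s := EReal.coe_lt_coe_iff.1 hts
  have hltT : ∀ u : ℝ, u ≤ s → (u : EReal) < T := fun u hu =>
    (EReal.coe_le_coe_iff.2 hu).trans_lt hsT
  have hherr : A * err 𝓜 (gd t₀) (Vd t₀) (q t₀) (v t₀) ≤ ρ / 2 := by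
    calc A * err 𝓜 (gd t₀) (Vd t₀) (q t₀) (v t₀) ≤ A * (ρ / (2 * A)) := by gcongr
      _ = ρ / 2 := by field_simp
  have h0 : err 𝓜 (gd t₀) (Vd t₀) (q t₀) (v t₀) < ρ := by
    have := le_mul_of_one_le_left (err_nonneg (𝓜 := 𝓜) (gd := gd) (Vd := Vd) t₀ (q t₀) (v t₀)) hA
    linarith
  have htrap := lt_of_trapped (η := fun s => err 𝓜 (gd s) (Vd s) (q s) (v s)) (t₀ := t₀) (t₁ := s)
    hρ (fun u hu => (continuousWithinAt_err h ht₀ hm hu.1 (hltT u hu.2)).mono fun w hw => hw.1) h0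
    (fun u hu hlt w hw => by
      have h1 := hdecay t₀ ht₀ T q v hm u
        (fun τ hτ => ⟨hltT τ (hτ.2.le.trans hu.2), hlt τ hτ⟩) w hw
      refine h1.trans (le_trans ?_ hherr)
      refine mul_le_of_le_one_right (mul_nonneg hA0.le (err_nonneg _ _ _)) ?_
      rw [Real.exp_le_one_iff]
      have : 0 ≤ l * (w - t₀) := mul_nonneg hl.le (by linarith [hw.1])
      linarith)
  exact hdecay t₀ ht₀ T q v hm s
    (fun τ hτ => ⟨hltT τ hτ.2.le, htrap τ ⟨hτ.1, hτ.2.le⟩⟩) t ⟨ht, hts'⟩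

/-! ### Existence of motions -/

/-- Extension of Lipschitz functions, componentwise: the force is controlled only on rigid motions
near the identity, but the regularised field has to be globally Lipschitz. -/
theorem ElasticForce.exists_extension (hF : ElasticForce f K F r C L) :
    ∃ (F' : Mat4 → Vec6) (L' : ℝ),
      (∀ i X Y δ, (∀ a b, |X a b - Y a b| ≤ δ) → |F' X i - F' Y i| ≤ L' * δ) ∧
      ∀ X ∈ SE3, (∀ a b, |(X - 1) a b| ≤ r) → F X = F' X := by
  let I := Fin 3 ⊕ Unit
  have hL : LipschitzOnWith (Real.toNNReal L) (fun X : I → I → ℝ => F X)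
      {X : I → I → ℝ | (show Mat4 from X) ∈ SE3 ∧ ∀ a b, |((show Mat4 from X) - 1) a b| ≤ r} := by
    refine LipschitzOnWith.of_dist_le_mul fun X hX Y hY => ?_
    refine (dist_pi_le_iff (by positivity)).2 fun i => ?_
    have h1 := hF.lipschitz X hX.1 Y hY.1 hX.2 hY.2 (dist X Y) (fun a b =>
      (dist_le_pi_dist (X a) (Y a) b).trans (dist_le_pi_dist X Y a)) i
    refine h1.trans (mul_le_mul_of_nonneg_right ?_ dist_nonneg)
    exact Real.le_coe_toNNReal L
  obtain ⟨F', hF', hEq⟩ := hL.extend_pi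
  refine ⟨F', Real.toNNReal L, fun i X Y δ hδ => ?_, fun X hX hXr => hEq ⟨hX, hXr⟩⟩
  have hδ0 : 0 ≤ δ := (abs_nonneg _).trans (hδ (Sum.inr ()) (Sum.inr ()))
  have h1 : dist (show I → I → ℝ from X) (show I → I → ℝ from Y) ≤ δ :=
    (dist_pi_le_iff hδ0).2 fun a => (dist_pi_le_iff hδ0).2 fun b => hδ a b
  have h2 := hF'.dist_le_mul (show I → I → ℝ from X) (show I → I → ℝ from Y)
  exact (dist_le_pi_dist (F' X) (F' Y) i).trans
    (h2.trans (mul_le_mul_of_nonneg_left h1 (NNReal.coe_nonneg _)))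

/-- Solutions of the regularised vector field with small error are motions. -/
theorem isMotion_of_regField (h : Admissible 𝓜 D gd Vd) {d ρ : ℝ} (hd : 0 < d)
    (hρ1 : ρ ≤ 1) {F' : Mat4 → Vec6}
    (hreg : ∀ t, 0 ≤ t → ∀ q, (∀ a b, |(gde (𝓜.g q) (gd t) - 1) a b| ≤ ρ) →
      𝓜.g q ∈ D ∧ d ≤ |(𝓜.J q).det| ∧ f (𝓜.g q) (gd t) = F' (gde (𝓜.g q) (gd t)))
    {t₀ : ℝ} (ht₀ : 0 ≤ t₀) {z : ℝ → Vec6 × Vec6}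
    (hz : ∀ t, t₀ ≤ t → HasDerivWithinAt z (regField 𝓜 gd Vd d F' Kd t (z t)) (Ici t₀) t)
    {T : EReal}
    (hη : ∀ t : ℝ, t₀ ≤ t → (t : EReal) < T →
      frobenius (1 - gde (𝓜.g (z t).1) (gd t)) + euclNorm (z t).2 < ρ) :
    IsMotion 𝓜 D gd Vd f Kd t₀ T (fun t => (z t).1)
      (fun t => (𝓜.J (z t).1)⁻¹ *ᵥ ((z t).2 + Vstar (𝓜.g (z t).1) (gd t) (Vd t))) := by
  have hsmall : ∀ t : ℝ, t₀ ≤ t → (t : EReal) < T → ∀ a b,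
      |(gde (𝓜.g (z t).1) (gd t) - 1) a b| ≤ ρ := fun t ht htT a b => by
    have h1 := abs_le_frobenius (1 - gde (𝓜.g (z t).1) (gd t)) a b
    rw [Matrix.sub_apply, abs_sub_comm] at h1
    have h2 : 0 ≤ euclNorm (z t).2 := Real.sqrt_nonneg _
    exact h1.trans (by linarith [hη t ht htT])
  have hnorm : ∀ t : ℝ, t₀ ≤ t → (t : EReal) < T → ‖(z t).2‖ ≤ 1 := fun t ht htT => by
    have h1 := frobenius_nonneg (1 - gde (𝓜.g (z t).1) (gd t))
    linarith [hη t ht htT, norm_le_euclNorm (z t).2]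
  have hvel : ∀ t : ℝ, t₀ ≤ t → (t : EReal) < T →
      regVel 𝓜 gd Vd d t (z t) =
        (𝓜.J (z t).1)⁻¹ *ᵥ ((z t).2 + Vstar (𝓜.g (z t).1) (gd t) (Vd t)) := fun t ht htT =>
    regVel_eq hd (hreg t (ht₀.trans ht) _ (hsmall t ht htT)).2.1 (hnorm t ht htT)
  have hq : ∀ t : ℝ, t₀ ≤ t → (t : EReal) < T → HasDerivWithinAt (fun t => (z t).1)
      ((𝓜.J (z t).1)⁻¹ *ᵥ ((z t).2 + Vstar (𝓜.g (z t).1) (gd t) (Vd t))) (Ici t₀) t :=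
    fun t ht htT => by
      rw [← hvel t ht htT]
      exact (hasFDerivAt_fst (𝕜 := ℝ) (p := z t)).comp_hasDerivWithinAt t (hz t ht)
  have he : ∀ t : ℝ, t₀ ≤ t → HasDerivWithinAt (fun t => (z t).2)
      (regField 𝓜 gd Vd d F' Kd t (z t)).2 (Ici t₀) t := fun t ht =>
    (hasFDerivAt_snd (𝕜 := ℝ) (p := z t)).comp_hasDerivWithinAt t (hz t ht)
  have hdet : ∀ t : ℝ, t₀ ≤ t → (t : EReal) < T → (𝓜.J (z t).1).det ≠ 0 := fun t ht htT =>
    abs_pos.1 (hd.trans_le (hreg t (ht₀.trans ht) _ (hsmall t ht htT)).2.1)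
  refine ⟨fun t ht htT => (hreg t (ht₀.trans ht) _ (hsmall t ht htT)).1, hq, fun t ht htT => ?_,
    fun t ht htT => ?_⟩
  · exact (((𝓜.hasEntryDeriv_J (hq t ht htT)).inv (hdet t ht htT)
      (uniqueDiffOn_Ici t₀ t ht)).mulVec ((he t ht).add
        (h.differentiableWithinAt_Vstar ht₀ ht
          (hq t ht htT)).hasDerivWithinAt)).differentiableWithinAt
  · have hu := uniqueDiffOn_Ici t₀ t ht
    have hJ : ∀ {s : ℝ} (x : Vec6), (𝓜.J (z s).1).det ≠ 0 →
        𝓜.J (z s).1 *ᵥ ((𝓜.J (z s).1)⁻¹ *ᵥ x) = x := fun x hs => by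
      rw [mulVec_mulVec, Matrix.mul_nonsing_inv _ (isUnit_iff_ne_zero.2 hs), one_mulVec]
    have hVs := (h.differentiableWithinAt_Vstar ht₀ ht (hq t ht htT)).hasDerivWithinAt
    have hdetc : ContinuousWithinAt (fun s => (𝓜.J (z s).1).det) (Ici t₀) t :=
      (differentiableWithinAt_det fun i j =>
        (𝓜.hasEntryDeriv_J (hq t ht htT) i j).differentiableWithinAt).continuousWithinAt
    -- `det J` stays nonzero near `t`, so `V^b = J v` equals `e + V_d^*` on a neighbourhood and may
    -- be differentiated in that form.
    have hderiv := (((he t ht).add hVs).congr_of_eventuallyEq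
      (f₁ := fun s => 𝓜.J (z s).1 *ᵥ
        ((𝓜.J (z s).1)⁻¹ *ᵥ ((z s).2 + Vstar (𝓜.g (z s).1) (gd s) (Vd s))))
      (by
        filter_upwards [hdetc.eventually_ne (hdet t ht htT)] with s hs
        exact hJ _ hs) (hJ _ (hdet t ht htT))).derivWithin hu
    rw [hderiv, control, hJ _ (hdet t ht htT), eV, hJ _ (hdet t ht htT), add_sub_cancel_right]
    obtain ⟨hD, hdd, hf⟩ := hreg t (ht₀.trans ht) _ (hsmall t ht htT)
    have hdyn := (Manipulator.dynamics_iff (e := (z t).2)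
      (v := (𝓜.J (z t).1)⁻¹ *ᵥ ((z t).2 + Vstar (𝓜.g (z t).1) (gd t) (Vd t)))
      (F := -f (𝓜.g (z t).1) (gd t) - Kd *ᵥ (z t).2) (h.nonsingular _ hD)).2 rfl
    have hfield : (regField 𝓜 gd Vd d F' Kd t (z t)).2 =
        (𝓜.J (z t).1 * (𝓜.M (z t).1)⁻¹ * (𝓜.J (z t).1)ᵀ) *ᵥ
          (-f (𝓜.g (z t).1) (gd t) - Kd *ᵥ (z t).2) -
        (𝓜.J (z t).1 * (𝓜.M (z t).1)⁻¹ * 𝓜.C (z t).1 ((𝓜.J (z t).1)⁻¹ *ᵥ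
          ((z t).2 + Vstar (𝓜.g (z t).1) (gd t) (Vd t))) -
          𝓜.Jdot (z t).1 ((𝓜.J (z t).1)⁻¹ *ᵥ
          ((z t).2 + Vstar (𝓜.g (z t).1) (gd t) (Vd t)))) *ᵥ ((𝓜.J (z t).1)⁻¹ *ᵥ (z t).2) := by
      rw [mulVec_mulVec, regField, regCoriolis, hvel t ht htT, clamp_eq (hnorm t ht htT),
        𝓜.Jreg_eq hd hdd, hf, Minvt]
    rw [← hfield] at hdyn
    rw [mulVec_add, mulVec_add]
    ext i
    have := congrFun hdyn i
    simp only [Pi.add_apply, Pi.sub_apply, Pi.neg_apply] at this ⊢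
    linarith

/-- A solution of the regularised field is a motion as long as its error is below `ρ`; the local
decay then bounds the error by `ρ / 2`, so it never reaches `ρ`. -/
theorem exists_motion_of_elasticForce (h : Admissible 𝓜 D gd Vd) (hF : ElasticForce f K F r C L)
    (hKd : Kd.PosDef) :
    ∃ δ > 0, ∀ t₀ : ℝ, 0 ≤ t₀ → ∀ q₀ v₀ : Vec6, err 𝓜 (gd t₀) (Vd t₀) q₀ v₀ < δ →
      ∃ q v : ℝ → Vec6, IsMotion 𝓜 D gd Vd f Kd t₀ ⊤ q v ∧ q t₀ = q₀ ∧ v t₀ = v₀ := by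
  obtain ⟨ρ₁, hρ₁, A, hA, l, hl, hdecay⟩ := exists_local_decay h hF hKd
  obtain ⟨r₁, hr₁, d, hd, hreg⟩ := h.exists_region
  obtain ⟨F', L', hF', hFF'⟩ := hF.exists_extension
  have hA0 : 0 < A := one_pos.trans_le hA
  set ρ := min ρ₁ (min r₁ (min r 1)) with hρ_def
  have hρ : 0 < ρ := lt_min hρ₁ (lt_min hr₁ (lt_min hF.r_pos one_pos))
  have hρρ₁ : ρ ≤ ρ₁ := min_le_left _ _
  have hρr₁ : ρ ≤ r₁ := (min_le_right _ _).trans (min_le_left _ _)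
  have hρr : ρ ≤ r := (min_le_right _ _).trans ((min_le_right _ _).trans (min_le_left _ _))
  have hρ1 : ρ ≤ 1 := (min_le_right _ _).trans ((min_le_right _ _).trans (min_le_right _ _))
  have hregion : ∀ t, 0 ≤ t → ∀ q, (∀ a b, |(gde (𝓜.g q) (gd t) - 1) a b| ≤ ρ) →
      𝓜.g q ∈ D ∧ d ≤ |(𝓜.J q).det| ∧ f (𝓜.g q) (gd t) = F' (gde (𝓜.g q) (gd t)) := by
    intro t ht q hq
    obtain ⟨h1, h2⟩ := hreg t ht q fun a b => (hq a b).trans hρr₁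
    refine ⟨h1, h2, ?_⟩
    rw [hF.eq_gde _ (𝓜.g_mem _) _ (h.gd_mem ht)]
    exact hFF' _ (gde_mem (𝓜.g_mem _) (h.gd_mem ht)) fun a b => (hq a b).trans hρr
  refine ⟨ρ / (2 * A), by positivity, fun t₀ ht₀ q₀ v₀ herr => ?_⟩
  obtain ⟨z, hz0, hz⟩ := exists_global_solution_of_unifLip
    (W := regField 𝓜 gd Vd d F' Kd) (unifLip_regVel h hd) (unifLip_regField_snd h hd hF' Kd) ht₀
    (q₀, eV 𝓜 (gd t₀) (Vd t₀) q₀ v₀)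
  set η : ℝ → ℝ := fun t => frobenius (1 - gde (𝓜.g (z t).1) (gd t)) + euclNorm (z t).2 with hη
  set v : ℝ → Vec6 := fun t =>
    (𝓜.J (z t).1)⁻¹ *ᵥ ((z t).2 + Vstar (𝓜.g (z t).1) (gd t) (Vd t)) with hv
  have hηerr : ∀ t, t₀ ≤ t → η t < ρ → err 𝓜 (gd t) (Vd t) (z t).1 (v t) = η t := by
    intro t ht hηt
    have hsm : ∀ a b, |(gde (𝓜.g (z t).1) (gd t) - 1) a b| ≤ ρ := fun a b => by
      have h1 := abs_le_frobenius (1 - gde (𝓜.g (z t).1) (gd t)) a b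
      rw [Matrix.sub_apply, abs_sub_comm] at h1
      have h2 : 0 ≤ euclNorm (z t).2 := Real.sqrt_nonneg _
      exact h1.trans (by linarith)
    have hdet : IsUnit (𝓜.J (z t).1).det := isUnit_iff_ne_zero.2
      (abs_pos.1 (hd.trans_le (hregion t (ht₀.trans ht) _ hsm).2.1))
    rw [err, eV, hv]
    simp only [mulVec_mulVec, Matrix.mul_nonsing_inv _ hdet, one_mulVec, add_sub_cancel_right]
    rfl
  have hη0 : η t₀ = err 𝓜 (gd t₀) (Vd t₀) q₀ v₀ := by
    simp only [hη, hz0]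
    rfl
  have hAη : A * η t₀ ≤ ρ / 2 := by
    rw [hη0]
    calc A * err 𝓜 (gd t₀) (Vd t₀) q₀ v₀ ≤ A * (ρ / (2 * A)) := by gcongr
      _ = ρ / 2 := by field_simp
  have hη0nn : 0 ≤ η t₀ := hη0 ▸ err_nonneg t₀ q₀ v₀
  have hη0ρ : η t₀ < ρ := by
    have := le_mul_of_one_le_left hη0nn hA
    linarith
  have hηc : ∀ t, t₀ ≤ t → ContinuousWithinAt η (Ici t₀) t := fun t ht =>
    continuousWithinAt_error h ht₀ ht
      ((hasFDerivAt_fst (𝕜 := ℝ) (p := z t)).comp_hasDerivWithinAt t (hz t ht))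
      ((hasFDerivAt_snd (𝕜 := ℝ) (p := z t)).comp_hasDerivWithinAt t
        (hz t ht)).continuousWithinAt
  have hall : ∀ t, t₀ ≤ t → η t < ρ := fun t ht => by
    refine lt_of_trapped (t₀ := t₀) (t₁ := t) hρ
      (fun u hu => (hηc u hu.1).mono fun w hw => hw.1) hη0ρ (fun s _ hlt w hw => ?_) t
      (right_mem_Icc.2 ht)
    -- Only smallness of the error before `s` is used, so the solution is a motion on `[t₀, s)`
    -- before its global behaviour is known. This is where a finite end time is needed.
    have hm : IsMotion 𝓜 D gd Vd f Kd t₀ (s : EReal) (fun t => (z t).1) v :=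
      isMotion_of_regField h hd hρ1 hregion ht₀ hz
        fun u hu hus => hlt u ⟨hu, EReal.coe_lt_coe_iff.1 hus⟩
    have h1 := hdecay t₀ ht₀ s _ v hm s (fun u hu => ⟨EReal.coe_lt_coe_iff.2 hu.2, by
      rw [hηerr u hu.1 (hlt u hu)]
      exact (hlt u hu).trans_le hρρ₁⟩) w hw
    rw [hηerr w hw.1 (hlt w hw), hηerr t₀ le_rfl hη0ρ] at h1
    refine h1.trans (le_trans ?_ hAη)
    refine mul_le_of_le_one_right (mul_nonneg hA0.le hη0nn) ?_
    rw [Real.exp_le_one_iff]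
    have : 0 ≤ l * (w - t₀) := mul_nonneg hl.le (by linarith [hw.1])
    linarith
  refine ⟨fun t => (z t).1, v,
    isMotion_of_regField h hd hρ1 hregion ht₀ hz fun t ht _ => hall t ht, by simp [hz0], ?_⟩
  have hsm : ∀ a b, |(gde (𝓜.g q₀) (gd t₀) - 1) a b| ≤ ρ := fun a b =>
    (abs_gde_sub_one_le_err (Vd := Vd) t₀ q₀ v₀ a b).trans (hη0 ▸ hη0ρ.le)
  have hdet : IsUnit (𝓜.J q₀).det := isUnit_iff_ne_zero.2
    (abs_pos.1 (hd.trans_le (hregion t₀ ht₀ _ hsm).2.1))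
  simp only [hv, hz0, eV, sub_add_cancel, mulVec_mulVec, Matrix.nonsing_inv_mul _ hdet, one_mulVec]

/-- Elastic forces with positive definite stiffness give asymptotic stability. -/
theorem asymptoticallyStable_of_elasticForce (h : Admissible 𝓜 D gd Vd)
    (hF : ElasticForce f K F r C L) (hKd : Kd.PosDef) : AsymptoticallyStable 𝓜 D gd Vd f Kd := by
  obtain ⟨δ, hδ, A, hA, l, hl, hdecay⟩ := exists_decay h hF hKd
  have hA0 : 0 < A := one_pos.trans_le hA
  refine ⟨exists_motion_of_elasticForce h hF hKd, fun ε hε => ?_, δ, hδ, fun ε hε => ?_⟩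
  · refine ⟨min δ (ε / A), lt_min hδ (by positivity), fun t₀ ht₀ T q v hm herr t ht htT => ?_⟩
    have h1 := hdecay t₀ ht₀ T q v hm (herr.trans_le (min_le_left _ _)) t ht htT
    have h2 : A * err 𝓜 (gd t₀) (Vd t₀) (q t₀) (v t₀) < ε := by
      have := herr.trans_le (min_le_right _ _)
      rw [lt_div_iff₀ hA0] at this
      linarith
    refine h1.trans_lt (lt_of_le_of_lt ?_ h2)
    refine mul_le_of_le_one_right (mul_nonneg hA0.le (err_nonneg _ _ _)) ?_
    rw [Real.exp_le_one_iff]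
    have : 0 ≤ l * (t - t₀) := mul_nonneg hl.le (by linarith)
    linarith
  -- Solves `A δ exp(-l τ) = ε`; the maximum covers `ε ≥ A δ`.
  · refine ⟨max 0 (-Real.log (ε / (A * δ)) / l), le_max_left _ _,
      fun t₀ ht₀ T q v hm herr t ht htT => ?_⟩
    have ht₀t : t₀ ≤ t := by linarith [le_max_left 0 (-Real.log (ε / (A * δ)) / l)]
    have h1 := hdecay t₀ ht₀ T q v hm herr t ht₀t htT
    have h2 : Real.exp (-l * (t - t₀)) ≤ ε / (A * δ) := by
      rw [← Real.le_log_iff_exp_le (by positivity)]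
      have h3 : -Real.log (ε / (A * δ)) / l ≤ t - t₀ := by
        linarith [le_max_right 0 (-Real.log (ε / (A * δ)) / l)]
      rw [div_le_iff₀ hl] at h3
      linarith
    calc err 𝓜 (gd t) (Vd t) (q t) (v t)
        ≤ A * err 𝓜 (gd t₀) (Vd t₀) (q t₀) (v t₀) * Real.exp (-l * (t - t₀)) := h1
      _ < A * δ * Real.exp (-l * (t - t₀)) := by gcongr
      _ ≤ A * δ * (ε / (A * δ)) := by gcongr
      _ = ε := by field_simp

end

/-! ### Lipschitz and small functions near the identity -/

/-- The rigid motions with entries `r`-close to those of the identity. -/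
def nearOne (r : ℝ) : Set Mat4 := {X | X ∈ SE3 ∧ ∀ a b, |(X - 1) a b| ≤ r}

/-- `f` is bounded, and Lipschitz with respect to the largest entry, on `S`. -/
def BddLip (S : Set Mat4) (f : Mat4 → ℝ) : Prop :=
  ∃ c : ℝ, 0 ≤ c ∧ (∀ X ∈ S, |f X| ≤ c) ∧
    ∀ X ∈ S, ∀ Y ∈ S, ∀ δ, (∀ a b, |X a b - Y a b| ≤ δ) → |f X - f Y| ≤ c * δ

theorem nonneg_of_entries {X Y : Mat4} {δ : ℝ} (h : ∀ a b, |X a b - Y a b| ≤ δ) : 0 ≤ δ :=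
  (abs_nonneg _).trans (h (Sum.inr ()) (Sum.inr ()))

namespace BddLip

variable {S : Set Mat4} {f g d : Mat4 → ℝ}

theorem of_bounds {b c : ℝ} (hb0 : 0 ≤ b) (hb : ∀ X ∈ S, |f X| ≤ b)
    (hl : ∀ X ∈ S, ∀ Y ∈ S, ∀ δ, (∀ a b, |X a b - Y a b| ≤ δ) → |f X - f Y| ≤ c * δ) :
    BddLip S f :=
  ⟨max b c, hb0.trans (le_max_left _ _), fun X hX => (hb X hX).trans (le_max_left _ _),
    fun X hX Y hY δ h => (hl X hX Y hY δ h).trans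
      (mul_le_mul_of_nonneg_right (le_max_right _ _) (nonneg_of_entries h))⟩

theorem congr (hf : BddLip S f) (h : ∀ X ∈ S, g X = f X) : BddLip S g := by
  obtain ⟨c, hc, hb, hl⟩ := hf
  refine ⟨c, hc, fun X hX => by rw [h X hX]; exact hb X hX, fun X hX Y hY => ?_⟩
  rw [h X hX, h Y hY]
  exact hl X hX Y hY

theorem const (a : ℝ) : BddLip S fun _ => a :=
  of_bounds (c := 0) (abs_nonneg a) (fun _ _ => le_rfl) fun _ _ _ _ _ _ => by simp

theorem add (hf : BddLip S f) (hg : BddLip S g) : BddLip S fun X => f X + g X := by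
  obtain ⟨c, hc, hb, hl⟩ := hf
  obtain ⟨c', hc', hb', hl'⟩ := hg
  refine ⟨c + c', by positivity,
    fun X hX => (abs_add_le _ _).trans (add_le_add (hb X hX) (hb' X hX)), fun X hX Y hY δ h => ?_⟩
  rw [add_sub_add_comm, add_mul]
  exact (abs_add_le _ _).trans (add_le_add (hl X hX Y hY δ h) (hl' X hX Y hY δ h))

theorem neg (hf : BddLip S f) : BddLip S fun X => -f X := by
  obtain ⟨c, hc, hb, hl⟩ := hf
  refine ⟨c, hc, fun X hX => by rw [abs_neg]; exact hb X hX, fun X hX Y hY δ h => ?_⟩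
  rw [neg_sub_neg, abs_sub_comm]
  exact hl X hX Y hY δ h

theorem sub (hf : BddLip S f) (hg : BddLip S g) : BddLip S fun X => f X - g X := by
  simpa [sub_eq_add_neg] using hf.add hg.neg

theorem mul (hf : BddLip S f) (hg : BddLip S g) : BddLip S fun X => f X * g X := by
  obtain ⟨c, hc, hb, hl⟩ := hf
  obtain ⟨c', hc', hb', hl'⟩ := hg
  refine of_bounds (b := c * c') (c := c * c' + c * c') (by positivity)
    (fun X hX => ?_) fun X hX Y hY δ h => ?_
  · rw [abs_mul]
    exact mul_le_mul (hb X hX) (hb' X hX) (abs_nonneg _) hc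
  · have hδ := nonneg_of_entries h
    calc |f X * g X - f Y * g Y| = |f X * (g X - g Y) + (f X - f Y) * g Y| := by ring_nf
      _ ≤ |f X| * |g X - g Y| + |f X - f Y| * |g Y| := by
          rw [← abs_mul, ← abs_mul]; exact abs_add_le _ _
      _ ≤ c * (c' * δ) + c * δ * c' :=
          add_le_add (mul_le_mul (hb X hX) (hl' X hX Y hY δ h) (abs_nonneg _) hc)
            (mul_le_mul (hl X hX Y hY δ h) (hb' Y hY) (abs_nonneg _) (by positivity))
      _ = (c * c' + c * c') * δ := by ring

theorem sum {ι : Type} {F : ι → Mat4 → ℝ} (s : Finset ι) (hF : ∀ i ∈ s, BddLip S (F i)) :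
    BddLip S fun X => ∑ i ∈ s, F i X := by
  classical
  induction s using Finset.induction_on with
  | empty => simpa using const 0
  | insert a s ha ih =>
    simp only [Finset.sum_insert ha]
    exact (hF a (by simp)).add (ih fun i hi => hF i (by simp [hi]))

theorem entry (r : ℝ) (a b) : BddLip (nearOne r) fun X => X a b := by
  refine of_bounds (b := |r| + 1) (c := 1) (by positivity) (fun X hX => ?_)
    fun X _ Y _ δ h => by rw [one_mul]; exact h a b
  have h1 := abs_le.1 ((hX.2 a b).trans (le_abs_self r))
  rw [Matrix.sub_apply, Matrix.one_apply] at h1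
  split_ifs at h1
  · exact abs_le.2 ⟨by linarith, by linarith⟩
  · exact abs_le.2 ⟨by linarith, by linarith⟩

/-- Composition with a function that is Lipschitz on the range. -/
theorem comp {T : Set ℝ} {u : ℝ → ℝ} {B L : ℝ} (hB : 0 ≤ B) (hL : 0 ≤ L)
    (hu : ∀ x ∈ T, |u x| ≤ B) (hu' : ∀ x ∈ T, ∀ y ∈ T, |u x - u y| ≤ L * |x - y|)
    (hf : BddLip S f) (hT : ∀ X ∈ S, f X ∈ T) : BddLip S fun X => u (f X) := by
  obtain ⟨c, hc, hb, hl⟩ := hf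
  refine of_bounds (b := B) (c := L * c) hB (fun X hX => hu _ (hT X hX)) fun X hX Y hY δ h => ?_
  rw [mul_assoc]
  exact (hu' _ (hT X hX) _ (hT Y hY)).trans (mul_le_mul_of_nonneg_left (hl X hX Y hY δ h) hL)

/-- Dividing at the smaller denominator `d₁` costs nothing because `p₁` is at most `c d₁`; the ratio
`n₂ / d₂` is at most `c` as well. Zero denominators fit, since then `p₁ = 0`. -/
theorem div_mul_aux {c l n₁ n₂ p₁ p₂ d₁ d₂ : ℝ} (hc : 0 ≤ c) (hd : 0 ≤ d₁) (hd' : d₁ ≤ d₂)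
    (hn : |n₂| ≤ c * d₂) (hp : |p₁| ≤ c * d₁)
    (h1 : |n₁ - n₂| ≤ l) (h2 : |p₁ - p₂| ≤ l) (h3 : |d₁ - d₂| ≤ l) :
    |n₁ / d₁ * p₁ - n₂ / d₂ * p₂| ≤ (2 * c + c * c) * l := by
  have hl : 0 ≤ l := (abs_nonneg _).trans h1
  have hq : |n₂ / d₂| ≤ c := by
    rcases (hd.trans hd').eq_or_lt with h0 | h0
    · rw [← h0]; simpa using hc
    · rw [abs_div, abs_of_pos h0, div_le_iff₀ h0]; exact hn
  have hA : |n₂ / d₂ * (p₁ - p₂)| ≤ c * l := by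
    rw [abs_mul]; exact mul_le_mul hq h2 (abs_nonneg _) hc
  rcases hd.eq_or_lt with h0 | h0
  · have hp0 : p₁ = 0 := abs_nonpos_iff.1 (by simpa [← h0] using hp)
    have : n₁ / d₁ * p₁ - n₂ / d₂ * p₂ = n₂ / d₂ * (p₁ - p₂) := by rw [hp0]; ring
    rw [this]
    nlinarith [mul_nonneg hc hl, mul_nonneg (mul_nonneg hc hc) hl]
  · have h0' := h0.trans_le hd'
    have hkey : n₁ / d₁ * p₁ - n₂ / d₂ * p₂ =
        n₂ / d₂ * (p₁ - p₂) + p₁ / d₁ * ((n₁ - n₂) + n₂ / d₂ * (d₂ - d₁)) := by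
      field_simp
      ring
    have hpd : |p₁ / d₁| ≤ c := by rw [abs_div, abs_of_pos h0, div_le_iff₀ h0]; exact hp
    have hB : |(n₁ - n₂) + n₂ / d₂ * (d₂ - d₁)| ≤ l + c * l := by
      refine (abs_add_le _ _).trans (add_le_add h1 ?_)
      rw [abs_mul, abs_sub_comm]
      exact mul_le_mul hq h3 (abs_nonneg _) hc
    rw [hkey]
    refine (abs_add_le _ _).trans ?_
    rw [abs_mul (p₁ / d₁)]
    have := mul_le_mul hpd hB (abs_nonneg _) hc
    linarith

/-- A quotient multiplied by a function that vanishes with the denominator. -/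
theorem div_mul (hf : BddLip S f) (hg : BddLip S g) (hd : BddLip S d) (hd0 : ∀ X ∈ S, 0 ≤ d X)
    {c : ℝ} (hc : 0 ≤ c) (hfd : ∀ X ∈ S, |f X| ≤ c * d X) (hgd : ∀ X ∈ S, |g X| ≤ c * d X) :
    BddLip S fun X => f X / d X * g X := by
  obtain ⟨c₁, hc₁, -, hl₁⟩ := hf
  obtain ⟨c₂, hc₂, hb₂, hl₂⟩ := hg
  obtain ⟨c₃, hc₃, -, hl₃⟩ := hd
  refine of_bounds (b := c * c₂) (c := (2 * c + c * c) * (c₁ + c₂ + c₃)) (by positivity)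
    (fun X hX => ?_) fun X hX Y hY δ h => ?_
  · rw [abs_mul]
    refine mul_le_mul ?_ (hb₂ X hX) (abs_nonneg _) hc
    rcases (hd0 X hX).eq_or_lt with h0 | h0
    · rw [← h0]; simpa using hc
    · rw [abs_div, abs_of_pos h0, div_le_iff₀ h0]; exact hfd X hX
  · have hδ := nonneg_of_entries h
    have h1 : |f X - f Y| ≤ (c₁ + c₂ + c₃) * δ := (hl₁ X hX Y hY δ h).trans
      (mul_le_mul_of_nonneg_right (by linarith) hδ)
    have h2 : |g X - g Y| ≤ (c₁ + c₂ + c₃) * δ := (hl₂ X hX Y hY δ h).trans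
      (mul_le_mul_of_nonneg_right (by linarith) hδ)
    have h3 : |d X - d Y| ≤ (c₁ + c₂ + c₃) * δ := (hl₃ X hX Y hY δ h).trans
      (mul_le_mul_of_nonneg_right (by linarith) hδ)
    rw [mul_assoc]
    rcases le_total (d X) (d Y) with hle | hle
    · exact div_mul_aux hc (hd0 X hX) hle (hfd Y hY) (hgd X hX) h1 h2 h3
    · rw [abs_sub_comm] at h1 h2 h3 ⊢
      exact div_mul_aux hc (hd0 Y hY) hle (hfd X hX) (hgd Y hY) h1 h2 h3

theorem mulVec {m n : Type} [Fintype n] {A : Mat4 → Matrix m n ℝ} {y : Mat4 → n → ℝ}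
    (hA : ∀ i j, BddLip S fun X => A X i j) (hy : ∀ j, BddLip S fun X => y X j) (i) :
    BddLip S fun X => (A X *ᵥ y X) i := by
  simp only [Matrix.mulVec, dotProduct]
  exact sum _ fun k _ => (hA i k).mul (hy k)

theorem matrix_mul {l m n : Type} [Fintype m] {A : Mat4 → Matrix l m ℝ} {B : Mat4 → Matrix m n ℝ}
    (hA : ∀ i j, BddLip S fun X => A X i j) (hB : ∀ i j, BddLip S fun X => B X i j) (i j) :
    BddLip S fun X => (A X * B X) i j := by
  simp only [Matrix.mul_apply]
  exact sum _ fun k _ => (hA i k).mul (hB k j)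

theorem unskew {A : Mat4 → Mat3} (hA : ∀ i j, BddLip S fun X => A X i j) (i) :
    BddLip S fun X => GIC.unskew (A X) i := by
  fin_cases i
  exacts [hA 2 1, hA 0 2, hA 1 0]

theorem exists_uniform {n : Type} [Fintype n] {F : Mat4 → n → ℝ}
    (hF : ∀ i, BddLip S fun X => F X i) :
    ∃ L, ∀ X ∈ S, ∀ Y ∈ S, ∀ δ, (∀ a b, |X a b - Y a b| ≤ δ) → ∀ i, |F X i - F Y i| ≤ L * δ := by
  choose c hc _ hl using hF
  refine ⟨∑ i, c i, fun X hX Y hY δ h i => (hl i X hX Y hY δ h).trans ?_⟩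
  exact mul_le_mul_of_nonneg_right
    (Finset.single_le_sum (fun j _ => hc j) (Finset.mem_univ i)) (nonneg_of_entries h)

end BddLip

/-- `f` is of order `k` in the distance to the identity on `S`. -/
def SmallOn (S : Set Mat4) (k : ℕ) (f : Mat4 → ℝ) : Prop :=
  ∃ c : ℝ, 0 ≤ c ∧ ∀ X ∈ S, |f X| ≤ c * ‖ell X‖ ^ k

namespace SmallOn

variable {S : Set Mat4} {f g : Mat4 → ℝ} {k l : ℕ}

theorem congr (hf : SmallOn S k f) (h : ∀ X ∈ S, g X = f X) : SmallOn S k g := by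
  obtain ⟨c, hc, hb⟩ := hf
  exact ⟨c, hc, fun X hX => by rw [h X hX]; exact hb X hX⟩

theorem zero : SmallOn S k fun _ => 0 := ⟨0, le_rfl, fun X _ => by simp⟩

theorem add (hf : SmallOn S k f) (hg : SmallOn S k g) : SmallOn S k fun X => f X + g X := by
  obtain ⟨c, hc, hb⟩ := hf
  obtain ⟨c', hc', hb'⟩ := hg
  refine ⟨c + c', by positivity, fun X hX => ?_⟩
  rw [add_mul]
  exact (abs_add_le _ _).trans (add_le_add (hb X hX) (hb' X hX))

theorem neg (hf : SmallOn S k f) : SmallOn S k fun X => -f X := by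
  obtain ⟨c, hc, hb⟩ := hf
  exact ⟨c, hc, fun X hX => by rw [abs_neg]; exact hb X hX⟩

theorem sub (hf : SmallOn S k f) (hg : SmallOn S k g) : SmallOn S k fun X => f X - g X := by
  simpa [sub_eq_add_neg] using hf.add hg.neg

theorem mul (hf : SmallOn S k f) (hg : SmallOn S l g) : SmallOn S (k + l) fun X => f X * g X := by
  obtain ⟨c, hc, hb⟩ := hf
  obtain ⟨c', hc', hb'⟩ := hg
  refine ⟨c * c', by positivity, fun X hX => ?_⟩
  rw [abs_mul, pow_add, mul_mul_mul_comm]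
  exact mul_le_mul (hb X hX) (hb' X hX) (abs_nonneg _) (by positivity)

theorem of_abs_le {c : ℝ} (hc : 0 ≤ c) (h : ∀ X ∈ S, |f X| ≤ c) : SmallOn S 0 f :=
  ⟨c, hc, fun X hX => by simpa using h X hX⟩

theorem bdd_mul {c : ℝ} (hc : 0 ≤ c) (hf : ∀ X ∈ S, |f X| ≤ c) (hg : SmallOn S k g) :
    SmallOn S k fun X => f X * g X := by
  simpa using (of_abs_le hc hf).mul hg

theorem const_mul (a : ℝ) (hg : SmallOn S k g) : SmallOn S k fun X => a * g X :=
  bdd_mul (abs_nonneg a) (fun _ _ => le_rfl) hg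

theorem sum {ι : Type} {F : ι → Mat4 → ℝ} (s : Finset ι) (hF : ∀ i ∈ s, SmallOn S k (F i)) :
    SmallOn S k fun X => ∑ i ∈ s, F i X := by
  classical
  induction s using Finset.induction_on with
  | empty => simpa using zero
  | insert a s ha ih =>
    simp only [Finset.sum_insert ha]
    exact (hF a (by simp)).add (ih fun i hi => hF i (by simp [hi]))

theorem ell (i) : SmallOn S 1 fun X => GIC.ell X i :=
  ⟨1, zero_le_one, fun X _ => by simpa using norm_le_pi_norm (GIC.ell X) i⟩

theorem sub_one {r : ℝ} (hr : r ≤ 1 / 3) (a b) : SmallOn (nearOne r) 1 fun X => (X - 1) a b :=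
  ⟨2, zero_le_two, fun X hX => by simpa using abs_sub_one_le hX.1 hr hX.2 a b⟩

theorem rot_sub_one {r : ℝ} (hr : r ≤ 1 / 3) (i j) :
    SmallOn (nearOne r) 1 fun X => (rot X - 1) i j :=
  (sub_one hr (Sum.inl i) (Sum.inl j)).congr fun X _ => by
    simp [rot, Matrix.toBlocks₁₁, Matrix.one_apply]

theorem rot_sub_one_add_transpose {r : ℝ} (hr : r ≤ 1 / 3) (i j) :
    SmallOn (nearOne r) 2 fun X => (rot X - 1) i j + (rot X - 1) j i := by
  refine (sum Finset.univ fun k _ =>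
    (rot_sub_one hr k i).mul (rot_sub_one hr k j)).neg.congr fun X hX => ?_
  have h := congrFun (congrFun (GIC.rot_sub_one_add_transpose hX.1) i) j
  simpa only [Matrix.add_apply, Matrix.transpose_apply, Matrix.neg_apply, Matrix.mul_apply]
    using h

theorem exists_norm_le {n : Type} [Fintype n] {F : Mat4 → n → ℝ}
    (hF : ∀ i, SmallOn S k fun X => F X i) :
    ∃ c : ℝ, 0 ≤ c ∧ ∀ X ∈ S, ‖F X‖ ≤ c * ‖GIC.ell X‖ ^ k := by
  choose c hc hb using hF
  have h0 : 0 ≤ ∑ i, c i := Finset.sum_nonneg fun i _ => hc i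
  refine ⟨∑ i, c i, h0, fun X hX => (pi_norm_le_iff_of_nonneg (by positivity)).2 fun i => ?_⟩
  exact (hb i X hX).trans (mul_le_mul_of_nonneg_right
    (Finset.single_le_sum (fun j _ => hc j) (Finset.mem_univ i)) (by positivity))

end SmallOn

/-! ### Elastic forces from estimates near the identity -/

theorem ElasticForce.of_nearOne {f : Mat4 → Mat4 → Vec6} {K : Mat6} {F : Mat4 → Vec6} {r : ℝ}
    (hK : K.PosDef) (hr : 0 < r) (heq : ∀ g ∈ SE3, ∀ gd ∈ SE3, f g gd = F (gde g gd))
    (happrox : ∀ i, SmallOn (nearOne r) 2 fun X => (F X - K *ᵥ ell X) i)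
    (hlip : ∀ i, BddLip (nearOne r) fun X => F X i) : ∃ C L, ElasticForce f K F r C L := by
  obtain ⟨C, hC, hC'⟩ := SmallOn.exists_norm_le happrox
  obtain ⟨L, hL⟩ := BddLip.exists_uniform hlip
  exact ⟨C, L, hK, hr, hC, heq, fun h hh hh' => hC' h ⟨hh, hh'⟩,
    fun X hX Y hY hX' hY' => hL X ⟨hX, hX'⟩ Y ⟨hY, hY'⟩⟩

/-! ### The elastic force of GIC-1 -/

/-- The stiffness of GIC-1 at the desired configuration. -/
def stiffness1 (Kp KR : Mat3) : Mat6 := fromBlocks Kp 0 0 (KR.trace • 1 - KR)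

/-- The quadratic form equals `tr(x̂ᵀ K x̂)`, a sum of values of `K` on the columns of `x̂`, which
do not all vanish. -/
theorem posDef_trace_sub {K : Mat3} (hK : K.PosDef) : (K.trace • (1 : Mat3) - K).PosDef := by
  have hsym : Kᵀ = K := by simpa using hK.1.eq
  refine Matrix.PosDef.of_dotProduct_mulVec_pos ?_ fun x hx => ?_
  · rw [Matrix.IsHermitian, conjTranspose_eq_transpose_of_trivial, transpose_sub, transpose_smul,
      transpose_one, hsym]
  · have hkey : star x ⬝ᵥ (K.trace • (1 : Mat3) - K) *ᵥ x =
        ∑ i, (skew x).col i ⬝ᵥ K *ᵥ (skew x).col i := by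
      have h (i j) : K i j = K j i := congrFun (congrFun hsym.symm i) j
      simp only [star_trivial, dotProduct, Matrix.mulVec, Fin.sum_univ_three, Matrix.trace, skew,
        Matrix.diag_apply, Matrix.sub_apply, Matrix.smul_apply, Matrix.one_apply, Matrix.col_apply]
      simp [h 1 0, h 2 0, h 2 1]
      ring
    have hnn (y : Fin 3 → ℝ) : 0 ≤ y ⬝ᵥ K *ᵥ y := by
      simpa using hK.posSemidef.dotProduct_mulVec_nonneg y
    have hpos {y : Fin 3 → ℝ} (hy : y ≠ 0) : 0 < y ⬝ᵥ K *ᵥ y := by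
      simpa using hK.dotProduct_mulVec_pos hy
    obtain ⟨i, hi⟩ := Function.ne_iff.1 hx
    obtain ⟨j, hj⟩ : ∃ j, (skew x).col j ≠ 0 := by
      by_contra! hall
      have h0 (a b) : skew x a b = 0 := congrFun (hall b) a
      have h1 := h0 2 1
      have h2 := h0 0 2
      have h3 := h0 1 0
      simp only [skew, Matrix.of_apply, Matrix.cons_val] at h1 h2 h3
      fin_cases i
      exacts [hi h1, hi h2, hi h3]
    rw [hkey]
    exact Finset.sum_pos' (fun i _ => hnn _) ⟨j, Finset.mem_univ j, hpos hj⟩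

theorem posDef_stiffness1 {Kp KR : Mat3} (hKp : Kp.PosDef) (hKR : KR.PosDef) :
    (stiffness1 Kp KR).PosDef := by
  have hW := posDef_trace_sub hKR
  refine Matrix.PosDef.of_dotProduct_mulVec_pos ?_ fun x hx => ?_
  · exact Matrix.IsHermitian.fromBlocks hKp.1 (by simp) hW.1
  · have hx' : x = Sum.elim (x ∘ Sum.inl) (x ∘ Sum.inr) := (Sum.elim_comp_inl_inr x).symm
    rw [star_trivial, hx', stiffness1, Matrix.fromBlocks_mulVec, sumElim_dotProduct_sumElim]
    simp only [Sum.elim_comp_inl, Sum.elim_comp_inr, Matrix.zero_mulVec, add_zero, zero_add]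
    have h1 := hKp.posSemidef.dotProduct_mulVec_nonneg (x ∘ Sum.inl)
    have h2 := hW.posSemidef.dotProduct_mulVec_nonneg (x ∘ Sum.inr)
    rw [star_trivial] at h1 h2
    by_cases h0 : x ∘ Sum.inl = 0
    · have h3 : x ∘ Sum.inr ≠ 0 := fun h3 => hx (by rw [hx', h0, h3]; ext (i | i) <;> rfl)
      have h4 := hW.dotProduct_mulVec_pos h3
      rw [star_trivial] at h4
      linarith
    · have h4 := hKp.dotProduct_mulVec_pos h0
      rw [star_trivial] at h4
      linarith

/-- The elastic force of GIC-1 as a function of the configuration error. -/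
def elastic1 (Kp KR : Mat3) (h : Mat4) : Vec6 :=
  Sum.elim ((rot h)ᵀ *ᵥ Kp *ᵥ pos h) (unskew (KR * rot h - (rot h)ᵀ * KR))

theorem force1_eq (Kp KR : Mat3) {g gd : Mat4} (hg : g ∈ SE3) (hgd : gd ∈ SE3) :
    force1 Kp KR g gd = elastic1 Kp KR (gde g gd) := by
  rw [force1, elastic1, rot_gde hg hgd, pos_gde hg hgd]
  simp only [transpose_mul, transpose_transpose, Matrix.mulVec_mulVec, Matrix.mul_assoc]

/-- The remainder is `(R - 1)ᵀ K_p p`, a product of two small factors. -/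
theorem elastic1_sub_inl (Kp KR : Mat3) (X : Mat4) (i : Fin 3) :
    (elastic1 Kp KR X - stiffness1 Kp KR *ᵥ ell X) (Sum.inl i) =
      ∑ k, (rot X - 1) k i * ∑ j, Kp k j * ell X (Sum.inl j) := by
  have h1 : (stiffness1 Kp KR *ᵥ ell X) (Sum.inl i) = (Kp *ᵥ pos X) i := by
    rw [stiffness1, ell, Matrix.fromBlocks_mulVec]
    simp
  have h2 : (elastic1 Kp KR X) (Sum.inl i) = ((rot X)ᵀ *ᵥ Kp *ᵥ pos X) i := rfl
  have h3 : ∑ k, (rot X - 1) k i * ∑ j, Kp k j * ell X (Sum.inl j) =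
      ((rot X - 1)ᵀ *ᵥ Kp *ᵥ pos X) i := rfl
  rw [Pi.sub_apply, h1, h2, h3, transpose_sub, Matrix.sub_mulVec, transpose_one, Matrix.one_mulVec,
    Pi.sub_apply]

/-- Split `R - 1` into its skew part `S` and symmetric part `Y`. Then `K_R R - Rᵀ K_R = (K_R S + S
K_R) + (K_R Y - Y K_R)`; the first bracket is the stiffness term, since `(K_R ŝ + ŝ K_R)^∨ = (tr K_R
I - K_R) s`, and the second is quadratically small with `Y`. -/
theorem elastic1_sub_inr {Kp KR : Mat3} (hKR : KRᵀ = KR) (X : Mat4) (i : Fin 3) :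
    (elastic1 Kp KR X - stiffness1 Kp KR *ᵥ ell X) (Sum.inr i) =
      unskew (Matrix.of fun a b => ∑ k, ((KR a k / 2) * ((rot X - 1) k b + (rot X - 1) b k) -
        (KR k b / 2) * ((rot X - 1) a k + (rot X - 1) k a))) i := by
  have h1 : (stiffness1 Kp KR *ᵥ ell X) (Sum.inr i) =
      ((KR.trace • (1 : Mat3) - KR) *ᵥ unskew ((1 / 2 : ℝ) • (rot X - (rot X)ᵀ))) i := by
    rw [stiffness1, ell, Matrix.fromBlocks_mulVec]
    simp
  have h2 : (elastic1 Kp KR X) (Sum.inr i) = unskew (KR * rot X - (rot X)ᵀ * KR) i := rfl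
  have h (i j) : KR i j = KR j i := congrFun (congrFun hKR.symm i) j
  rw [Pi.sub_apply, h1, h2]
  generalize rot X = R
  fin_cases i <;>
  · simp only [unskew, Matrix.mulVec, dotProduct, Fin.sum_univ_three, Matrix.trace,
      Matrix.diag_apply, Matrix.sub_apply, Matrix.smul_apply, Matrix.one_apply, Matrix.mul_apply,
      Matrix.transpose_apply, Matrix.of_apply, smul_eq_mul]
    simp [h 1 0, h 2 0, h 2 1]
    ring

theorem exists_elasticForce_force1 {Kp KR : Mat3} (hKp : Kp.PosDef) (hKR : KR.PosDef) :
    ∃ K F r C L, ElasticForce (force1 Kp KR) K F r C L := by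
  refine ⟨stiffness1 Kp KR, elastic1 Kp KR, 1 / 3, ElasticForce.of_nearOne
    (posDef_stiffness1 hKp hKR) (by norm_num) (fun g hg gd hgd => force1_eq Kp KR hg hgd) ?_ ?_⟩
  · have hE := SmallOn.rot_sub_one (r := 1 / 3) le_rfl
    have hY := SmallOn.rot_sub_one_add_transpose (r := 1 / 3) le_rfl
    rintro (i | i)
    · simp only [elastic1_sub_inl]
      exact SmallOn.sum _ fun k _ => (hE k i).mul (SmallOn.sum _ fun j _ =>
        (SmallOn.ell (Sum.inl j)).const_mul _)
    · simp only [elastic1_sub_inr (show KRᵀ = KR by simpa using hKR.1.eq)]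
      have h (a b : Fin 3) : SmallOn (nearOne (1 / 3)) 2 fun X =>
          ∑ k, ((KR a k / 2) * ((rot X - 1) k b + (rot X - 1) b k) -
            (KR k b / 2) * ((rot X - 1) a k + (rot X - 1) k a)) :=
        SmallOn.sum _ fun k _ => ((hY k b).const_mul _).sub ((hY a k).const_mul _)
      fin_cases i
      exacts [h 2 1, h 0 2, h 1 0]
  · have hR (i j) : BddLip (nearOne (1 / 3)) fun X => rot X i j := BddLip.entry _ _ _
    rintro (i | i)
    · exact BddLip.mulVec (A := fun X => (rot X)ᵀ) (y := fun X => Kp *ᵥ pos X) (fun a b => hR b a)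
        (BddLip.mulVec (A := fun _ => Kp) (fun _ _ => BddLip.const _) fun j => BddLip.entry _ _ _) i
    · exact BddLip.unskew (A := fun X => KR * rot X - (rot X)ᵀ * KR) (fun a b =>
        (BddLip.matrix_mul (A := fun _ => KR) (fun _ _ => BddLip.const _) hR a b).sub
        (BddLip.matrix_mul (A := fun X => (rot X)ᵀ) (B := fun _ => KR) (fun a b => hR b a)
          (fun _ _ => BddLip.const _) a b)) i

/-! ### The function `φ / sin φ` -/

theorem three_quarters_mul_le_sin {x : ℝ} (h0 : 0 < x) (h1 : x < 1) : 3 / 4 * x ≤ Real.sin x := by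
  have h := Real.sin_gt_sub_cube h0
  nlinarith [mul_pos h0 h0, mul_pos (mul_pos h0 h0) (sub_pos.2 h1), mul_pos h0 (sub_pos.2 h1)]

theorem sinc_pos {x : ℝ} (h0 : 0 ≤ x) (h1 : x ≤ 1) : 0 < Real.sinc x := by
  rcases h0.eq_or_lt with h | h
  · rw [← h]; simp
  · rw [Real.sinc_of_ne_zero h.ne']
    exact div_pos (Real.sin_pos_of_pos_of_lt_pi h (by linarith [Real.pi_gt_three])) h

theorem sinc_inv_le_two {x : ℝ} (h0 : 0 ≤ x) (h1 : x ≤ 1) : (Real.sinc x)⁻¹ ≤ 2 := by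
  have hpos := sinc_pos h0 h1
  refine inv_le_of_inv_le₀ (by norm_num) ?_
  rcases h0.eq_or_lt with h | h
  · rw [← h]; norm_num
  · rw [Real.sinc_of_ne_zero h.ne', le_div_iff₀ h]
    have := Real.sin_gt_sub_cube h
    nlinarith [mul_pos h h, mul_nonneg (mul_pos h h).le (sub_nonneg.2 h1),
      mul_nonneg h0 (sub_nonneg.2 h1)]

theorem hasDerivAt_sinc_inv {x : ℝ} (h0 : 0 < x) (h1 : x < 1) :
    HasDerivAt (fun y => (Real.sinc y)⁻¹)
      ((Real.sin x - x * Real.cos x) / Real.sin x ^ 2) x := by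
  have hs : Real.sin x ≠ 0 := by
    have := three_quarters_mul_le_sin h0 h1
    exact (lt_of_lt_of_le (by positivity) this).ne'
  have h := (hasDerivAt_id x).div (Real.hasDerivAt_sin x) hs
  simp only [id, one_mul] at h
  refine h.congr_of_eventuallyEq ?_
  filter_upwards [eventually_ne_nhds h0.ne'] with y hy
  rw [Real.sinc_of_ne_zero hy, inv_div]
  rfl

theorem continuousOn_sinc_inv : ContinuousOn (fun y => (Real.sinc y)⁻¹) (Icc 0 1) :=
  Real.continuous_sinc.continuousOn.inv₀ fun _ hx => (sinc_pos hx.1 hx.2).ne'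

/-- `φ / sin φ` is a Lipschitz function of `cos φ` near `φ = 0`. -/
theorem abs_sinc_inv_sub_le {x y : ℝ} (hx : x ∈ Icc (0 : ℝ) 1) (hy : y ∈ Icc (0 : ℝ) 1) :
    |(Real.sinc x)⁻¹ - (Real.sinc y)⁻¹| ≤ 2 * |Real.cos x - Real.cos y| := by
  have hmono : MonotoneOn (fun y => (Real.sinc y)⁻¹) (Icc 0 1) := by
    refine monotoneOn_of_deriv_nonneg (convex_Icc 0 1) continuousOn_sinc_inv ?_ ?_
    · rw [interior_Icc]
      exact fun z hz => (hasDerivAt_sinc_inv hz.1 hz.2).differentiableAt.differentiableWithinAt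
    · rw [interior_Icc]
      intro z hz
      rw [(hasDerivAt_sinc_inv hz.1 hz.2).deriv]
      have hcos : 0 < Real.cos z := Real.cos_pos_of_mem_Ioo
        ⟨by linarith [hz.1, Real.pi_gt_three], by linarith [hz.2, Real.pi_gt_three]⟩
      have h := Real.lt_tan hz.1 (by linarith [hz.2, Real.pi_gt_three])
      rw [Real.tan_eq_sin_div_cos, lt_div_iff₀ hcos] at h
      exact div_nonneg (by linarith) (by positivity)
  -- Together with monotonicity of `1 / sinc` this bounds its increments by twice those of `-cos`.
  have hanti : AntitoneOn (fun y => (Real.sinc y)⁻¹ + 2 * Real.cos y) (Icc 0 1) := by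
    have hd {z : ℝ} (hz : z ∈ Ioo (0 : ℝ) 1) :=
      (hasDerivAt_sinc_inv hz.1 hz.2).add ((Real.hasDerivAt_cos z).const_mul 2)
    refine antitoneOn_of_deriv_nonpos (convex_Icc 0 1) (continuousOn_sinc_inv.add
      (by fun_prop)) ?_ ?_
    · rw [interior_Icc]
      exact fun z hz => (hd hz).differentiableAt.differentiableWithinAt
    · rw [interior_Icc]
      intro z hz
      have hz' : deriv (fun y => (Real.sinc y)⁻¹ + 2 * Real.cos y) z = _ := (hd hz).deriv
      rw [hz']
      have h1 := three_quarters_mul_le_sin hz.1 hz.2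
      have h2 := Real.one_sub_sq_div_two_le_cos (x := z)
      have h3 := Real.sin_lt hz.1
      have hs : 0 < Real.sin z := lt_of_lt_of_le (by linarith [hz.1]) h1
      have h4 : (3 / 4 * z) ^ 3 ≤ Real.sin z ^ 3 := pow_le_pow_left₀ (by linarith [hz.1]) h1 3
      have h5 : 0 < z ^ 3 := pow_pos hz.1 3
      -- The left side is at most `z³ / 2`, while `2 sin³ z ≥ 2 (3z/4)³ = 27 z³ / 32`.
      have h6 : Real.sin z - z * Real.cos z ≤ 2 * Real.sin z * Real.sin z ^ 2 := by
        nlinarith [mul_le_mul_of_nonneg_left h2 hz.1.le]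
      have h7 := (div_le_iff₀ (pow_pos hs 2)).2 h6
      linarith
  wlog hxy : x ≤ y generalizing x y
  · rw [abs_sub_comm, abs_sub_comm (Real.cos x)]
    exact this hy hx (le_of_not_ge hxy)
  have h1 := hmono hx hy hxy
  have h2 := hanti hx hy hxy
  simp only at h1 h2
  have h3 : Real.cos y ≤ Real.cos x := Real.cos_le_cos_of_nonneg_of_le_pi hx.1
    (by linarith [hy.2, Real.pi_gt_three]) hxy
  rw [abs_of_nonpos (by linarith), abs_of_nonneg (by linarith)]
  linarith

/-- Half-angle formulas. In this form `α` involves only `1 / sinc` and the cosine, both Lipschitz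
functions of the rotation. -/
theorem alpha_eq {x : ℝ} (h0 : 0 < x) (h1 : x ≤ 1) :
    alpha x = (Real.sinc x)⁻¹ * (1 + Real.cos x) / 2 := by
  have hx : x = 2 * (x / 2) := by ring
  have hs : Real.sin (x / 2) ≠ 0 :=
    (Real.sin_pos_of_pos_of_lt_pi (by linarith) (by linarith [Real.pi_gt_three])).ne'
  have hc : Real.cos (x / 2) ≠ 0 := (Real.cos_pos_of_mem_Ioo
    ⟨by linarith [Real.pi_gt_three], by linarith [Real.pi_gt_three]⟩).ne'
  have hcos : Real.cos x = 2 * Real.cos (x / 2) ^ 2 - 1 := by rw [← Real.cos_two_mul, ← hx]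
  have hsin : Real.sin x = 2 * Real.sin (x / 2) * Real.cos (x / 2) := by
    rw [← Real.sin_two_mul, ← hx]
  rw [alpha, Real.cot_eq_cos_div_sin, Real.sinc_of_ne_zero h0.ne', hcos, hsin]
  field_simp
  ring

/-! ### The logarithm near the identity -/

/-- The vector `sin φ • n` of a rotation by the angle `φ` about the unit vector `n`. -/
def rotSin (R : Mat3) : Fin 3 → ℝ := unskew ((1 / 2 : ℝ) • (R - Rᵀ))

/-- This is `sin² φ = 1 - cos² φ`. It follows from the column norms of `R` and from the diagonal of
`adj R = Rᵀ`, which expresses the principal minors. -/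
theorem rotSin_dotProduct_self {R : Mat3} (hR : R ∈ Matrix.specialOrthogonalGroup (Fin 3) ℝ) :
    rotSin R ⬝ᵥ rotSin R = 1 - ((R.trace - 1) / 2) ^ 2 := by
  have hdet : R.det = 1 := (Matrix.mem_specialOrthogonalGroup_iff.1 hR).2
  have hmul := transpose_mul_self_of_mem hR
  have hadj : R.adjugate = Rᵀ := by
    have h1 : R.adjugate * R = 1 := by rw [Matrix.adjugate_mul, hdet, one_smul]
    calc R.adjugate = R.adjugate * (R * Rᵀ) := by
          rw [mul_transpose_self_of_mem hR, Matrix.mul_one]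
      _ = Rᵀ := by rw [← Matrix.mul_assoc, h1, Matrix.one_mul]
  have hdiag (i) := congrFun (congrFun hmul i) i
  have hminor (i) := congrFun (congrFun hadj i) i
  have e0 := hdiag 0
  have e1 := hdiag 1
  have e2 := hdiag 2
  have m0 := hminor 0
  have m1 := hminor 1
  have m2 := hminor 2
  rw [Matrix.adjugate_fin_three] at m0 m1 m2
  simp [Matrix.mul_apply, Fin.sum_univ_three] at e0 e1 e2 m0 m1 m2
  simp only [rotSin, unskew, dotProduct, Fin.sum_univ_three, Matrix.trace, Matrix.diag_apply,
    Matrix.sub_apply, Matrix.smul_apply, Matrix.transpose_apply, smul_eq_mul]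
  simp
  linear_combination (e0 + e1 + e2) / 4 + (m0 + m1 + m2) / 2

variable {X : Mat4}

theorem rotAngle_bounds (hX : X ∈ nearOne (1 / 10)) :
    (rotAngle (rot X)) ∈ Icc (0 : ℝ) 1 ∧ Real.cos (rotAngle (rot X)) = ((rot X).trace - 1) / 2 ∧
      Real.sin (rotAngle (rot X)) ^ 2 = rotSin (rot X) ⬝ᵥ rotSin (rot X) := by
  have hsq := rotSin_dotProduct_self (rot_mem hX.1)
  have hnn : 0 ≤ rotSin (rot X) ⬝ᵥ rotSin (rot X) :=
    Finset.sum_nonneg fun i _ => mul_self_nonneg _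
  -- Diagonal entries are at least `9/10`; the value `5/9` is an upper bound of `cos 1` and so
  -- forces `φ ≤ 1`.
  have hlow : 5 / 9 ≤ ((rot X).trace - 1) / 2 := by
    have h (i : Fin 3) := (abs_le.1 (hX.2 (Sum.inl i) (Sum.inl i))).1
    have h' (i : Fin 3) : (X - 1) (Sum.inl i) (Sum.inl i) = rot X i i - 1 := by
      simp [rot, Matrix.toBlocks₁₁]
    have h0 := h 0
    have h1 := h 1
    have h2 := h 2
    rw [h'] at h0 h1 h2
    simp only [Matrix.trace, Matrix.diag_apply, Fin.sum_univ_three]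
    linarith
  set c := ((rot X).trace - 1) / 2 with hc
  have hup : c ≤ 1 := by nlinarith
  have hcos : Real.cos (rotAngle (rot X)) = c := Real.cos_arccos (by linarith) hup
  refine ⟨⟨Real.arccos_nonneg _, ?_⟩, hcos, ?_⟩
  · calc Real.arccos c ≤ Real.arccos (Real.cos 1) :=
          Real.arccos_le_arccos (Real.cos_one_le.trans hlow)
      _ = 1 := Real.arccos_cos zero_le_one (by linarith [Real.pi_gt_three])
  · rw [hsq, Real.sin_sq, hcos]

theorem sin_eq_mul_sinc (x : ℝ) : Real.sin x = x * Real.sinc x := by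
  rcases eq_or_ne x 0 with h | h
  · simp [h]
  · rw [Real.sinc_of_ne_zero h, mul_div_cancel₀ _ h]

/-- Replaces `φ / sin φ` by `1 / sinc φ`, which is regular at `φ = 0`; there `rotSin` vanishes and
the two sides agree. -/
theorem logSO3_eq (hX : X ∈ nearOne (1 / 10)) :
    logSO3 (rot X) = (Real.sinc (rotAngle (rot X)))⁻¹ • rotSin (rot X) := by
  obtain ⟨hφ, -, hsq⟩ := rotAngle_bounds hX
  set φ := rotAngle (rot X)
  have hlin (a : ℝ) : unskew (a • (rot X - (rot X)ᵀ)) = (2 * a) • rotSin (rot X) := by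
    ext i
    fin_cases i <;> simp [unskew, rotSin] <;> ring
  rw [logSO3, hlin]
  rcases eq_or_ne φ 0 with h | h
  · have h0 : rotSin (rot X) = 0 := by
      rw [h, Real.sin_zero] at hsq
      exact dotProduct_self_eq_zero.1 (by rw [← hsq]; ring)
    rw [h0, smul_zero, smul_zero]
  · rw [Real.sinc_of_ne_zero h, inv_div]
    congr 1
    change 2 * (φ / (2 * Real.sin φ)) = φ / Real.sin φ
    rw [mul_div_assoc', mul_div_mul_left _ _ two_ne_zero]

theorem logSO3_sq (hX : X ∈ nearOne (1 / 10)) :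
    ∑ i, logSO3 (rot X) i ^ 2 = rotAngle (rot X) ^ 2 := by
  obtain ⟨hφ, -, hsq⟩ := rotAngle_bounds hX
  have h1 : ∑ i, logSO3 (rot X) i ^ 2 = (Real.sinc (rotAngle (rot X)))⁻¹ ^ 2 *
      (rotSin (rot X) ⬝ᵥ rotSin (rot X)) := by
    rw [logSO3_eq hX, dotProduct, Finset.mul_sum]
    exact Finset.sum_congr rfl fun i _ => by simp only [Pi.smul_apply, smul_eq_mul]; ring
  have h2 := (sinc_pos hφ.1 hφ.2).ne'
  rw [h1, ← hsq, sin_eq_mul_sinc]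
  field_simp

theorem euclNorm_logSO3 (hX : X ∈ nearOne (1 / 10)) :
    euclNorm (logSO3 (rot X)) = rotAngle (rot X) := by
  rw [euclNorm, logSO3_sq hX, Real.sqrt_sq (rotAngle_bounds hX).1.1]

/-- The coefficient `1 - (φ / 2) cot (φ / 2)` as a function of the rotation. -/
def oneSubAlpha (R : Mat3) : ℝ :=
  1 - (Real.sinc (rotAngle R))⁻¹ * (1 + (R.trace - 1) / 2) / 2

theorem Ainv_logSO3 (hX : X ∈ nearOne (1 / 10)) (i j : Fin 3) :
    Ainv (logSO3 (rot X)) i j = (1 : Mat3) i j - 1 / 2 * skew (logSO3 (rot X)) i j +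
      oneSubAlpha (rot X) / rotAngle (rot X) ^ 2 *
        (skew (logSO3 (rot X)) * skew (logSO3 (rot X))) i j := by
  obtain ⟨hφ, hcos, -⟩ := rotAngle_bounds hX
  rw [Ainv, euclNorm_logSO3 hX]
  simp only [Matrix.add_apply, Matrix.sub_apply, Matrix.smul_apply, smul_eq_mul]
  rcases hφ.1.eq_or_lt with h | h
  -- At `φ = 0` the numerators differ, but both quotients are zero by the convention for division by
  -- zero.
  · rw [← h]; simp
  · rw [alpha_eq h hφ.2, hcos, oneSubAlpha]

theorem abs_sinc_inv_sub_one_le (hX : X ∈ nearOne (1 / 10)) :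
    |(Real.sinc (rotAngle (rot X)))⁻¹ - 1| ≤ 2 * (1 - Real.cos (rotAngle (rot X))) := by
  have h := abs_sinc_inv_sub_le (rotAngle_bounds hX).1 (left_mem_Icc.2 zero_le_one)
  rwa [Real.sinc_zero, inv_one, Real.cos_zero, abs_sub_comm (Real.cos _),
    abs_of_nonneg (sub_nonneg.2 (Real.cos_le_one _))] at h

/-- With `A = 1 / sinc φ`, the coefficient is `(1 - A) + A (1 - cos φ) / 2`, where `|1 - A| ≤ 2 (1 -
cos φ) ≤ φ²` and `A ≤ 2`. -/
theorem abs_oneSubAlpha_le (hX : X ∈ nearOne (1 / 10)) :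
    |oneSubAlpha (rot X)| ≤ 3 * rotAngle (rot X) ^ 2 := by
  obtain ⟨hφ, hcos, -⟩ := rotAngle_bounds hX
  have h1 := abs_sinc_inv_sub_one_le hX
  have h2 := Real.one_sub_sq_div_two_le_cos (x := rotAngle (rot X))
  have h3 := sinc_inv_le_two hφ.1 hφ.2
  have h4 := (inv_pos.2 (sinc_pos hφ.1 hφ.2)).le
  have h5 := Real.cos_le_one (rotAngle (rot X))
  rw [oneSubAlpha, ← hcos]
  set A := (Real.sinc (rotAngle (rot X)))⁻¹
  set c := Real.cos (rotAngle (rot X))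
  have h6 := abs_le.1 h1
  exact abs_le.2 ⟨by nlinarith, by nlinarith⟩

theorem BddLip.trace_rot : BddLip (nearOne (1 / 10)) fun X => ((rot X).trace - 1) / 2 := by
  simp only [div_eq_mul_inv, Matrix.trace, Matrix.diag_apply]
  exact ((BddLip.sum _ fun i _ => BddLip.entry _ (Sum.inl i) (Sum.inl i)).sub
    (BddLip.const 1)).mul (BddLip.const _)

/-- `arccos` is not Lipschitz at `1`, but the composite with `1 / sinc` is, so it is estimated as a
function of `cos φ`. -/
theorem BddLip.sinc_inv :
    BddLip (nearOne (1 / 10)) fun X => (Real.sinc (rotAngle (rot X)))⁻¹ := by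
  refine BddLip.comp (T := {c | c ∈ Icc (-1 : ℝ) 1 ∧ Real.arccos c ≤ 1})
    (u := fun c => (Real.sinc (Real.arccos c))⁻¹) zero_le_two zero_le_two (fun c hc => ?_)
    (fun c hc c' hc' => ?_) BddLip.trace_rot fun X hX => ?_
  · rw [abs_of_pos (inv_pos.2 (sinc_pos (Real.arccos_nonneg c) hc.2))]
    exact sinc_inv_le_two (Real.arccos_nonneg c) hc.2
  · have h := abs_sinc_inv_sub_le ⟨Real.arccos_nonneg c, hc.2⟩ ⟨Real.arccos_nonneg c', hc'.2⟩
    rwa [Real.cos_arccos hc.1.1 hc.1.2, Real.cos_arccos hc'.1.1 hc'.1.2] at h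
  · obtain ⟨hφ, hcos, -⟩ := rotAngle_bounds hX
    refine ⟨?_, hφ.2⟩
    rw [← hcos]
    exact Real.cos_mem_Icc _

theorem BddLip.rotSin (i) : BddLip (nearOne (1 / 10)) fun X => GIC.rotSin (rot X) i :=
  BddLip.unskew (A := fun X => (1 / 2 : ℝ) • (rot X - (rot X)ᵀ)) (fun a b =>
    (BddLip.const (1 / 2 : ℝ)).mul ((BddLip.entry _ (Sum.inl a) (Sum.inl b)).sub
      (BddLip.entry _ (Sum.inl b) (Sum.inl a)))) i

theorem BddLip.logSO3 (i) : BddLip (nearOne (1 / 10)) fun X => GIC.logSO3 (rot X) i :=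
  (BddLip.sinc_inv.mul (BddLip.rotSin i)).congr fun X hX => by
    rw [logSO3_eq hX, Pi.smul_apply, smul_eq_mul]

theorem BddLip.skew_logSO3 (i j) :
    BddLip (nearOne (1 / 10)) fun X => skew (GIC.logSO3 (rot X)) i j := by
  fin_cases i <;> fin_cases j
  exacts [BddLip.const 0, (BddLip.logSO3 2).neg, BddLip.logSO3 1, BddLip.logSO3 2, BddLip.const 0,
    (BddLip.logSO3 0).neg, (BddLip.logSO3 1).neg, BddLip.logSO3 0, BddLip.const 0]

theorem abs_logSO3_le (hX : X ∈ nearOne (1 / 10)) (i) :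
    |logSO3 (rot X) i| ≤ rotAngle (rot X) := by
  refine abs_le_of_sq_le_sq ?_ (rotAngle_bounds hX).1.1
  rw [← logSO3_sq hX]
  exact Finset.single_le_sum (f := fun i => logSO3 (rot X) i ^ 2)
    (fun j _ => sq_nonneg _) (Finset.mem_univ i)

theorem abs_skew_logSO3_le (hX : X ∈ nearOne (1 / 10)) (i j) :
    |skew (logSO3 (rot X)) i j| ≤ rotAngle (rot X) := by
  have h := abs_logSO3_le hX
  have h0 := (rotAngle_bounds hX).1.1
  fin_cases i <;> fin_cases j <;> simp [skew, h, h0]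

theorem abs_skew_logSO3_mul_le (hX : X ∈ nearOne (1 / 10)) (i j) :
    |(skew (logSO3 (rot X)) * skew (logSO3 (rot X))) i j| ≤ 3 * rotAngle (rot X) ^ 2 := by
  rw [Matrix.mul_apply]
  refine (Finset.abs_sum_le_sum_abs _ _).trans ?_
  calc ∑ k, |skew (logSO3 (rot X)) i k * skew (logSO3 (rot X)) k j|
      ≤ ∑ _k : Fin 3, rotAngle (rot X) * rotAngle (rot X) := Finset.sum_le_sum fun k _ => by
        rw [abs_mul]
        exact mul_le_mul (abs_skew_logSO3_le hX _ _) (abs_skew_logSO3_le hX _ _) (abs_nonneg _)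
          (rotAngle_bounds hX).1.1
    _ = 3 * rotAngle (rot X) ^ 2 := by simp; ring

/-- The quotient by `φ²` need not be Lipschitz on its own. It is multiplied by `ψ̂²`, and both this
factor and the numerator are at most `3 φ²`, which is the situation of `BddLip.div_mul`. -/
theorem BddLip.Ainv_logSO3 (i j) :
    BddLip (nearOne (1 / 10)) fun X => Ainv (GIC.logSO3 (rot X)) i j := by
  refine BddLip.congr (((BddLip.const _).sub ((BddLip.const _).mul
    (BddLip.skew_logSO3 i j))).add ?_) fun X hX => GIC.Ainv_logSO3 hX i j
  refine BddLip.div_mul (c := 3) ?_ (BddLip.matrix_mul (A := fun X => skew (GIC.logSO3 (rot X)))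
    (B := fun X => skew (GIC.logSO3 (rot X))) BddLip.skew_logSO3 BddLip.skew_logSO3 i j) ?_
    (fun X _ => sq_nonneg _) (by norm_num) (fun X hX => abs_oneSubAlpha_le hX)
    fun X hX => abs_skew_logSO3_mul_le hX i j
  · simp only [oneSubAlpha, div_eq_mul_inv _ (2 : ℝ)]
    exact (BddLip.const 1).sub ((BddLip.sinc_inv.mul ((BddLip.const 1).add (by
      simpa only [div_eq_mul_inv] using BddLip.trace_rot))).mul (BddLip.const _))
  · refine (BddLip.sum Finset.univ fun i _ => (BddLip.logSO3 i).mul (BddLip.logSO3 i)).congr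
      fun X hX => ?_
    rw [← logSO3_sq hX]
    exact Finset.sum_congr rfl fun i _ => sq _

theorem BddLip.logSE3 (i) : BddLip (nearOne (1 / 10)) fun X => GIC.logSE3 X i := by
  rcases i with i | i
  · exact BddLip.mulVec (A := fun X => Ainv (GIC.logSO3 (rot X))) (y := pos) BddLip.Ainv_logSO3
      (fun j => BddLip.entry _ _ _) i
  · exact BddLip.logSO3 i

theorem rotSin_eq_ell (i) : rotSin (rot X) i = ell X (Sum.inr i) := rfl

/-- For `cos φ ≥ 0` one has `1 - cos φ ≤ sin² φ`, and `sin φ` is the length of the rotational part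
of `ell`. -/
theorem SmallOn.one_sub_cos :
    SmallOn (nearOne (1 / 10)) 2 fun X => 1 - Real.cos (rotAngle (rot X)) := by
  obtain ⟨c, hc, hb⟩ := SmallOn.sum (S := nearOne (1 / 10)) (k := 2) Finset.univ
    fun (i : Fin 3) _ => (SmallOn.ell (Sum.inr i)).mul (SmallOn.ell (Sum.inr i))
  refine ⟨c, hc, fun X hX => le_trans ?_ (hb X hX)⟩
  obtain ⟨hφ, -, hsq⟩ := rotAngle_bounds hX
  have h1 : ∑ i : Fin 3, GIC.ell X (Sum.inr i) * GIC.ell X (Sum.inr i) =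
      Real.sin (rotAngle (rot X)) ^ 2 := hsq.symm
  have h2 := Real.cos_le_one (rotAngle (rot X))
  have h3 : 0 ≤ Real.cos (rotAngle (rot X)) := Real.cos_nonneg_of_mem_Icc
    ⟨by linarith [hφ.1, Real.pi_gt_three], by linarith [hφ.2, Real.pi_gt_three]⟩
  simp only [h1]
  rw [abs_of_nonneg (sub_nonneg.2 h2), abs_of_nonneg (sq_nonneg _), Real.sin_sq]
  nlinarith

theorem SmallOn.logSO3_sub_ell (i) :
    SmallOn (nearOne (1 / 10)) 2 fun X => GIC.logSO3 (rot X) i - GIC.ell X (Sum.inr i) := by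
  obtain ⟨c, hc, hb⟩ := SmallOn.one_sub_cos
  have h1 : SmallOn (nearOne (1 / 10)) 2 fun X => (Real.sinc (rotAngle (rot X)))⁻¹ - 1 :=
    ⟨2 * c, by positivity, fun X hX => (abs_sinc_inv_sub_one_le hX).trans (by
      have := (le_abs_self _).trans (hb X hX)
      linarith)⟩
  obtain ⟨a, ha, ha', -⟩ := BddLip.rotSin i
  refine (SmallOn.bdd_mul ha ha' h1).congr fun X hX => ?_
  rw [logSO3_eq hX, Pi.smul_apply, smul_eq_mul, ← rotSin_eq_ell]
  ring

theorem SmallOn.logSO3 (i) : SmallOn (nearOne (1 / 10)) 1 fun X => GIC.logSO3 (rot X) i := by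
  obtain ⟨a, ha, ha', -⟩ := BddLip.sinc_inv
  refine (SmallOn.bdd_mul ha ha' (SmallOn.ell (Sum.inr i))).congr fun X hX => ?_
  rw [logSO3_eq hX, Pi.smul_apply, smul_eq_mul, ← rotSin_eq_ell]

theorem SmallOn.skew_logSO3 (i j) :
    SmallOn (nearOne (1 / 10)) 1 fun X => skew (GIC.logSO3 (rot X)) i j := by
  fin_cases i <;> fin_cases j
  exacts [SmallOn.zero, (SmallOn.logSO3 2).neg, SmallOn.logSO3 1, SmallOn.logSO3 2, SmallOn.zero,
    (SmallOn.logSO3 0).neg, (SmallOn.logSO3 1).neg, SmallOn.logSO3 0, SmallOn.zero]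

/-- `ψ` is of first order and the coefficient of `ψ̂²` is bounded by three. -/
theorem SmallOn.Ainv_sub_one (i j) :
    SmallOn (nearOne (1 / 10)) 1 fun X => Ainv (GIC.logSO3 (rot X)) i j - (1 : Mat3) i j := by
  have h1 : ∀ X ∈ nearOne (1 / 10),
      |oneSubAlpha (rot X) / rotAngle (rot X) ^ 2| ≤ 3 := fun X hX => by
    rw [abs_div, abs_of_nonneg (sq_nonneg (rotAngle (rot X)))]
    exact div_le_of_le_mul₀ (sq_nonneg _) (by norm_num) (abs_oneSubAlpha_le hX)
  have h2 : SmallOn (nearOne (1 / 10)) 1 fun X =>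
      (skew (GIC.logSO3 (rot X)) * skew (GIC.logSO3 (rot X))) i j := by
    simp only [Matrix.mul_apply]
    refine SmallOn.sum _ fun k _ => SmallOn.bdd_mul zero_le_one (fun X hX => ?_)
      (SmallOn.skew_logSO3 k j)
    exact (abs_skew_logSO3_le hX i k).trans (rotAngle_bounds hX).1.2
  refine (((SmallOn.skew_logSO3 i j).const_mul (-1 / 2)).add
    (SmallOn.bdd_mul (by norm_num) h1 h2)).congr fun X hX => ?_
  rw [Ainv_logSO3 hX]
  ring

/-- The stiffness of GIC-2 at the identity is therefore `K_ξ` itself. -/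
theorem SmallOn.logSE3_sub_ell (i) :
    SmallOn (nearOne (1 / 10)) 2 fun X => GIC.logSE3 X i - GIC.ell X i := by
  rcases i with i | i
  · refine (SmallOn.sum Finset.univ fun j _ => (SmallOn.Ainv_sub_one i j).mul
      (SmallOn.ell (Sum.inl j))).congr fun X _ => ?_
    have h1 : GIC.logSE3 X (Sum.inl i) = (Ainv (GIC.logSO3 (rot X)) *ᵥ pos X) i := rfl
    have h2 : GIC.ell X (Sum.inl i) = ((1 : Mat3) *ᵥ pos X) i := by rw [Matrix.one_mulVec]; rfl
    rw [h1, h2, ← Pi.sub_apply, ← Matrix.sub_mulVec]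
    rfl
  · exact SmallOn.logSO3_sub_ell i

theorem exists_elasticForce_force2 {Kξ : Mat6} (hK : Kξ.PosDef) :
    ∃ K F r C L, ElasticForce (force2 Kξ) K F r C L := by
  refine ⟨Kξ, fun X => Kξ *ᵥ logSE3 X, 1 / 10, ElasticForce.of_nearOne hK (by norm_num)
    (fun _ _ _ _ => rfl) (fun i => ?_) fun i => ?_⟩
  · refine (SmallOn.sum Finset.univ fun j _ =>
      (SmallOn.logSE3_sub_ell j).const_mul (Kξ i j)).congr fun X _ => ?_
    rw [← Matrix.mulVec_sub]
    rfl
  · exact BddLip.mulVec (A := fun _ => Kξ) (fun _ _ => BddLip.const _) BddLip.logSE3 i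

end GIC

end

/-! ### Both control laws -/

theorem theorem2 (𝓜 : GIC.Manipulator) (D : Set GIC.Mat4) (gd : ℝ → GIC.Mat4) (Vd : ℝ → GIC.Vec6)
    (hadm : GIC.Admissible 𝓜 D gd Vd)
    (Kp KR : GIC.Mat3) (Kξ Kd : GIC.Mat6)
    (hKp : Kp.PosDef) (hKR : KR.PosDef) (hKξ : Kξ.PosDef) (hKd : Kd.PosDef) :
    GIC.AsymptoticallyStable 𝓜 D gd Vd (GIC.force1 Kp KR) Kd ∧
      GIC.AsymptoticallyStable 𝓜 D gd Vd (GIC.force2 Kξ) Kd := by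
  obtain ⟨K₁, F₁, r₁, C₁, L₁, h₁⟩ := GIC.exists_elasticForce_force1 hKp hKR
  obtain ⟨K₂, F₂, r₂, C₂, L₂, h₂⟩ := GIC.exists_elasticForce_force2 hKξ
  exact ⟨GIC.asymptoticallyStable_of_elasticForce hadm h₁ hKd,
    GIC.asymptoticallyStable_of_elasticForce hadm h₂ hKd⟩
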